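/- Throughout $\alpha\in(0,\infty)$. For a set $\mathcal F$ of probability measures on a measurable space, let $C_{\alpha}(\mathcal F)=\sup_{p}I_{\alpha}(p;\mathcal F)$ be the Rényi capacity of order $\alpha$. The supremum is over the probability mass functions $p$ on finite subsets of $\mathcal F$. The Rényi information is $I_{\alpha}(p;\mathcal F)=\frac{\alpha}{\alpha-1}\ln\int\big(\sum_W p(W)(\tfrac{dW}{d\nu})^{\alpha}\big)^{1/\alpha}d\nu$ for $\alpha\neq1$ (for any $\nu$ dominating the support of $p$), and $I_1$ is the mutual information. Let $D_{\alpha}(W\|Q)$ be the Rényi divergence ($D_1$ is the Kullback–Leibler divergence). If $C_\alpha(\mathcal F)<\infty$, the Rényi center of order $\alpha$ of $\mathcal F$ is the unique probability measure $Q$ with $\sup_{W\in\mathcal F}D_{\alpha}(W\|Q)=C_{\alpha}(\mathcal F)$. Let $T>0$. For a nonnegative integrable function $f$ on $(0,T]$ let $P_f$ be the law, on the space of nondecreasing, right-continuous, integer valued functions on $(0,T]$ with the $\sigma$-algebra generated by the evaluations, of the Poisson point process with the deterministic intensity function $f$. For a constant $\gamma\ge0$, $P_\gamma$ is the law with constant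 intensity $\gamma$. For $0\le A\le B<\infty$ and $c\in[A,B]$ let $\mathcal P_{c}$, $\mathcal P_{\le c}$, $\mathcal P_{\ge c}$ and $\mathcal P$ be the sets of all $P_f$ with $A\le f\le B$ and, respectively, $\frac1T\int_0^T f\,dt=c$, $\frac1T\int_0^T f\,dt\le c$, $\frac1T\int_0^T f\,dt\ge c$, and no further constraint. Conventions: $0^0=1$, $0\ln\frac{x}{y}=0$ (also when $x$ or $y$ is $0$), $0\cdot\infty=0$. For $A=B$ every formula in (1)–(3) is given its limit as $B\downarrow A$: the intensities $p_{\alpha,c}$, $p_\alpha$ and the mean $c_\alpha$ are $A$, and the capacities are $0$. The two-term expressions with $D_\alpha$ in (1) and (3) are then $0$, since their divergences vanish. Define $$p_{\alpha,c}=\Big(\tfrac{c-A}{B-A}B^{\alpha}+\tfrac{B-c}{B-A}A^{\alpha}\Big)^{1/\alpha},\qquad c_{\alpha}=\begin{cases}\alpha^{\frac{\alpha}{1-\alpha}}\big(\tfrac{B-A}{B^\alpha-A^\alpha}\big)^{\frac1{1-\alpha}}+\tfrac{AB^\alpha-BA^\alpha}{B^\alpha-A^\alpha}&\alpha\ne1\\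 e^{-1}B^{\frac{B}{B-A}}A^{-\frac{A}{B-A}}&\alpha=1,\end{cases}$$ $$p_\alpha=\begin{cases}\alpha^{\frac{1}{1-\alpha}}\big(\tfrac{B-A}{B^\alpha-A^\alpha}\big)^{\frac1{1-\alpha}}&\alpha\ne1\\ e^{-1}B^{\frac{B}{B-A}}A^{-\frac{A}{B-A}}&\alpha=1.\end{cases}$$ Then $c_\alpha\in[A,B]$, and the following hold. (1) For every $c\in[A,B]$, $$C_\alpha(\mathcal P_c)=\begin{cases}\frac{\alpha}{\alpha-1}(p_{\alpha,c}-c)\,T&\alpha\neq1\\ \big(\tfrac{c-A}{B-A}B\ln\tfrac Bc+\tfrac{B-c}{B-A}A\ln\tfrac Ac\big)T&\alpha=1,\end{cases}$$ the Rényi center of $\mathcal P_c$ is $P_{p_{\alpha,c}}$, and $C_\alpha(\mathcal P_c)=\frac{c-A}{B-A}D_\alpha(P_B\|P_{p_{\alpha,c}})+\frac{B-c}{B-A}D_\alpha(P_A\|P_{p_{\alpha,c}})$. (2) For every $c\in[A,B]$, $\mathcal P_{\le c}$ has the same Rényi capacity and center of order $\alpha$ as $\mathcal P_{\min(c,c_\alpha)}$,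 and $\mathcal P_{\ge c}$ has the same Rényi capacity and center of order $\alpha$ as $\mathcal P_{\max(c,c_\alpha)}$; these are given explicitly by (1). (3) $\mathcal P$ has the same Rényi capacity and center of order $\alpha$ as $\mathcal P_{c_\alpha}$. Explicitly, $$C_\alpha(\mathcal P)=\begin{cases}\Big(\big(\tfrac{\alpha(B-A)}{B^\alpha-A^\alpha}\big)^{\frac1{1-\alpha}}-\tfrac{\alpha}{\alpha-1}\tfrac{AB^\alpha-BA^\alpha}{B^\alpha-A^\alpha}\Big)T&\alpha\ne1\\ \Big(e^{-1}B^{\frac{B}{B-A}}A^{-\frac{A}{B-A}}-\tfrac{AB}{B-A}\ln\tfrac BA\Big)T&\alpha=1,\end{cases}$$ the center is $P_{p_\alpha}$, $p_\alpha=p_{\alpha,c_\alpha}$, and $C_\alpha(\mathcal P)=\frac{c_\alpha-A}{B-A}D_\alpha(P_B\|P_{p_\alpha})+\frac{B-c_\alpha}{B-A}D_\alpha(P_A\|P_{p_\alpha})$. (4) Let $A\ge0$, let $g$ be Lebesgue integrable on $(0,T]$ with $g\ge A$, and let $\mathcal P_{A,g}$ be the set of all $P_f$ with $A\le f(t)\le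 g(t)$ for all $t\in(0,T]$. Then $$C_\alpha(\mathcal P_{A,g})=\begin{cases}\int_0^T\Big[\big(\tfrac{\alpha(g-A)}{g^\alpha-A^\alpha}\big)^{\frac1{1-\alpha}}-\tfrac{\alpha}{\alpha-1}\tfrac{Ag^\alpha-gA^\alpha}{g^\alpha-A^\alpha}\Big]dt&\alpha\neq1\\ \int_0^T\Big[e^{-1}g^{\frac{g}{g-A}}A^{-\frac{A}{g-A}}-\tfrac{Ag}{g-A}\ln\tfrac gA\Big]dt&\alpha=1,\end{cases}$$ and the Rényi center is $P_{p_\alpha(\cdot)}$ with $$p_\alpha(t)=\begin{cases}\alpha^{\frac1{1-\alpha}}\big(\tfrac{g(t)-A}{g(t)^\alpha-A^\alpha}\big)^{\frac1{1-\alpha}}&\alpha\neq1\\ e^{-1}g(t)^{\frac{g(t)}{g(t)-A}}A^{-\frac{A}{g(t)-A}}&\alpha=1,\end{cases}$$ where at points with $g(t)=A$ the integrand is $0$ and $p_\alpha(t)=A$; the integrand and $p_\alpha(\cdot)$ are integrable on $(0,T]$. -/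

import Mathlib

open MeasureTheory Set
open scoped ENNReal NNReal

namespace RenyiPoisson

noncomputable section

/-! ### Rényi information, divergence, capacity and center (positive real orders) -/

section General

variable {Ω : Type*} [MeasurableSpace Ω]

/-- A prior on `F`: a probability mass function on a finite subset of the set `F` of measures. -/
structure Prior (F : Set (Measure Ω)) where
  /-- the mass `p(W)` of each measure `W` -/
  mass : Measure Ω →₀ ℝ≥0
  support_subset : (mass.support : Set (Measure Ω)) ⊆ F
  sum_eq_one : ∑ W ∈ mass.support, mass W = 1

/-- The mixture `μ_{1,p} = ∑_W p(W) W`; every `W` in the support of `p` is absolutely continuous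
with respect to it. -/
def Prior.mixture {F : Set (Measure Ω)} (p : Prior F) : Measure Ω :=
  ∑ W ∈ p.mass.support, p.mass W • W

/-- The mean measure `μ_{α,p}` of order `α ∈ (0,∞)`: its density is the weighted power mean of order
`α` of the densities of the `W`'s. The reference measure used here is `μ_{1,p}`; the mean measure
does not depend on the choice of the reference measure. -/
def Prior.meanMeasure {F : Set (Measure Ω)} (p : Prior F) (α : ℝ) : Measure Ω :=
  p.mixture.withDensity fun y ↦
    (∑ W ∈ p.mass.support, (p.mass W : ℝ≥0∞) * (W.rnDeriv p.mixture y) ^ α) ^ (1 / α)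

/-- The posterior `π(W | y) = p(W) (dW / dμ_{1,p})(y)`. -/
def Prior.posterior {F : Set (Measure Ω)} (p : Prior F) (W : Measure Ω) (y : Ω) : ℝ :=
  (p.mass W : ℝ) * (W.rnDeriv p.mixture y).toReal

/-- The Rényi information of order `α ∈ (0,∞)` for the prior `p`: it is `α/(α-1) ln ‖μ_{α,p}‖` for
`α ≠ 1`, and the mutual information for `α = 1`. (For `α = 1` the integrand is bounded.) -/
def renyiInformation {F : Set (Measure Ω)} (α : ℝ) (p : Prior F) : EReal :=
  if α = 1 then
    ((∫ y, ∑ W ∈ p.mass.support,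
        p.posterior W y * Real.log (p.posterior W y / p.mass W) ∂p.mixture : ℝ) : EReal)
  else ((α / (α - 1) : ℝ) : EReal) * ENNReal.log (p.meanMeasure α univ)

/-- The Rényi capacity of order `α ∈ (0,∞)` of a set `F` of probability measures. -/
def renyiCapacity (α : ℝ) (F : Set (Measure Ω)) : EReal :=
  ⨆ p : Prior F, renyiInformation α p

/-- The Rényi divergence of order `α ∈ (0,∞)` between probability measures; it is the
Kullback–Leibler divergence for `α = 1`. The reference measure is `W + Q`. -/
def renyiDivergence (α : ℝ) (W Q : Measure Ω) : EReal :=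
  if α = 1 then (InformationTheory.klDiv W Q : EReal)
  else ((1 / (α - 1) : ℝ) : EReal) *
    ENNReal.log (∫⁻ y, (W.rnDeriv (W + Q) y) ^ α * (Q.rnDeriv (W + Q) y) ^ (1 - α) ∂(W + Q))

/-- The Rényi radius of `F` relative to `Q`. -/
def relativeRadius (α : ℝ) (F : Set (Measure Ω)) (Q : Measure Ω) : EReal :=
  ⨆ W ∈ F, renyiDivergence α W Q

/-- `Q` is the Rényi center of order `α` of `F`: the capacity of `F` is finite and `Q` is the unique
probability measure with `sup_{W ∈ F} D_α(W ‖ Q) = C_α(F)`. -/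
structure IsRenyiCenter (α : ℝ) (F : Set (Measure Ω)) (Q : Measure Ω) : Prop where
  capacity_lt_top : renyiCapacity α F < ⊤
  isProbabilityMeasure : IsProbabilityMeasure Q
  radius_eq : relativeRadius α F Q = renyiCapacity α F
  unique : ∀ Q' : Measure Ω, IsProbabilityMeasure Q' →
    relativeRadius α F Q' = renyiCapacity α F → Q' = Q

end General

/-! ### Poisson point processes on `(0,T]` -/

/-- Nondecreasing, right-continuous, integer valued functions on `(0,T]`. -/
def SamplePath (T : ℝ) : Type :=
  {N : Ioc (0 : ℝ) T → ℤ // Monotone N ∧ ∀ t, ContinuousWithinAt N (Ici t) t}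

/-- The σ-algebra generated by the evaluations `N ↦ N t`, `t ∈ (0,T]`. -/
instance (T : ℝ) : MeasurableSpace (SamplePath T) :=
  inferInstanceAs (MeasurableSpace
    {N : Ioc (0 : ℝ) T → ℤ // Monotone N ∧ ∀ t, ContinuousWithinAt N (Ici t) t})

/-- The counting path `t ↦ #{i | x i ≤ t}` of a finite family of arrival times. -/
def countingPath (T : ℝ) {n : ℕ} (x : Fin n → ℝ) : SamplePath T :=
  ⟨fun t ↦ ∑ i, if x i ≤ (t : ℝ) then 1 else 0, by
    intro s t hst
    refine Finset.sum_le_sum fun i _ ↦ ?_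
    have h : (s : ℝ) ≤ t := hst
    split_ifs with h1 h2
    · exact le_rfl
    · exact absurd (h1.trans h) h2
    · exact zero_le_one
    · exact le_rfl, by
    intro t
    refine tendsto_finsetSum _ fun i _ ↦ ?_
    by_cases h : x i ≤ (t : ℝ)
    · refine Filter.Tendsto.congr' (f₁ := fun _ ↦ (if x i ≤ (t : ℝ) then 1 else 0 : ℤ)) ?_
        tendsto_const_nhds
      filter_upwards [self_mem_nhdsWithin] with s hs
      have hs' : (t : ℝ) ≤ s := hs
      rw [if_pos h, if_pos (h.trans hs')]
    · refine Filter.Tendsto.congr' (f₁ := fun _ ↦ (if x i ≤ (t : ℝ) then 1 else 0 : ℤ)) ?_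
        tendsto_const_nhds
      have hlt : ∀ᶠ s : Ioc (0 : ℝ) T in nhdsWithin t (Ici t), (s : ℝ) < x i :=
        nhdsWithin_le_nhds (continuous_subtype_val.continuousAt.eventually_lt
          continuousAt_const (not_le.mp h))
      filter_upwards [hlt] with s hs
      rw [if_neg h, if_neg (not_le.mpr hs)]⟩

theorem measurable_countingPath (T : ℝ) (n : ℕ) :
    Measurable (countingPath T : (Fin n → ℝ) → SamplePath T) := by
  refine Measurable.subtype_mk (measurable_pi_lambda _ fun t ↦ ?_)
  refine Finset.measurable_sum _ fun i _ ↦ ?_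
  exact Measurable.ite (measurableSet_le (measurable_pi_apply i) measurable_const)
    measurable_const measurable_const

/-- The mean measure `f(t) dt` on `(0,T]` of the arrival times. -/
def intensityMeasure (T : ℝ) (f : ℝ → ℝ) : Measure ℝ :=
  (volume.restrict (Ioc 0 T)).withDensity fun t ↦ ENNReal.ofReal (f t)

/-- The law on the sample path space of the Poisson point process on `(0,T]` with the nonnegative
integrable intensity function `f`. Writing `m = f(t) dt` and `Λ = m((0,T])`, the number of arrivals
is Poisson with mean `Λ`, and given that it equals `n` the (unordered) arrival times are `n`
independent points with law `m / Λ`; so the part of the law with exactly `n` arrivals is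
`e^{-Λ} / n!` times the image of `m^{⊗ n}` under the counting map. -/
def poissonProcess (T : ℝ) (f : ℝ → ℝ) : Measure (SamplePath T) :=
  ENNReal.ofReal (Real.exp (-∫ t in Ioc 0 T, f t)) •
    Measure.sum fun n : ℕ ↦ ((Nat.factorial n : ℝ≥0∞)⁻¹) •
      (Measure.pi fun _ : Fin n ↦ intensityMeasure T f).map (countingPath T)

theorem isProbabilityMeasure_poissonProcess (T : ℝ) (f : ℝ → ℝ) (hf : IntegrableOn f (Ioc 0 T))
    (h0 : ∀ t ∈ Ioc 0 T, 0 ≤ f t) : IsProbabilityMeasure (poissonProcess T f) := by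
  have hm : intensityMeasure T f univ = ENNReal.ofReal (∫ t in Ioc 0 T, f t) := by
    rw [intensityMeasure, withDensity_apply _ MeasurableSet.univ, Measure.restrict_univ,
      ofReal_integral_eq_lintegral_ofReal hf
        ((ae_restrict_iff' measurableSet_Ioc).2 (Filter.Eventually.of_forall h0))]
  have hΛ : 0 ≤ ∫ t in Ioc 0 T, f t := setIntegral_nonneg measurableSet_Ioc h0
  set Λ := ∫ t in Ioc 0 T, f t with hL
  have : IsFiniteMeasure (intensityMeasure T f) := ⟨by rw [hm]; exact ENNReal.ofReal_lt_top⟩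
  constructor
  have hterm : ∀ n : ℕ, (((Nat.factorial n : ℝ≥0∞)⁻¹) •
      (Measure.pi fun _ : Fin n ↦ intensityMeasure T f).map (countingPath T)) univ
      = ENNReal.ofReal (Λ ^ n / n.factorial) := by
    intro n
    rw [Measure.smul_apply, Measure.map_apply (measurable_countingPath T n) MeasurableSet.univ,
      preimage_univ, Measure.pi_univ, Finset.prod_const, hm, Finset.card_univ, Fintype.card_fin,
      ENNReal.ofReal_div_of_pos (by positivity), ENNReal.ofReal_pow hΛ, ENNReal.ofReal_natCast,
      smul_eq_mul, ENNReal.div_eq_inv_mul]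
  rw [poissonProcess, Measure.smul_apply, Measure.sum_apply _ MeasurableSet.univ]
  simp_rw [hterm]
  rw [← ENNReal.ofReal_tsum_of_nonneg (fun n ↦ by positivity) (Real.summable_pow_div_factorial Λ)]
  rw [← NormedSpace.exp_eq_tsum_div (𝔸 := ℝ) |> fun h ↦ congrFun h Λ, ← Real.exp_eq_exp_ℝ,
    smul_eq_mul, ← ENNReal.ofReal_mul (Real.exp_pos _).le, ← Real.exp_add, neg_add_cancel]
  simp

/-- Integrable intensity functions on `(0,T]` with values in `[A, B]`. -/
def IsIntensity (T A B : ℝ) (f : ℝ → ℝ) : Prop :=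
  IntegrableOn f (Ioc 0 T) ∧ ∀ t ∈ Ioc 0 T, A ≤ f t ∧ f t ≤ B

/-- Intensities with values in `[A, B]` and average equal to `c`. -/
def familyEq (T A B c : ℝ) : Set (Measure (SamplePath T)) :=
  {W | ∃ f, IsIntensity T A B f ∧ (∫ t in Ioc 0 T, f t) = T * c ∧ W = poissonProcess T f}

/-- Intensities with values in `[A, B]` and average at most `c`. -/
def familyLe (T A B c : ℝ) : Set (Measure (SamplePath T)) :=
  {W | ∃ f, IsIntensity T A B f ∧ (∫ t in Ioc 0 T, f t) ≤ T * c ∧ W = poissonProcess T f}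

/-- Intensities with values in `[A, B]` and average at least `c`. -/
def familyGe (T A B c : ℝ) : Set (Measure (SamplePath T)) :=
  {W | ∃ f, IsIntensity T A B f ∧ T * c ≤ (∫ t in Ioc 0 T, f t) ∧ W = poissonProcess T f}

/-- Intensities with values in `[A, B]`. -/
def family (T A B : ℝ) : Set (Measure (SamplePath T)) :=
  {W | ∃ f, IsIntensity T A B f ∧ W = poissonProcess T f}

/-- Intensities that lie between the constant `A` and the function `g`. -/
def familyFun (T A : ℝ) (g : ℝ → ℝ) : Set (Measure (SamplePath T)) :=
  {W | ∃ f, IntegrableOn f (Ioc 0 T) ∧ (∀ t ∈ Ioc 0 T, A ≤ f t ∧ f t ≤ g t) ∧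
    W = poissonProcess T f}

/-! ### The explicit expressions

For `A = B` the fractions below are of the form `0 / 0` and each expression is given the value of
its limit as `B` decreases to `A`. -/

/-- The intensity `p_{α,c}` of the center under the mean constraint. -/
def meanIntensity (α A B c : ℝ) : ℝ :=
  if A = B then A
  else ((c - A) / (B - A) * B ^ α + (B - c) / (B - A) * A ^ α) ^ (1 / α)

/-- The capacity per unit time under the mean constraint. -/
def meanCapacityRate (α A B c : ℝ) : ℝ :=
  if A = B then 0
  else if α = 1 then
    (c - A) / (B - A) * B * Real.log (B / c) + (B - c) / (B - A) * A * Real.log (A / c)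
  else α / (α - 1) * (meanIntensity α A B c - c)

/-- The optimal mean intensity `c_α`. -/
def optimalMean (α A B : ℝ) : ℝ :=
  if A = B then A
  else if α = 1 then Real.exp (-1) * B ^ (B / (B - A)) * A ^ (-(A / (B - A)))
  else α ^ (α / (1 - α)) * ((B - A) / (B ^ α - A ^ α)) ^ (1 / (1 - α))
    + (A * B ^ α - B * A ^ α) / (B ^ α - A ^ α)

/-- The intensity `p_α` of the center without a mean constraint. -/
def centerIntensity (α A B : ℝ) : ℝ :=
  if A = B then A
  else if α = 1 then Real.exp (-1) * B ^ (B / (B - A)) * A ^ (-(A / (B - A)))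
  else α ^ (1 / (1 - α)) * ((B - A) / (B ^ α - A ^ α)) ^ (1 / (1 - α))

/-- The capacity per unit time without a mean constraint. -/
def capacityRate (α A B : ℝ) : ℝ :=
  if A = B then 0
  else if α = 1 then
    Real.exp (-1) * B ^ (B / (B - A)) * A ^ (-(A / (B - A)))
      - A * B / (B - A) * Real.log (B / A)
  else (α * (B - A) / (B ^ α - A ^ α)) ^ (1 / (1 - α))
    - α / (α - 1) * ((A * B ^ α - B * A ^ α) / (B ^ α - A ^ α))

end

end RenyiPoisson

namespace RenyiPoisson

open Filter Topology

/-! ### Scaling and logarithms in the extended reals -/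

section ExtendedReals

/-! The theorem is a saddle point statement. Fix levels `a ≤ b` and a weight `w` in `[0,1]`, all
functions of time, and let `q = (w b^α + (1-w) a^α)^(1/α)` be the power mean of the levels. If `f ≤
K q`, the divergence of the Poisson laws is an integral of a local quantity, `D_α(P_f ‖ P_q) = ∫
localDiv α f q` (`renyiDivergence_poissonProcess`). The claim is that capacity and center are `C = ∫
infoRate` and `P_q`, where `infoRate` is the `w`-average of the local divergences of `b` and `a`
from `q`, as soon as no member of the family is farther than `C` from `P_q` and the family contains
certain intensities that switch between `a` and `b` (`IsSaddle.renyiCapacity_eq`,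
`IsSaddle.isRenyiCenter`).

Upper bound: Sibson's identity and Hölder's inequality bound the information of any prior by its
largest divergence from any fixed `Q` (`renyiInformation_le_of_ne_one`); take `Q = P_q`.

Lower bound: cut `(0,T]` into cells and, independently in each cell, take the value `b` on a
cyclically shifted fraction `w` of the cell and `a` elsewhere. As the cells shrink, finitely many
distinct arrival times fall into distinct cells and see independent levels, while the integral of
the random intensity concentrates at its mean. Hence the densities of the mean measures of these
uniform priors converge almost surely to a constant multiple of the density of `P_q`
(`tendsto_avg_pathDensity`, `limitDensity_eq`), and their informations converge to `C` by domination
(`tendsto_renyiInformation_shiftPrior`).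

Uniqueness: if every divergence from `Q` is at most `C`, the limit of Sibson's identity says that
the Hellinger integral of `P_q` and `Q` is at least one for `α < 1`, at most one for `α > 1`. Either
way the affinity of order one half is at least one, so `Q = P_q`.

Order one is reached by a limit in the order, using monotonicity across order one of both
information and divergence. Uniqueness there first passes to the fixed order one half
(`ofReal_exp_le_affinity`), which survives the limit.

It remains to verify the saddle inequality. The local divergence is convex in its first argument,
hence below its chord on `[A,B]`; the slope of the chord is governed by `levelGap`, which is
positive below `centerIntensity`, zero there and negative above. With the mean fixed the slope is
irrelevant; under a one-sided constraint its sign is the favourable one or the optimum `optimalMean`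
is feasible and the chord is flat; with a variable upper bound `g` the flat chord is used separately
at each time. -/

theorem log_le_coe_iff (X : ℝ≥0∞) (s : ℝ) :
    ENNReal.log X ≤ (s : EReal) ↔ X ≤ ENNReal.ofReal (Real.exp s) := by
  rw [← ENNReal.log_le_log_iff, ENNReal.log_ofReal_of_pos (Real.exp_pos _), Real.log_exp]

theorem coe_le_log_iff (X : ℝ≥0∞) (s : ℝ) :
    (s : EReal) ≤ ENNReal.log X ↔ ENNReal.ofReal (Real.exp s) ≤ X := by
  rw [← ENNReal.log_le_log_iff, ENNReal.log_ofReal_of_pos (Real.exp_pos _), Real.log_exp]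

theorem coe_mul_le_coe_iff_of_pos {κ : ℝ} (hκ : 0 < κ) (y : EReal) (R : ℝ) :
    (κ : EReal) * y ≤ (R : EReal) ↔ y ≤ ((R / κ : ℝ) : EReal) := by
  induction y using EReal.rec with
  | bot => simp [EReal.coe_mul_bot_of_pos hκ]
  | top => simp [EReal.coe_mul_top_of_pos hκ]
  | coe y => norm_cast; rw [le_div_iff₀ hκ, mul_comm]

theorem coe_le_coe_mul_iff_of_pos {κ : ℝ} (hκ : 0 < κ) (y : EReal) (R : ℝ) :
    (R : EReal) ≤ (κ : EReal) * y ↔ ((R / κ : ℝ) : EReal) ≤ y := by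
  induction y using EReal.rec with
  | bot => simp [EReal.coe_mul_bot_of_pos hκ]
  | top => simp [EReal.coe_mul_top_of_pos hκ]
  | coe y => norm_cast; rw [div_le_iff₀ hκ, mul_comm]

theorem coe_mul_le_coe_iff_of_neg {κ : ℝ} (hκ : κ < 0) (y : EReal) (R : ℝ) :
    (κ : EReal) * y ≤ (R : EReal) ↔ ((R / κ : ℝ) : EReal) ≤ y := by
  induction y using EReal.rec with
  | bot => simp [EReal.coe_mul_bot_of_neg hκ]
  | top => simp [EReal.coe_mul_top_of_neg hκ]
  | coe y => norm_cast; rw [div_le_iff_of_neg hκ, mul_comm]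

theorem ennreal_mul_rpow {s : ℝ≥0∞} (h0 : s ≠ 0) (ht : s ≠ ⊤) (q : ℝ≥0∞) (z : ℝ) :
    (q * s) ^ z = q ^ z * s ^ z := by
  rw [ENNReal.mul_rpow_eq_ite]
  simp [h0, ht]

end ExtendedReals

/-! ### Independence of the reference measure, and Sibson's identity -/

section ChangeOfReference

variable {Ω : Type*} [MeasurableSpace Ω]

/-- The Hellinger integral of order `α`, computed with the reference measure `ν`. -/
noncomputable def hellinger (ν : Measure Ω) (α : ℝ) (W Q : Measure Ω) : ℝ≥0∞ :=
  ∫⁻ y, (W.rnDeriv ν y) ^ α * (Q.rnDeriv ν y) ^ (1 - α) ∂ν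

theorem rnDeriv_eq_zero_of_rnDeriv_eq_zero {W μ κ : Measure Ω} [IsFiniteMeasure W]
    [IsFiniteMeasure μ] [IsFiniteMeasure κ] (hW : W ≪ μ) :
    ∀ᵐ y ∂κ, μ.rnDeriv κ y = 0 → W.rnDeriv κ y = 0 := by
  filter_upwards [Measure.rnDeriv_mul_rnDeriv (κ := κ) hW] with y hy h0
  rw [← hy, Pi.mul_apply, h0, mul_zero]

/-- The exponents `α` and `1 - α` add to one, so the powers of `dμ/dκ` cancel against the change of
measure. Only `W ≪ μ` is needed, not `Q ≪ μ`: where `dμ/dκ` vanishes so does the density of `W`, and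
since `α > 0` the integrand is zero there whatever `Q` does. -/
theorem hellinger_change {W Q μ κ : Measure Ω} [IsFiniteMeasure W] [IsFiniteMeasure Q]
    [IsFiniteMeasure μ] [IsFiniteMeasure κ] {α : ℝ} (hα : 0 < α) (hW : W ≪ μ) (hμ : μ ≪ κ)
    (hQ : Q ≪ κ) : hellinger μ α W Q = hellinger κ α W Q := by
  have h1 : hellinger μ α W Q = ∫⁻ y, (W.rnDeriv κ y / μ.rnDeriv κ y) ^ α *
      (Q.rnDeriv κ y / μ.rnDeriv κ y) ^ (1 - α) ∂μ := by
    refine lintegral_congr_ae ?_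
    filter_upwards [Measure.rnDeriv_eq_div (hW.trans hμ) hμ, Measure.rnDeriv_eq_div hQ hμ]
      with y h1 h2
    rw [h1, h2]
  rw [h1, ← lintegral_rnDeriv_mul hμ (by fun_prop)]
  refine lintegral_congr_ae ?_
  filter_upwards [rnDeriv_eq_zero_of_rnDeriv_eq_zero (κ := κ) hW, μ.rnDeriv_lt_top κ]
    with y h0 hlt
  by_cases hs : μ.rnDeriv κ y = 0
  · simp [hs, h0 hs, hα]
  · have hi0 : (μ.rnDeriv κ y)⁻¹ ≠ 0 := ENNReal.inv_ne_zero.2 hlt.ne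
    have hit : (μ.rnDeriv κ y)⁻¹ ≠ ⊤ := ENNReal.inv_ne_top.2 hs
    rw [div_eq_mul_inv, div_eq_mul_inv, ennreal_mul_rpow hi0 hit, ennreal_mul_rpow hi0 hit]
    have : μ.rnDeriv κ y * ((μ.rnDeriv κ y)⁻¹ ^ α * (μ.rnDeriv κ y)⁻¹ ^ (1 - α)) = 1 := by
      rw [← ENNReal.rpow_add _ _ hi0 hit, add_sub_cancel, ENNReal.rpow_one,
        ENNReal.mul_inv_cancel hs hlt.ne]
    calc _ = (W.rnDeriv κ y) ^ α * (Q.rnDeriv κ y) ^ (1 - α) * (μ.rnDeriv κ y *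
          ((μ.rnDeriv κ y)⁻¹ ^ α * (μ.rnDeriv κ y)⁻¹ ^ (1 - α))) := by ring
      _ = _ := by rw [this, mul_one]

/-- The Rényi divergence computed with any finite reference measure dominating the first
argument. -/
theorem renyiDivergence_eq {W Q ν : Measure Ω} [IsFiniteMeasure W] [IsFiniteMeasure Q]
    [IsFiniteMeasure ν] {α : ℝ} (hα : 0 < α) (h1 : α ≠ 1) (hW : W ≪ ν) :
    renyiDivergence α W Q = ((1 / (α - 1) : ℝ) : EReal) * ENNReal.log (hellinger ν α W Q) := by
  have e1 : hellinger (W + Q) α W Q = hellinger (ν + Q) α W Q := by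
    refine hellinger_change hα (Measure.AbsolutelyContinuous.rfl.add_right _) ?_ ?_
    · exact hW.add Measure.AbsolutelyContinuous.rfl
    · rw [add_comm]; exact Measure.AbsolutelyContinuous.rfl.add_right _
  have e2 : hellinger ν α W Q = hellinger (ν + Q) α W Q := by
    refine hellinger_change hα hW (Measure.AbsolutelyContinuous.rfl.add_right _) ?_
    rw [add_comm]; exact Measure.AbsolutelyContinuous.rfl.add_right _
  rw [renyiDivergence, if_neg h1, e2, ← e1, hellinger]

variable {F : Set (Measure Ω)}

theorem Prior.mass_pos (p : Prior F) {W : Measure Ω} (hW : W ∈ p.mass.support) : 0 < p.mass W :=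
  pos_iff_ne_zero.2 (Finsupp.mem_support_iff.1 hW)

theorem Prior.mem (p : Prior F) {W : Measure Ω} (hW : W ∈ p.mass.support) : W ∈ F :=
  p.support_subset hW

theorem Prior.absolutelyContinuous_mixture (p : Prior F) {W : Measure Ω}
    (hW : W ∈ p.mass.support) : W ≪ p.mixture := by
  intro s hs
  rw [Prior.mixture, Measure.finsetSum_apply, Finset.sum_eq_zero_iff] at hs
  have := hs W hW
  rw [Measure.smul_apply] at this
  simpa [(p.mass_pos hW).ne'] using this

theorem Prior.mixture_absolutelyContinuous (p : Prior F) {ν : Measure Ω}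
    (h : ∀ W ∈ p.mass.support, W ≪ ν) : p.mixture ≪ ν := by
  intro s hs
  rw [Prior.mixture, Measure.finsetSum_apply, Finset.sum_eq_zero_iff]
  intro W hW
  rw [Measure.smul_apply, h W hW hs, smul_zero]

theorem Prior.isProbabilityMeasure_mixture (p : Prior F)
    (h : ∀ W ∈ p.mass.support, IsProbabilityMeasure W) : IsProbabilityMeasure p.mixture := by
  constructor
  rw [Prior.mixture, Measure.finsetSum_apply]
  have : ∀ W ∈ p.mass.support, (p.mass W • W) univ = (p.mass W : ℝ≥0∞) := by
    intro W hW
    have := h W hW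
    rw [Measure.smul_apply, measure_univ, ENNReal.smul_def, smul_eq_mul, mul_one]
  rw [Finset.sum_congr rfl this]
  exact_mod_cast p.sum_eq_one

/-- The density of order `α` of the mean measure with respect to `ν`. -/
noncomputable def Prior.meanDensity (p : Prior F) (α : ℝ) (ν : Measure Ω) (y : Ω) : ℝ≥0∞ :=
  (∑ W ∈ p.mass.support, (p.mass W : ℝ≥0∞) * (W.rnDeriv ν y) ^ α) ^ (1 / α)

theorem Prior.measurable_meanDensity (p : Prior F) (α : ℝ) (ν : Measure Ω) :
    Measurable (p.meanDensity α ν) := by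
  unfold Prior.meanDensity
  fun_prop

/-- The power mean is homogeneous of degree one, so the factor `dμ/dν` from the chain rule comes out
of it exactly once. This allows one reference measure to serve all priors. -/
theorem Prior.meanMeasure_univ (p : Prior F) {ν : Measure Ω} [IsFiniteMeasure ν] {α : ℝ}
    (hα : 0 < α) (hp : ∀ W ∈ p.mass.support, IsProbabilityMeasure W)
    (hν : ∀ W ∈ p.mass.support, W ≪ ν) :
    p.meanMeasure α univ = ∫⁻ y, p.meanDensity α ν y ∂ν := by
  have := p.isProbabilityMeasure_mixture hp
  set μ := p.mixture with hμdef
  have hμ : μ ≪ ν := p.mixture_absolutelyContinuous hν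
  have h1 : p.meanMeasure α univ = ∫⁻ y, p.meanDensity α μ y ∂μ := by
    rw [Prior.meanMeasure, withDensity_apply _ MeasurableSet.univ, Measure.restrict_univ]
    rfl
  rw [h1, ← lintegral_rnDeriv_mul hμ (p.measurable_meanDensity α μ).aemeasurable]
  refine lintegral_congr_ae ?_
  have hall : ∀ᵐ y ∂ν, ∀ W ∈ p.mass.support,
      W.rnDeriv μ y * μ.rnDeriv ν y = W.rnDeriv ν y := by
    rw [Filter.eventually_all_finset]
    intro W hW
    have := hp W hW
    exact Measure.rnDeriv_mul_rnDeriv (p.absolutelyContinuous_mixture hW)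
  filter_upwards [hall] with y h
  have hs : ∑ W ∈ p.mass.support, (p.mass W : ℝ≥0∞) * (W.rnDeriv ν y) ^ α
      = (∑ W ∈ p.mass.support, (p.mass W : ℝ≥0∞) * (W.rnDeriv μ y) ^ α) * (μ.rnDeriv ν y) ^ α := by
    rw [Finset.sum_mul]
    refine Finset.sum_congr rfl fun W hW ↦ ?_
    rw [← h W hW, ENNReal.mul_rpow_of_nonneg _ _ hα.le, mul_assoc]
  rw [Prior.meanDensity, Prior.meanDensity, hs, ENNReal.mul_rpow_of_nonneg _ _ (by positivity),
    ← ENNReal.rpow_mul, mul_one_div_cancel hα.ne', ENNReal.rpow_one, mul_comm]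

/-- Sibson's identity. -/
theorem Prior.lintegral_meanDensity_rpow_mul (p : Prior F) {ν : Measure Ω} {α : ℝ}
    (hα : 0 < α) {q : Ω → ℝ≥0∞} (hq : Measurable q) :
    ∫⁻ y, (p.meanDensity α ν y) ^ α * (q y) ^ (1 - α) ∂ν =
      ∑ W ∈ p.mass.support, (p.mass W : ℝ≥0∞) *
        ∫⁻ y, (W.rnDeriv ν y) ^ α * (q y) ^ (1 - α) ∂ν := by
  simp_rw [Prior.meanDensity, ← ENNReal.rpow_mul, one_div_mul_cancel hα.ne', ENNReal.rpow_one,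
    Finset.sum_mul]
  rw [lintegral_finsetSum _ (fun W _ ↦ by fun_prop)]
  refine Finset.sum_congr rfl fun W _ ↦ ?_
  simp_rw [mul_assoc]
  rw [lintegral_const_mul _ (by fun_prop)]

theorem Prior.sum_mul_const (p : Prior F) (c : ℝ≥0∞) :
    ∑ W ∈ p.mass.support, (p.mass W : ℝ≥0∞) * c = c := by
  rw [← Finset.sum_mul]
  have : ∑ W ∈ p.mass.support, (p.mass W : ℝ≥0∞) = 1 := by exact_mod_cast p.sum_eq_one
  rw [this, one_mul]

end ChangeOfReference
end RenyiPoisson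

namespace RenyiPoisson

open Filter Topology

/-! ### Hölder inequalities and rigidity of the Hellinger integral -/

section Holder

variable {Ω : Type*} [MeasurableSpace Ω] {ν : Measure Ω}

theorem lintegral_rpow_mul_rpow_le {f g : Ω → ℝ≥0∞} (hf : Measurable f) (hg : Measurable g)
    {a b : ℝ} (ha : 0 ≤ a) (hb : 0 ≤ b) (hab : a + b = 1) :
    ∫⁻ y, f y ^ a * g y ^ b ∂ν ≤ (∫⁻ y, f y ∂ν) ^ a * (∫⁻ y, g y ∂ν) ^ b :=
  ENNReal.lintegral_mul_norm_pow_le hf.aemeasurable hg.aemeasurable ha hb hab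

/-- Hölder with exponents `α` and `1 - α`. The bound `∫ q ≤ 1`, rather than equality, covers a `Q`
with a part singular to the reference. -/
theorem lintegral_rpow_mul_rpow_one_sub_le {f q : Ω → ℝ≥0∞} (hf : Measurable f)
    (hq : Measurable q) (hq1 : ∫⁻ y, q y ∂ν ≤ 1) {α : ℝ} (h0 : 0 < α) (h1 : α < 1) :
    ∫⁻ y, f y ^ α * q y ^ (1 - α) ∂ν ≤ (∫⁻ y, f y ∂ν) ^ α := by
  refine (lintegral_rpow_mul_rpow_le hf hq h0.le (by linarith) (by ring)).trans ?_
  calc _ ≤ (∫⁻ y, f y ∂ν) ^ α * 1 := by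
        gcongr
        exact ENNReal.rpow_le_one hq1 (by linarith)
    _ = _ := mul_one _

/-- The reverse Hölder inequality. -/
theorem lintegral_le_of_one_lt {f q : Ω → ℝ≥0∞} (hf : Measurable f)
    (hq : Measurable q) (hq1 : ∫⁻ y, q y ∂ν ≤ 1) {α : ℝ} (h1 : 1 < α) :
    ∫⁻ y, f y ∂ν ≤ (∫⁻ y, f y ^ α * q y ^ (1 - α) ∂ν) ^ (1 / α) := by
  have h0 : 0 < α := by linarith
  by_cases hfin : ∫⁻ y, f y ^ α * q y ^ (1 - α) ∂ν = ⊤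
  · rw [hfin, ENNReal.top_rpow_of_pos (by positivity)]; exact le_top
  have hae := ae_lt_top (by fun_prop) hfin
  have hqt := ae_lt_top (μ := ν) hq (hq1.trans_lt ENNReal.one_lt_top).ne
  have h1α : 1 / α ≤ 1 := by rw [div_le_one h0]; exact h1.le
  -- The powers of `q` cancel where `q` is positive and finite. Where `q = 0`, finiteness of `f^α
  -- q^(1-α)` with `1 - α < 0` forces `f = 0`.
  calc ∫⁻ y, f y ∂ν = ∫⁻ y, (f y ^ α * q y ^ (1 - α)) ^ (1 / α) * q y ^ (1 - 1 / α) ∂ν := by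
        refine lintegral_congr_ae ?_
        filter_upwards [hae, hqt] with y hy hqy
        by_cases hq0 : q y = 0
        · have hf0 : f y = 0 := by
            by_contra hne
            rw [hq0, ENNReal.zero_rpow_of_neg (by linarith), ENNReal.mul_top] at hy
            · exact lt_irrefl _ hy
            · simp [hne, h0.le]
          rw [hf0, hq0, ENNReal.zero_rpow_of_pos h0, zero_mul,
            ENNReal.zero_rpow_of_pos (by positivity), zero_mul]
        · rw [ENNReal.mul_rpow_of_nonneg _ _ (by positivity), ← ENNReal.rpow_mul,
            mul_one_div_cancel h0.ne', ENNReal.rpow_one, mul_assoc, ← ENNReal.rpow_mul,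
            ← ENNReal.rpow_add _ _ hq0 hqy.ne]
          have : (1 - α) * (1 / α) + (1 - 1 / α) = 0 := by field_simp; ring
          rw [this, ENNReal.rpow_zero, mul_one]
    _ ≤ (∫⁻ y, f y ^ α * q y ^ (1 - α) ∂ν) ^ (1 / α) * (∫⁻ y, q y ∂ν) ^ (1 - 1 / α) :=
        lintegral_rpow_mul_rpow_le (by fun_prop) hq (by positivity) (by linarith) (by ring)
    _ ≤ (∫⁻ y, f y ^ α * q y ^ (1 - α) ∂ν) ^ (1 / α) * 1 := by
        gcongr
        exact ENNReal.rpow_le_one hq1 (by linarith)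
    _ = _ := mul_one _

/-- Interpolation between the orders `1/2` and `1`: the order `α` is `2(1-α) · 1/2 + (2α-1) · 1`,
and Hölder applies with these two weights. -/
theorem lintegral_rpow_mul_le_half {f q : Ω → ℝ≥0∞} (hf : Measurable f) (hq : Measurable q)
    (hft : ∫⁻ y, f y ∂ν ≠ ⊤) (hqt : ∫⁻ y, q y ∂ν ≠ ⊤) {α : ℝ} (h2 : 1 / 2 ≤ α) (h1 : α < 1) :
    ∫⁻ y, f y ^ α * q y ^ (1 - α) ∂ν ≤
      (∫⁻ y, f y ^ (1 / 2 : ℝ) * q y ^ (1 / 2 : ℝ) ∂ν) ^ (2 * (1 - α)) *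
        (∫⁻ y, f y ∂ν) ^ (2 * α - 1) := by
  refine le_trans (le_of_eq ?_) (lintegral_rpow_mul_rpow_le
    (f := fun y ↦ f y ^ (1 / 2 : ℝ) * q y ^ (1 / 2 : ℝ)) (by fun_prop) hf
    (a := 2 * (1 - α)) (b := 2 * α - 1) (by linarith) (by linarith) (by ring))
  refine lintegral_congr_ae ?_
  filter_upwards [ae_lt_top hf hft, ae_lt_top hq hqt] with y hfy hqy
  rw [ENNReal.mul_rpow_of_nonneg _ _ (by linarith), ← ENNReal.rpow_mul, ← ENNReal.rpow_mul,
    mul_right_comm, ← ENNReal.rpow_add_of_nonneg _ _ (by linarith) (by linarith)]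
  congr 2 <;> ring_nf

/-- Two measures with Hellinger affinity at least one agree. -/
theorem eq_of_one_le_affinity [IsFiniteMeasure ν] {Q Q' : Measure Ω} [IsProbabilityMeasure Q]
    [IsProbabilityMeasure Q'] (hQ : Q ≪ ν)
    (h : 1 ≤ ∫⁻ y, Q.rnDeriv ν y ^ (1 / 2 : ℝ) * Q'.rnDeriv ν y ^ (1 / 2 : ℝ) ∂ν) : Q' = Q := by
  set q := Q.rnDeriv ν
  set q' := Q'.rnDeriv ν
  have hq : Measurable q := Q.measurable_rnDeriv ν
  have hq' : Measurable q' := Q'.measurable_rnDeriv ν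
  have hi' : ∫⁻ y, q' y ∂ν ≤ 1 := by
    simpa using Measure.lintegral_rnDeriv_le (μ := Q') (ν := ν)
  have hi : ∫⁻ y, q y ∂ν ≤ 1 := by
    simpa using Measure.lintegral_rnDeriv_le (μ := Q) (ν := ν)
  -- The arithmetic-geometric mean inequality with its equality case. Since both densities integrate
  -- to at most one, affinity at least one forces equality almost everywhere.
  have key : ∀ᵐ y ∂ν, (2 * (q y ^ (1 / 2 : ℝ) * q' y ^ (1 / 2 : ℝ)) ≤ q y + q' y) ∧
      (2 * (q y ^ (1 / 2 : ℝ) * q' y ^ (1 / 2 : ℝ)) = q y + q' y → q y = q' y) := by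
    filter_upwards [Q.rnDeriv_lt_top ν, Q'.rnDeriv_lt_top ν] with y h1 h2
    change q y < ⊤ at h1
    change q' y < ⊤ at h2
    generalize q y = a at *
    generalize q' y = b at *
    lift a to ℝ≥0 using h1.ne
    lift b to ℝ≥0 using h2.ne
    rw [← ENNReal.coe_rpow_of_nonneg _ (by norm_num), ← ENNReal.coe_rpow_of_nonneg _ (by norm_num)]
    have hx : a = (a ^ (1 / 2 : ℝ)) ^ 2 := by
      rw [← NNReal.rpow_natCast, ← NNReal.rpow_mul]; norm_num
    have hy : b = (b ^ (1 / 2 : ℝ)) ^ 2 := by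
      rw [← NNReal.rpow_natCast, ← NNReal.rpow_mul]; norm_num
    generalize a ^ (1 / 2 : ℝ) = x at *
    generalize b ^ (1 / 2 : ℝ) = z at *
    subst hx hy
    norm_cast
    constructor
    · rw [← NNReal.coe_le_coe]; push_cast; nlinarith [sq_nonneg ((x : ℝ) - z)]
    · intro h
      have h' : 2 * ((x : ℝ) * z) = x ^ 2 + z ^ 2 := by exact_mod_cast h
      have : (x : ℝ) - z = 0 := by
        have : ((x : ℝ) - z) ^ 2 = 0 := by linarith [sub_sq (x : ℝ) z]
        exact pow_eq_zero_iff (two_ne_zero) |>.1 this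
      have : x = z := by exact_mod_cast (sub_eq_zero.1 this)
      rw [this]
  have hle : ∫⁻ y, q y + q' y ∂ν ≤ 2 := by
    rw [lintegral_add_left hq]
    calc _ ≤ (1 : ℝ≥0∞) + 1 := add_le_add hi hi'
      _ = 2 := by norm_num
  have hge : ∫⁻ y, q y + q' y ∂ν ≤ ∫⁻ y, 2 * (q y ^ (1 / 2 : ℝ) * q' y ^ (1 / 2 : ℝ)) ∂ν := by
    rw [lintegral_const_mul _ (by fun_prop)]
    refine hle.trans ?_
    calc (2 : ℝ≥0∞) = 2 * 1 := by norm_num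
      _ ≤ _ := by gcongr
  have hae := ae_eq_of_ae_le_of_lintegral_le (key.mono fun y h ↦ h.1)
    (((lintegral_mono_ae (key.mono fun y h ↦ h.1)).trans hle).trans_lt (by simp)).ne
    (by fun_prop) hge
  have hqq : q =ᵐ[ν] q' := by
    filter_upwards [key, hae] with y h1 h2 using h1.2 h2
  -- `Q'` need not be absolutely continuous, so equal densities give only an inequality of measures;
  -- equal total mass then excludes a singular part.
  have hle' : Q ≤ Q' := by
    calc Q = ν.withDensity q := (Measure.withDensity_rnDeriv_eq _ _ hQ).symm
      _ = ν.withDensity q' := withDensity_congr_ae hqq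
      _ ≤ Q' := Measure.withDensity_rnDeriv_le _ _
  exact (Measure.eq_of_le_of_measure_univ_eq hle' (by simp)).symm

/-- Interpolation reduces the order to one half: directly for `α ≥ 1/2`, and after exchanging `Q`
and `Q'`, which turns `α` into `1 - α`, for `α ≤ 1/2`. -/
theorem eq_of_one_le_hellinger [IsFiniteMeasure ν] {Q Q' : Measure Ω} [IsProbabilityMeasure Q]
    [IsProbabilityMeasure Q'] (hQ : Q ≪ ν) {α : ℝ} (h0 : 0 < α) (h1 : α < 1)
    (h : 1 ≤ hellinger ν α Q Q') : Q' = Q := by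
  refine eq_of_one_le_affinity hQ ?_
  have hi' : ∫⁻ y, Q'.rnDeriv ν y ∂ν ≤ 1 := by
    simpa using Measure.lintegral_rnDeriv_le (μ := Q') (ν := ν)
  have hi : ∫⁻ y, Q.rnDeriv ν y ∂ν ≤ 1 := by
    simpa using Measure.lintegral_rnDeriv_le (μ := Q) (ν := ν)
  have hm := Q.measurable_rnDeriv ν
  have hm' := Q'.measurable_rnDeriv ν
  have aux : ∀ {X K : ℝ≥0∞} {s t : ℝ}, K ≤ 1 → 0 < s → 0 ≤ t → 1 ≤ X ^ s * K ^ t → 1 ≤ X := by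
    intro X K s t hK hs ht hX
    have : 1 ≤ X ^ s := by
      calc 1 ≤ X ^ s * K ^ t := hX
        _ ≤ X ^ s * 1 := by gcongr; exact ENNReal.rpow_le_one hK ht
        _ = _ := mul_one _
    by_contra hlt
    exact absurd (ENNReal.rpow_lt_one (not_le.1 hlt) hs) (not_lt.2 this)
  rcases le_total (1 / 2) α with h2 | h2
  · exact aux hi (by linarith) (by linarith) (h.trans (lintegral_rpow_mul_le_half hm hm'
      (hi.trans_lt ENNReal.one_lt_top).ne (hi'.trans_lt ENNReal.one_lt_top).ne h2 h1))
  · have h3 := lintegral_rpow_mul_le_half (ν := ν) (α := 1 - α) hm' hm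
      (hi'.trans_lt ENNReal.one_lt_top).ne (hi.trans_lt ENNReal.one_lt_top).ne (by linarith)
      (by linarith)
    rw [sub_sub_cancel] at h3
    rw [lintegral_congr fun y ↦ mul_comm (Q.rnDeriv ν y ^ (1 / 2 : ℝ)) _]
    refine aux hi' (by linarith) (by linarith) (h.trans (le_trans (le_of_eq ?_) h3))
    exact lintegral_congr fun y ↦ mul_comm _ _

/-- Order one lies between `1/2` and `α > 1`, so Hölder bounds `1 = ∫ q` by a product of powers of
the Hellinger integral of order `α`, which is at most one, and of the affinity. The affinity must
then be at least one. -/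
theorem eq_of_hellinger_le_one [IsFiniteMeasure ν] {Q Q' : Measure Ω} [IsProbabilityMeasure Q]
    [IsProbabilityMeasure Q'] (hQ : Q ≪ ν) {α : ℝ} (h1 : 1 < α)
    (h : hellinger ν α Q Q' ≤ 1) : Q' = Q := by
  refine eq_of_one_le_affinity hQ ?_
  set q := Q.rnDeriv ν
  set q' := Q'.rnDeriv ν
  have hq : Measurable q := Q.measurable_rnDeriv ν
  have hq' : Measurable q' := Q'.measurable_rnDeriv ν
  have hpos : 0 < α - 1 / 2 := by linarith
  have hy0 : 0 < (α - 1) / (α - 1 / 2) := div_pos (by linarith) hpos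
  have hd : α - 1 / 2 ≠ 0 := hpos.ne'
  have hi : ∫⁻ y, q y ∂ν = 1 := by rw [Measure.lintegral_rnDeriv hQ, measure_univ]
  have hae : ∀ᵐ y ∂ν, q y ^ α * q' y ^ (1 - α) < ⊤ :=
    ae_lt_top (by fun_prop) (h.trans_lt ENNReal.one_lt_top).ne
  -- The two weights solve `x α + y / 2 = 1` and `x (1 - α) + y / 2 = 0`, so that the product of the
  -- integrands is `q` itself.
  have key : (1 : ℝ≥0∞) ≤ (∫⁻ y, q y ^ α * q' y ^ (1 - α) ∂ν) ^ ((1 / 2) / (α - 1 / 2)) *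
      (∫⁻ y, q y ^ (1 / 2 : ℝ) * q' y ^ (1 / 2 : ℝ) ∂ν) ^ ((α - 1) / (α - 1 / 2)) := by
    rw [← hi]
    refine le_trans (le_of_eq ?_) (lintegral_rpow_mul_rpow_le (by fun_prop) (by fun_prop)
      (by positivity) hy0.le (by rw [← add_div, div_eq_one_iff_eq hd]; ring))
    refine lintegral_congr_ae ?_
    filter_upwards [hae, Q.rnDeriv_lt_top ν, Q'.rnDeriv_lt_top ν] with y hy h1y h2y
    change q y < ⊤ at h1y
    change q' y < ⊤ at h2y
    have hx0 : 0 < (1 / 2) / (α - 1 / 2) := by positivity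
    by_cases hq0 : q y = 0
    · rw [hq0, ENNReal.zero_rpow_of_pos (by linarith : 0 < α), zero_mul,
        ENNReal.zero_rpow_of_pos hx0, zero_mul]
    by_cases hq'0 : q' y = 0
    · rw [hq'0, ENNReal.zero_rpow_of_neg (by linarith), ENNReal.mul_top] at hy
      · exact absurd hy (lt_irrefl _)
      · simp [hq0, h1y.ne]
    · rw [ENNReal.mul_rpow_of_nonneg _ _ hx0.le, ENNReal.mul_rpow_of_nonneg _ _ hy0.le,
        ← ENNReal.rpow_mul, ← ENNReal.rpow_mul, ← ENNReal.rpow_mul, ← ENNReal.rpow_mul,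
        mul_mul_mul_comm, ← ENNReal.rpow_add _ _ hq0 h1y.ne, ← ENNReal.rpow_add _ _ hq'0 h2y.ne]
      have e1 : α * ((1 / 2) / (α - 1 / 2)) + 1 / 2 * ((α - 1) / (α - 1 / 2)) = 1 := by
        rw [mul_div_assoc', mul_div_assoc', mul_div_assoc', ← add_div, div_eq_one_iff_eq hd]; ring
      have e2 : (1 - α) * ((1 / 2) / (α - 1 / 2)) + 1 / 2 * ((α - 1) / (α - 1 / 2)) = 0 := by
        rw [mul_div_assoc', mul_div_assoc', mul_div_assoc', ← add_div, div_eq_zero_iff]; left; ring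
      rw [e1, e2, ENNReal.rpow_one, ENNReal.rpow_zero, mul_one]
  by_contra hlt
  refine absurd key (not_le.2 ?_)
  calc _ ≤ 1 * (∫⁻ y, q y ^ (1 / 2 : ℝ) * q' y ^ (1 / 2 : ℝ) ∂ν) ^ ((α - 1) / (α - 1 / 2)) := by
        gcongr
        exact ENNReal.rpow_le_one h (by positivity)
    _ < 1 := by rw [one_mul]; exact ENNReal.rpow_lt_one (not_le.1 hlt) hy0

end Holder

/-! ### Information is at most the radius, for orders other than one -/

section OrderBounds

variable {Ω : Type*} [MeasurableSpace Ω] {F : Set (Measure Ω)}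

theorem renyiDivergence_le_iff_of_lt {W Q ν : Measure Ω} [IsFiniteMeasure W] [IsFiniteMeasure Q]
    [IsFiniteMeasure ν] {α : ℝ} (h0 : 0 < α) (h1 : α < 1) (hW : W ≪ ν) (R : ℝ) :
    renyiDivergence α W Q ≤ (R : EReal) ↔
      ENNReal.ofReal (Real.exp ((α - 1) * R)) ≤ hellinger ν α W Q := by
  rw [renyiDivergence_eq h0 h1.ne hW, coe_mul_le_coe_iff_of_neg
    (one_div_neg.2 (by linarith)), coe_le_log_iff, div_div_eq_mul_div, div_one, mul_comm]

theorem renyiDivergence_le_iff_of_gt {W Q ν : Measure Ω} [IsFiniteMeasure W] [IsFiniteMeasure Q]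
    [IsFiniteMeasure ν] {α : ℝ} (h1 : 1 < α) (hW : W ≪ ν) (R : ℝ) :
    renyiDivergence α W Q ≤ (R : EReal) ↔
      hellinger ν α W Q ≤ ENNReal.ofReal (Real.exp ((α - 1) * R)) := by
  rw [renyiDivergence_eq (by linarith) h1.ne' hW, coe_mul_le_coe_iff_of_pos
    (one_div_pos.2 (by linarith)), log_le_coe_iff, div_div_eq_mul_div, div_one, mul_comm]

/-- By Sibson's identity the integral is the average over the prior of the Hellinger integrals, and
each of these obeys the bound. A bound on all divergences thus becomes one inequality for the mean
density, which can be passed to the limit along a sequence of priors. -/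
theorem Prior.le_lintegral_meanDensity_rpow (p : Prior F) {ν Q : Measure Ω} [IsFiniteMeasure ν]
    [IsFiniteMeasure Q] {α R : ℝ} (h0 : 0 < α) (h1 : α < 1)
    (hp : ∀ W ∈ p.mass.support, IsProbabilityMeasure W) (hν : ∀ W ∈ p.mass.support, W ≪ ν)
    (h : ∀ W ∈ p.mass.support, renyiDivergence α W Q ≤ (R : EReal)) :
    ENNReal.ofReal (Real.exp ((α - 1) * R)) ≤
      ∫⁻ y, p.meanDensity α ν y ^ α * Q.rnDeriv ν y ^ (1 - α) ∂ν := by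
  rw [p.lintegral_meanDensity_rpow_mul h0 (Q.measurable_rnDeriv ν),
    ← p.sum_mul_const (ENNReal.ofReal _)]
  refine Finset.sum_le_sum fun W hW ↦ ?_
  have := hp W hW
  gcongr
  exact (renyiDivergence_le_iff_of_lt h0 h1 (hν W hW) R).1 (h W hW)

theorem Prior.lintegral_meanDensity_rpow_le (p : Prior F) {ν Q : Measure Ω} [IsFiniteMeasure ν]
    [IsFiniteMeasure Q] {α R : ℝ} (h1 : 1 < α)
    (hp : ∀ W ∈ p.mass.support, IsProbabilityMeasure W) (hν : ∀ W ∈ p.mass.support, W ≪ ν)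
    (h : ∀ W ∈ p.mass.support, renyiDivergence α W Q ≤ (R : EReal)) :
    ∫⁻ y, p.meanDensity α ν y ^ α * Q.rnDeriv ν y ^ (1 - α) ∂ν ≤
      ENNReal.ofReal (Real.exp ((α - 1) * R)) := by
  rw [p.lintegral_meanDensity_rpow_mul (by linarith) (Q.measurable_rnDeriv ν),
    ← p.sum_mul_const (ENNReal.ofReal _)]
  refine Finset.sum_le_sum fun W hW ↦ ?_
  have := hp W hW
  gcongr
  exact (renyiDivergence_le_iff_of_gt h1 (hν W hW) R).1 (h W hW)

/-- For `α ≠ 1` the Rényi information is at most the radius relative to any `Q`. -/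
theorem renyiInformation_le_of_ne_one (p : Prior F) {Q : Measure Ω} [IsProbabilityMeasure Q]
    {α R : ℝ} (h0 : 0 < α) (h1 : α ≠ 1)
    (hp : ∀ W ∈ p.mass.support, IsProbabilityMeasure W)
    (h : ∀ W ∈ p.mass.support, renyiDivergence α W Q ≤ (R : EReal)) :
    renyiInformation α p ≤ (R : EReal) := by
  have := p.isProbabilityMeasure_mixture hp
  have hν : ∀ W ∈ p.mass.support, W ≪ p.mixture := fun W hW ↦ p.absolutelyContinuous_mixture hW
  have hq1 : ∫⁻ y, Q.rnDeriv p.mixture y ∂p.mixture ≤ 1 := by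
    simpa using Measure.lintegral_rnDeriv_le (μ := Q) (ν := p.mixture)
  have hm := p.measurable_meanDensity α p.mixture
  have hmq := Q.measurable_rnDeriv p.mixture
  rw [renyiInformation, if_neg h1, p.meanMeasure_univ h0 hp hν]
  have hexp : ENNReal.ofReal (Real.exp ((α - 1) * R)) ^ (1 / α) =
      ENNReal.ofReal (Real.exp (R / (α / (α - 1)))) := by
    rw [ENNReal.ofReal_rpow_of_pos (Real.exp_pos _), ← Real.exp_mul]
    congr 2
    have : α - 1 ≠ 0 := sub_ne_zero.2 h1
    field_simp
  rcases lt_or_gt_of_ne h1 with hlt | hgt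
  · rw [coe_mul_le_coe_iff_of_neg (div_neg_of_pos_of_neg h0 (by linarith)), coe_le_log_iff, ← hexp]
    have := (p.le_lintegral_meanDensity_rpow h0 hlt hp hν h).trans
      (lintegral_rpow_mul_rpow_one_sub_le hm hmq hq1 h0 hlt)
    calc _ ≤ ((∫⁻ y, p.meanDensity α p.mixture y ∂p.mixture) ^ α) ^ (1 / α) := by gcongr
      _ = _ := by rw [← ENNReal.rpow_mul, mul_one_div_cancel h0.ne', ENNReal.rpow_one]
  · rw [coe_mul_le_coe_iff_of_pos (div_pos h0 (by linarith)), log_le_coe_iff, ← hexp]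
    refine (lintegral_le_of_one_lt hm hmq hq1 hgt).trans ?_
    gcongr
    exact p.lintegral_meanDensity_rpow_le hgt hp hν h

end OrderBounds
end RenyiPoisson

namespace RenyiPoisson

open Filter Topology

/-! ### Comparison of order one with its neighbours -/

section OrderOne

variable {Ω : Type*} [MeasurableSpace Ω] {F : Set (Measure Ω)}

/-- Jensen's inequality for the exponential. -/
theorem ofReal_exp_integral_le {P : Measure Ω} [IsProbabilityMeasure P] {X : Ω → ℝ}
    (hX : Integrable X P) :
    ENNReal.ofReal (Real.exp (∫ y, X y ∂P)) ≤ ∫⁻ y, ENNReal.ofReal (Real.exp (X y)) ∂P := by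
  set m := ∫ y, X y ∂P with hm
  -- The tangent line of the exponential at the mean is integrable, whereas `exp X` need not be; its
  -- positive part is what survives `ENNReal.ofReal`.
  have hint : Integrable (fun y ↦ Real.exp m * (1 + (X y - m))) P := by fun_prop
  have hval : ∫ y, Real.exp m * (1 + (X y - m)) ∂P = Real.exp m := by
    rw [integral_const_mul, integral_add (by fun_prop) (by fun_prop),
      integral_sub hX (by fun_prop), ← hm]
    simp
  have h1 : ENNReal.ofReal (Real.exp m) ≤
      ∫⁻ y, ENNReal.ofReal (Real.exp m * (1 + (X y - m))) ∂P := by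
    have h := ofReal_integral_eq_lintegral_ofReal hint.pos_part
      (Filter.Eventually.of_forall fun y ↦ le_max_right _ _)
    have h2 : Real.exp m ≤ ∫ y, max (Real.exp m * (1 + (X y - m))) 0 ∂P :=
      hval.symm.le.trans (integral_mono hint hint.pos_part fun y ↦ le_max_left _ _)
    calc _ ≤ ENNReal.ofReal (∫ y, max (Real.exp m * (1 + (X y - m))) 0 ∂P) :=
          ENNReal.ofReal_le_ofReal h2
      _ = _ := by
          rw [h]
          refine lintegral_congr fun y ↦ ?_
          rw [ENNReal.ofReal_max, ENNReal.ofReal_zero, max_eq_left zero_le]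
  refine h1.trans (lintegral_mono fun y ↦ ENNReal.ofReal_le_ofReal ?_)
  calc Real.exp m * (1 + (X y - m)) ≤ Real.exp m * Real.exp (X y - m) := by
        gcongr
        linarith [Real.add_one_le_exp (X y - m)]
    _ = Real.exp (X y) := by rw [← Real.exp_add]; ring_nf

/-- The mutual information of a prior as a real number. -/
noncomputable def Prior.mutualInformation (p : Prior F) : ℝ :=
  ∫ y, ∑ W ∈ p.mass.support,
    p.posterior W y * Real.log (p.posterior W y / p.mass W) ∂p.mixture

theorem renyiInformation_one (p : Prior F) :
    renyiInformation 1 p = (p.mutualInformation : EReal) := by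
  rw [renyiInformation, if_pos rfl, Prior.mutualInformation]

/-- Both sides are densities of the mixture with respect to itself. -/
theorem Prior.ae_sum_rnDeriv (p : Prior F)
    (hp : ∀ W ∈ p.mass.support, IsProbabilityMeasure W) :
    ∀ᵐ y ∂p.mixture, ∑ W ∈ p.mass.support, (p.mass W : ℝ≥0∞) * W.rnDeriv p.mixture y = 1 := by
  have := p.isProbabilityMeasure_mixture hp
  have h : p.mixture.withDensity (fun y ↦ ∑ W ∈ p.mass.support,
      (p.mass W : ℝ≥0∞) * W.rnDeriv p.mixture y) = p.mixture.withDensity 1 := by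
    ext s hs
    rw [withDensity_one, withDensity_apply _ hs, lintegral_finsetSum _ (fun W _ ↦ by fun_prop)]
    conv_rhs => rw [Prior.mixture, Measure.finsetSum_apply]
    refine Finset.sum_congr rfl fun W hW ↦ ?_
    have := hp W hW
    rw [lintegral_const_mul _ (by fun_prop),
      Measure.setLIntegral_rnDeriv (p.absolutelyContinuous_mixture hW), Measure.smul_apply,
      ENNReal.smul_def, smul_eq_mul]
  have h' := (withDensity_eq_iff_of_sigmaFinite (by fun_prop) (by fun_prop)).1 h
  filter_upwards [h'] with y hy using hy

/-- The integrand of the mutual information and of the norm of the mean measure, compared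
pointwise; `r` are densities with respect to the mixture. -/
theorem exp_sum_le_rpow {ι : Type*} {S : Finset ι} {m r : ι → ℝ} (hm : ∀ i ∈ S, 0 < m i)
    (hr : ∀ i ∈ S, 0 ≤ r i) (hs : ∑ i ∈ S, m i * r i = 1) {α : ℝ} (hα : 0 < α) :
    Real.exp ((α - 1) / α * ∑ i ∈ S, m i * r i * Real.log (m i * r i / m i)) ≤
      (∑ i ∈ S, m i * r i ^ α) ^ (1 / α) := by
  -- Jensen with the posterior probabilities `m i * r i` as weights.
  have h1 : Real.exp (∑ i ∈ S, m i * r i * ((α - 1) * Real.log (r i))) ≤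
      ∑ i ∈ S, m i * r i * Real.exp ((α - 1) * Real.log (r i)) := by
    have := convexOn_exp.map_sum_le (t := S) (w := fun i ↦ m i * r i)
      (p := fun i ↦ (α - 1) * Real.log (r i))
      (fun i hi ↦ mul_nonneg (hm i hi).le (hr i hi)) hs (fun i _ ↦ mem_univ _)
    simpa using this
  have h2 : ∑ i ∈ S, m i * r i * Real.exp ((α - 1) * Real.log (r i)) ≤
      ∑ i ∈ S, m i * r i ^ α := by
    refine Finset.sum_le_sum fun i hi ↦ ?_
    rcases (hr i hi).eq_or_lt with h0 | h0
    · rw [← h0, Real.zero_rpow hα.ne', mul_zero, zero_mul]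
    · rw [mul_comm (α - 1), ← Real.rpow_def_of_pos h0, mul_assoc, ← Real.rpow_one_add' h0.le
        (by linarith)]
      ring_nf
      exact le_rfl
  have h3 : ∑ i ∈ S, m i * r i * ((α - 1) * Real.log (r i)) =
      (α - 1) * ∑ i ∈ S, m i * r i * Real.log (m i * r i / m i) := by
    rw [Finset.mul_sum]
    refine Finset.sum_congr rfl fun i hi ↦ ?_
    rw [mul_div_cancel_left₀ _ (hm i hi).ne']
    ring
  rw [h3] at h1
  calc _ = (Real.exp ((α - 1) * ∑ i ∈ S, m i * r i * Real.log (m i * r i / m i))) ^ (1 / α) := by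
        rw [← Real.exp_mul]; congr 1; ring
    _ ≤ _ := by
        gcongr
        exact h1.trans h2

/-- With `u = x / m` one has `u - 1 ≤ u log u ≤ u²`. This bounds the integrand of the mutual
information by a constant depending only on the prior, hence makes it integrable. -/
theorem abs_mul_log_div_le {m x : ℝ} (hm : 0 < m) (hx0 : 0 ≤ x) (hx1 : x ≤ 1) :
    |x * Real.log (x / m)| ≤ 1 / m + m := by
  have hlog : x / m * Real.log (x / m) ≤ x / m * (x / m) := by
    rcases hx0.eq_or_lt with h0 | h0
    · simp [← h0]
    · have : Real.log (x / m) ≤ x / m := (Real.log_le_sub_one_of_pos (by positivity)).trans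
        (by linarith)
      gcongr
  have hlow : x / m - 1 ≤ x / m * Real.log (x / m) := by
    have := InformationTheory.klFun_nonneg (x := x / m) (by positivity)
    rw [InformationTheory.klFun_apply] at this
    linarith
  have e : x * Real.log (x / m) = m * (x / m * Real.log (x / m)) := by field_simp
  have hq : 0 ≤ x / m := by positivity
  rw [e, abs_le]
  constructor
  · have : m * (-1) ≤ m * (x / m * Real.log (x / m)) := by gcongr; linarith
    have : 0 < 1 / m := by positivity
    linarith
  · calc _ ≤ m * (x / m * (x / m)) := by gcongr
      _ = x * x / m := by field_simp
      _ ≤ 1 / m := by gcongr; nlinarith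
      _ ≤ _ := by linarith

/-- The norm of the mean measure is at least `exp((α-1)/α · I)`, `I` the mutual information. -/
theorem Prior.ofReal_exp_le_meanMeasure (p : Prior F) {α : ℝ} (hα : 0 < α)
    (hp : ∀ W ∈ p.mass.support, IsProbabilityMeasure W) :
    ENNReal.ofReal (Real.exp ((α - 1) / α * p.mutualInformation)) ≤ p.meanMeasure α univ := by
  have := p.isProbabilityMeasure_mixture hp
  rw [p.meanMeasure_univ hα hp fun W hW ↦ p.absolutelyContinuous_mixture hW]
  have hfin : ∀ᵐ y ∂p.mixture, ∀ W ∈ p.mass.support, W.rnDeriv p.mixture y < ⊤ := by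
    rw [Filter.eventually_all_finset]
    intro W hW
    have := hp W hW
    exact W.rnDeriv_lt_top _
  have hreal : ∀ᵐ y ∂p.mixture, ∑ W ∈ p.mass.support, p.posterior W y = 1 := by
    filter_upwards [hfin, p.ae_sum_rnDeriv hp] with y h1 h2
    have := congrArg ENNReal.toReal h2
    rw [ENNReal.toReal_sum fun W hW ↦ ENNReal.mul_ne_top (by simp) (h1 W hW).ne] at this
    simpa [Prior.posterior, ENNReal.toReal_mul] using this
  have hpost : ∀ W y, 0 ≤ p.posterior W y := fun W y ↦ by unfold Prior.posterior; positivity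
  have hmeas : ∀ W, Measurable (p.posterior W) := fun W ↦ by unfold Prior.posterior; fun_prop
  have hint : Integrable (fun y ↦ ∑ W ∈ p.mass.support,
      p.posterior W y * Real.log (p.posterior W y / p.mass W)) p.mixture := by
    refine Integrable.of_bound (by fun_prop)
      (∑ W ∈ p.mass.support, (1 / (p.mass W : ℝ) + p.mass W)) ?_
    filter_upwards [hreal] with y hy
    refine (Finset.abs_sum_le_sum_abs _ _).trans (Finset.sum_le_sum fun W hW ↦ ?_)
    refine abs_mul_log_div_le (by exact_mod_cast p.mass_pos hW) (hpost W y) ?_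
    rw [← hy]
    exact Finset.single_le_sum (f := fun W ↦ p.posterior W y) (fun V _ ↦ hpost V y) hW
  rw [Prior.mutualInformation, ← integral_const_mul]
  refine (ofReal_exp_integral_le (hint.const_mul _)).trans (lintegral_mono_ae ?_)
  filter_upwards [hfin, hreal] with y h1 h2
  have key := exp_sum_le_rpow (S := p.mass.support) (m := fun W ↦ (p.mass W : ℝ))
    (r := fun W ↦ (W.rnDeriv p.mixture y).toReal)
    (fun W hW ↦ by exact_mod_cast p.mass_pos hW) (fun W _ ↦ ENNReal.toReal_nonneg) h2 hα
  refine (ENNReal.ofReal_le_ofReal key).trans (le_of_eq ?_)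
  rw [Prior.meanDensity, ← ENNReal.ofReal_rpow_of_nonneg (Finset.sum_nonneg fun W _ ↦ by positivity)
    (by positivity), ENNReal.ofReal_sum_of_nonneg fun W _ ↦ by positivity]
  congr 1
  refine Finset.sum_congr rfl fun W hW ↦ ?_
  rw [ENNReal.ofReal_mul (by positivity), ← ENNReal.ofReal_rpow_of_nonneg (by positivity) hα.le,
    ENNReal.ofReal_toReal (h1 W hW).ne, ENNReal.ofReal_coe_nnreal]

/-- A single lower bound on the norm of the mean measure, `Prior.ofReal_exp_le_meanMeasure`, gives
monotonicity on both sides of order one: the factor `α / (α - 1)` is negative here and positive for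
`α > 1`. -/
theorem renyiInformation_le_mutualInformation (p : Prior F) {α : ℝ} (h0 : 0 < α) (h1 : α < 1)
    (hp : ∀ W ∈ p.mass.support, IsProbabilityMeasure W) :
    renyiInformation α p ≤ renyiInformation 1 p := by
  rw [renyiInformation_one, renyiInformation, if_neg h1.ne, coe_mul_le_coe_iff_of_neg
    (div_neg_of_pos_of_neg h0 (by linarith)), coe_le_log_iff]
  convert p.ofReal_exp_le_meanMeasure h0 hp using 3
  rw [div_div_eq_mul_div]; ring

theorem mutualInformation_le_renyiInformation (p : Prior F) {α : ℝ} (h1 : 1 < α)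
    (hp : ∀ W ∈ p.mass.support, IsProbabilityMeasure W) :
    renyiInformation 1 p ≤ renyiInformation α p := by
  rw [renyiInformation_one, renyiInformation, if_neg h1.ne', coe_le_coe_mul_iff_of_pos
    (div_pos (by linarith) (by linarith)), coe_le_log_iff]
  convert p.ofReal_exp_le_meanMeasure (by linarith) hp using 3
  rw [div_div_eq_mul_div]; ring

theorem hellinger_self_right {W Q : Measure Ω} [IsFiniteMeasure W] [IsFiniteMeasure Q] (α : ℝ) :
    hellinger Q α W Q = ∫⁻ y, (W.rnDeriv Q y) ^ α ∂Q := by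
  refine lintegral_congr_ae ?_
  filter_upwards [Q.rnDeriv_self] with y hy
  rw [hy, ENNReal.one_rpow, mul_one]

/-- Jensen under `W` for `(α - 1) log (dW/dQ)`; passing from `W` to `Q` supplies the missing factor
`dW/dQ`. No sign of `α - 1` is used, so the bound serves orders below and above one. -/
theorem ofReal_exp_klDiv_le_hellinger {W Q : Measure Ω} [IsProbabilityMeasure W]
    [IsProbabilityMeasure Q] {α : ℝ} (hWQ : W ≪ Q) (hint : Integrable (llr W Q) W) :
    ENNReal.ofReal (Real.exp ((α - 1) * (InformationTheory.klDiv W Q).toReal)) ≤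
      hellinger Q α W Q := by
  rw [InformationTheory.toReal_klDiv_of_measure_eq hWQ (by simp), ← integral_const_mul]
  refine (ofReal_exp_integral_le (hint.const_mul _)).trans ?_
  rw [hellinger_self_right, ← lintegral_rnDeriv_mul hWQ
    (by have := measurable_llr W Q; fun_prop)]
  refine lintegral_mono_ae ?_
  filter_upwards [W.rnDeriv_lt_top Q] with y hy
  by_cases h0 : W.rnDeriv Q y = 0
  · simp [h0]
  rw [llr_def]
  have hpos : 0 < (W.rnDeriv Q y).toReal := ENNReal.toReal_pos h0 hy.ne
  rw [mul_comm (α - 1), ← Real.rpow_def_of_pos hpos, ← ENNReal.ofReal_rpow_of_pos hpos,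
    ENNReal.ofReal_toReal hy.ne]
  nth_rewrite 1 [← ENNReal.rpow_one (W.rnDeriv Q y)]
  rw [← ENNReal.rpow_add _ _ h0 hy.ne]
  ring_nf
  exact le_rfl

/-- For `β > 1` the integrand is infinite where `Q` has density zero and `W` does not, so finiteness
forces `W ≪ Q`. After that `u log u` is dominated by a multiple of `u^β`. -/
theorem klDiv_ne_top_of_hellinger {W Q : Measure Ω} [IsProbabilityMeasure W]
    [IsProbabilityMeasure Q] {β : ℝ} (hβ : 1 < β) (h : hellinger (W + Q) β W Q ≠ ⊤) :
    InformationTheory.klDiv W Q ≠ ⊤ := by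
  have hWs : W ≪ W + Q := Measure.AbsolutelyContinuous.rfl.add_right _
  have hQs : Q ≪ W + Q := by rw [add_comm]; exact Measure.AbsolutelyContinuous.rfl.add_right _
  have hWQ : W ≪ Q := by
    intro s hs
    have hm := measure_toMeasurable (μ := Q) s
    rw [hs] at hm
    refine measure_mono_null (subset_toMeasurable Q s) ?_
    have hms := measurableSet_toMeasurable Q s
    rw [← Measure.setLIntegral_rnDeriv hQs,
      lintegral_eq_zero_iff (Q.measurable_rnDeriv _)] at hm
    rw [← Measure.setLIntegral_rnDeriv hWs,
      lintegral_eq_zero_iff (W.measurable_rnDeriv _)]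
    have hfin := ae_restrict_of_ae (s := toMeasurable Q s) (ae_lt_top (by fun_prop) h)
    filter_upwards [hm, hfin] with y h1 h2
    by_contra hne
    simp only [Pi.zero_apply] at h1 hne
    rw [h1, ENNReal.zero_rpow_of_neg (by linarith), ENNReal.mul_top] at h2
    · exact lt_irrefl _ h2
    · simp [hne]; intro; linarith
  rw [InformationTheory.klDiv_eq_lintegral_klFun_of_ac hWQ]
  have hH : ∫⁻ y, (W.rnDeriv Q y) ^ β ∂Q ≠ ⊤ := by
    rw [← hellinger_self_right, hellinger_change (by linarith) hWQ hQs hQs]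
    exact h
  have hle : ∫⁻ y, ENNReal.ofReal (InformationTheory.klFun (W.rnDeriv Q y).toReal) ∂Q ≤
      ∫⁻ y, (ENNReal.ofReal (1 / (β - 1)) * (W.rnDeriv Q y) ^ β + 1) ∂Q := by
    refine lintegral_mono_ae ?_
    filter_upwards [W.rnDeriv_lt_top Q] with y hy
    set x := (W.rnDeriv Q y).toReal with hx
    have hx0 : 0 ≤ x := ENNReal.toReal_nonneg
    have hb : 0 < β - 1 := by linarith
    have e : ENNReal.ofReal (1 / (β - 1)) * (W.rnDeriv Q y) ^ β + 1 =
        ENNReal.ofReal (1 / (β - 1) * x ^ β + 1) := by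
      rw [ENNReal.ofReal_add (by positivity) zero_le_one, ENNReal.ofReal_mul (by positivity),
        ← ENNReal.ofReal_rpow_of_nonneg hx0 (by linarith), hx, ENNReal.ofReal_toReal hy.ne,
        ENNReal.ofReal_one]
    rw [e]
    refine ENNReal.ofReal_le_ofReal ?_
    rw [InformationTheory.klFun_apply]
    rcases hx0.eq_or_lt with h0 | h0
    · rw [← h0]; simp; positivity
    -- This is `log y ≤ y` for `y = x^(β-1)`.
    have hl : x * Real.log x ≤ 1 / (β - 1) * x ^ β := by
      have h1 : (β - 1) * Real.log x ≤ x ^ (β - 1) := by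
        rw [← Real.log_rpow h0]
        linarith [Real.log_le_sub_one_of_pos (Real.rpow_pos_of_pos h0 (β - 1))]
      have h2 : x * x ^ (β - 1) = x ^ β := by
        rw [← Real.rpow_one_add' hx0 (by linarith)]; ring_nf
      rw [← h2, one_div_mul_eq_div, le_div_iff₀ hb]
      calc x * Real.log x * (β - 1) = x * ((β - 1) * Real.log x) := by ring
        _ ≤ _ := by gcongr
    linarith
  refine (hle.trans_lt ?_).ne
  rw [lintegral_add_right _ measurable_const, lintegral_const_mul _ (by fun_prop)]
  simp only [lintegral_const, measure_univ, mul_one]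
  exact ENNReal.add_lt_top.2 ⟨ENNReal.mul_lt_top (by simp) (lt_top_iff_ne_top.2 hH), by simp⟩

theorem renyiDivergence_one (W Q : Measure Ω) :
    renyiDivergence 1 W Q = (InformationTheory.klDiv W Q : EReal) := if_pos rfl

theorem coe_klDiv_toReal {W Q : Measure Ω} (h : InformationTheory.klDiv W Q ≠ ⊤) :
    (InformationTheory.klDiv W Q : EReal) =
      (((InformationTheory.klDiv W Q).toReal : ℝ) : EReal) := by
  rw [EReal.coe_ennreal_toReal h]

theorem renyiDivergence_le_one {W Q : Measure Ω} [IsProbabilityMeasure W]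
    [IsProbabilityMeasure Q] {α : ℝ} (h0 : 0 < α) (h1 : α < 1) :
    renyiDivergence α W Q ≤ renyiDivergence 1 W Q := by
  rw [renyiDivergence_one]
  by_cases hk : InformationTheory.klDiv W Q = ⊤
  · rw [hk]; exact le_top
  obtain ⟨hWQ, hint⟩ := InformationTheory.klDiv_ne_top_iff.1 hk
  rw [coe_klDiv_toReal hk, renyiDivergence_le_iff_of_lt h0 h1 hWQ]
  exact ofReal_exp_klDiv_le_hellinger hWQ hint

theorem renyiDivergence_one_le {W Q : Measure Ω} [IsProbabilityMeasure W]
    [IsProbabilityMeasure Q] {β : ℝ} (h1 : 1 < β) :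
    renyiDivergence 1 W Q ≤ renyiDivergence β W Q := by
  have hWs : W ≪ W + Q := Measure.AbsolutelyContinuous.rfl.add_right _
  by_cases hH : hellinger (W + Q) β W Q = ⊤
  · rw [renyiDivergence_eq (by linarith) h1.ne' hWs, hH, ENNReal.log_top,
      EReal.coe_mul_top_of_pos (one_div_pos.2 (by linarith))]
    exact le_top
  have hk := klDiv_ne_top_of_hellinger h1 hH
  obtain ⟨hWQ, hint⟩ := InformationTheory.klDiv_ne_top_iff.1 hk
  rw [renyiDivergence_one, coe_klDiv_toReal hk, renyiDivergence_eq (by linarith) h1.ne' hWQ,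
    coe_le_coe_mul_iff_of_pos (one_div_pos.2 (by linarith)), coe_le_log_iff, div_div_eq_mul_div,
    div_one, mul_comm]
  exact ofReal_exp_klDiv_le_hellinger hWQ hint

end OrderOne
end RenyiPoisson

namespace RenyiPoisson

open Filter Topology

/-! ### Product integrals and product densities -/

section ProductIntegrals

theorem lintegral_pi_fin_prod {X : Type*} [MeasurableSpace X] (μ : Measure X) [SigmaFinite μ] :
    ∀ (n : ℕ) (φ : Fin n → X → ℝ≥0∞), (∀ i, Measurable (φ i)) →
      ∫⁻ x, ∏ i, φ i (x i) ∂(Measure.pi fun _ : Fin n ↦ μ) = ∏ i, ∫⁻ t, φ i t ∂μ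
  | 0, φ, _ => by simp
  | n + 1, φ, hφ => by
    have e := (measurePreserving_piFinSuccAbove (fun _ : Fin (n + 1) ↦ μ) 0)
    have h1 : ∫⁻ x, ∏ i, φ i (x i) ∂(Measure.pi fun _ : Fin (n + 1) ↦ μ) =
        ∫⁻ z : X × (Fin n → X), φ 0 z.1 * ∏ i : Fin n, φ i.succ (z.2 i)
          ∂(μ.prod (Measure.pi fun _ : Fin n ↦ μ)) := by
      rw [← e.lintegral_comp (by fun_prop)]
      refine lintegral_congr fun x ↦ ?_
      rw [Fin.prod_univ_succ]
      rfl
    rw [h1, lintegral_prod_mul (f := φ 0) (g := fun x : Fin n → X ↦ ∏ i, φ i.succ (x i)) (hφ 0).aemeasurable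
      (Finset.measurable_fun_prod _ fun i _ ↦ (hφ i.succ).comp (measurable_pi_apply i)).aemeasurable,
      Fin.prod_univ_succ,
      lintegral_pi_fin_prod μ n (fun i ↦ φ i.succ) fun i ↦ hφ _]

theorem pi_withDensity_fin {X : Type*} [MeasurableSpace X] (μ : Measure X) [SigmaFinite μ]
    (n : ℕ) {φ : X → ℝ≥0∞} (hφ : Measurable φ) [SigmaFinite (μ.withDensity φ)] :
    (Measure.pi fun _ : Fin n ↦ μ.withDensity φ) =
      (Measure.pi fun _ : Fin n ↦ μ).withDensity fun x ↦ ∏ i, φ (x i) := by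
  refine (Measure.pi_eq fun s hs ↦ ?_)
  rw [withDensity_apply _ (MeasurableSet.univ_pi hs), ← lintegral_indicator
    (MeasurableSet.univ_pi hs)]
  have h : ∀ x : Fin n → X, (univ.pi s).indicator (fun x ↦ ∏ i, φ (x i)) x =
      ∏ i, (s i).indicator φ (x i) := by
    intro x
    by_cases hx : x ∈ univ.pi s
    · rw [indicator_of_mem hx]
      exact Finset.prod_congr rfl fun i _ ↦ (indicator_of_mem (hx i (mem_univ i)) _).symm
    · rw [indicator_of_notMem hx]
      simp only [mem_univ_pi, not_forall] at hx
      obtain ⟨i, hi⟩ := hx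
      exact (Finset.prod_eq_zero (Finset.mem_univ i) (indicator_of_notMem hi _)).symm
  simp_rw [h]
  rw [lintegral_pi_fin_prod μ n _ fun i ↦ hφ.indicator (hs i)]
  refine Finset.prod_congr rfl fun i _ ↦ ?_
  rw [lintegral_indicator (hs i), withDensity_apply _ (hs i)]

end ProductIntegrals

/-! ### Arrival times as measurable functions of the path -/

section Arrivals

variable {T : ℝ}

theorem measurable_eval (t : Ioc (0 : ℝ) T) : Measurable fun ω : SamplePath T ↦ ω.1 t :=
  (measurable_pi_apply t).comp measurable_subtype_coe

/-- The `k`-th arrival time (counted from zero). -/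
noncomputable def arrival (k : ℕ) (ω : SamplePath T) : ℝ :=
  ⨅ r : {r : ℚ // (r : ℝ) ∈ Ioc 0 T}, if (k : ℤ) < ω.1 ⟨(r : ℚ), r.2⟩ then ((r : ℚ) : ℝ) else T

/-- The restriction to rational times makes the infimum countable; this is its purpose. -/
theorem measurable_arrival (k : ℕ) : Measurable (arrival k : SamplePath T → ℝ) := by
  refine Measurable.iInf fun r ↦ ?_
  exact Measurable.ite (measurableSet_lt measurable_const (measurable_eval _)) measurable_const
    measurable_const

/-- The number of coordinates up to `t` is unchanged by sorting, and it exceeds `k` exactly when the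
coordinate with index `k` in increasing order is at most `t`. -/
theorem lt_countingPath_iff {n : ℕ} (x : Fin n → ℝ) (k : Fin n) (t : Ioc (0 : ℝ) T) :
    ((k : ℕ) : ℤ) < (countingPath T x).1 t ↔ x (Tuple.sort x k) ≤ t := by
  have h := Tuple.lt_card_le_iff_apply_le_of_monotone (j := k) (a := (t : ℝ))
    (Tuple.monotone_sort x)
  rw [← Function.comp_apply (f := x), ← h]
  change _ < (∑ i, if x i ≤ (t : ℝ) then 1 else 0 : ℤ) ↔ _
  rw [← Equiv.sum_comp (Tuple.sort x) (fun i ↦ if x i ≤ (t : ℝ) then (1 : ℤ) else 0),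
    Finset.sum_boole]
  simp

variable [hT : Fact (0 < T)]

/-- The number of arrivals. -/
def arrivalCount (ω : SamplePath T) : ℕ := (ω.1 ⟨T, hT.out, le_rfl⟩).toNat

theorem measurable_arrivalCount : Measurable (arrivalCount : SamplePath T → ℕ) :=
  (measurable_of_countable Int.toNat).comp (measurable_eval _)

theorem arrivalCount_countingPath {n : ℕ} {x : Fin n → ℝ} (hx : ∀ i, x i ∈ Ioc 0 T) :
    arrivalCount (countingPath T x) = n := by
  have : (countingPath T x).1 ⟨T, hT.out, le_rfl⟩ = n := by
    change (∑ i, if x i ≤ T then 1 else 0 : ℤ) = n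
    rw [Finset.sum_congr rfl fun i _ ↦ if_pos (hx i).2]
    simp
  rw [arrivalCount, this, Int.toNat_natCast]

theorem arrival_countingPath {n : ℕ} {x : Fin n → ℝ} (hx : ∀ i, x i ∈ Ioc 0 T) (k : Fin n) :
    arrival (k : ℕ) (countingPath T x) = x (Tuple.sort x k) := by
  have hT0 := hT.out
  set s := x (Tuple.sort x k) with hs
  have hsT : s ∈ Ioc 0 T := hx _
  have hne : Nonempty {r : ℚ // (r : ℝ) ∈ Ioc 0 T} := by
    obtain ⟨r, h1, h2⟩ := exists_rat_btwn hT0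
    exact ⟨⟨r, h1, h2.le⟩⟩
  have hlow : ∀ r : {r : ℚ // (r : ℝ) ∈ Ioc 0 T},
      s ≤ if ((k : ℕ) : ℤ) < (countingPath T x).1 ⟨(r : ℚ), r.2⟩ then ((r : ℚ) : ℝ) else T := by
    intro r
    split_ifs with h
    · exact (lt_countingPath_iff x k ⟨(r : ℚ), r.2⟩).1 h
    · exact hsT.2
  refine le_antisymm ?_ (le_ciInf hlow)
  have hbdd : BddBelow (range fun r : {r : ℚ // (r : ℝ) ∈ Ioc 0 T} ↦
      if ((k : ℕ) : ℤ) < (countingPath T x).1 ⟨(r : ℚ), r.2⟩ then ((r : ℚ) : ℝ) else T) :=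
    ⟨s, by rintro _ ⟨r, rfl⟩; exact hlow r⟩
  refine le_of_forall_gt fun b hb ↦ ?_
  -- If `s < T`, a rational just to the right of `s` approximates the infimum. If `s = T` there is
  -- no room to the right, and the default value `T` in `arrival` gives the bound.
  by_cases hsT' : s < T
  · obtain ⟨r, h1, h2⟩ := exists_rat_btwn (lt_min hsT' hb)
    have hr : (r : ℝ) ∈ Ioc 0 T := ⟨hsT.1.trans h1, (h2.trans_le (min_le_left _ _)).le⟩
    refine (ciInf_le hbdd ⟨r, hr⟩).trans_lt ?_
    rw [if_pos ((lt_countingPath_iff x k ⟨(r : ℝ), hr⟩).2 h1.le)]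
    exact h2.trans_le (min_le_right _ _)
  · obtain ⟨r⟩ := hne
    refine (ciInf_le hbdd r).trans_lt ?_
    have : T < b := (not_lt.1 hsT').trans_lt hb
    split_ifs
    · exact r.2.2.trans_lt this
    · exact this

/-- The product of the values of `φ` at the arrival times. -/
noncomputable def pathProd (φ : ℝ → ℝ) (ω : SamplePath T) : ℝ :=
  ∏ k ∈ Finset.range (arrivalCount ω), φ (arrival k ω)

theorem measurable_pathProd {φ : ℝ → ℝ} (hφ : Measurable φ) :
    Measurable (pathProd φ : SamplePath T → ℝ) := by
  have hn : ∀ n : ℕ, Measurable fun ω : SamplePath T ↦ ∏ k ∈ Finset.range n, φ (arrival k ω) :=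
    fun n ↦ Finset.measurable_fun_prod _ fun k _ ↦ hφ.comp (measurable_arrival k)
  have h : Measurable (Function.uncurry fun (n : ℕ) (ω : SamplePath T) ↦
      ∏ k ∈ Finset.range n, φ (arrival k ω)) := measurable_from_prod_countable_right hn
  have h2 : Measurable fun ω : SamplePath T ↦ (arrivalCount ω, ω) :=
    measurable_arrivalCount.prodMk measurable_id
  have h3 := h.comp h2
  exact h3

/-- The path only remembers the sorted points, but the product is symmetric, so the sorting
permutation drops out. -/
theorem pathProd_countingPath (φ : ℝ → ℝ) {n : ℕ} {x : Fin n → ℝ} (hx : ∀ i, x i ∈ Ioc 0 T) :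
    pathProd φ (countingPath T x) = ∏ i, φ (x i) := by
  rw [pathProd, arrivalCount_countingPath hx, Finset.prod_range,
    ← Equiv.prod_comp (Tuple.sort x) fun i ↦ φ (x i)]
  exact Finset.prod_congr rfl fun k _ ↦ by rw [arrival_countingPath hx]

theorem pathProd_nonneg {φ : ℝ → ℝ} (hφ : ∀ t, 0 ≤ φ t) (ω : SamplePath T) :
    0 ≤ pathProd φ ω := Finset.prod_nonneg fun _ _ ↦ hφ _

theorem pathProd_mono {φ ψ : ℝ → ℝ} (hφ : ∀ t, 0 ≤ φ t) (h : ∀ t, φ t ≤ ψ t)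
    (ω : SamplePath T) : pathProd φ ω ≤ pathProd ψ ω :=
  Finset.prod_le_prod (fun _ _ ↦ hφ _) fun _ _ ↦ h _

end Arrivals

/-! ### A common reference measure and the Poisson densities -/

section ReferenceMeasure

/-- The reference measure: `e^T` times the law of the Poisson process with unit intensity. -/
noncomputable def reference (T : ℝ) : Measure (SamplePath T) :=
  Measure.sum fun n : ℕ ↦ ((Nat.factorial n : ℝ≥0∞)⁻¹) •
    (Measure.pi fun _ : Fin n ↦ volume.restrict (Ioc 0 T)).map (countingPath T)

variable {T : ℝ}

theorem lintegral_reference {Φ : SamplePath T → ℝ≥0∞} (hΦ : Measurable Φ) :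
    ∫⁻ ω, Φ ω ∂(reference T) = ∑' n : ℕ, ((Nat.factorial n : ℝ≥0∞)⁻¹) *
      ∫⁻ x, Φ (countingPath T x) ∂(Measure.pi fun _ : Fin n ↦ volume.restrict (Ioc 0 T)) := by
  rw [reference, lintegral_sum_measure]
  refine tsum_congr fun n ↦ ?_
  rw [lintegral_smul_measure, lintegral_map hΦ (measurable_countingPath T n), smul_eq_mul]

theorem ae_mem_Ioc (n : ℕ) : ∀ᵐ x ∂(Measure.pi fun _ : Fin n ↦ volume.restrict (Ioc (0 : ℝ) T)),
    ∀ i, x i ∈ Ioc 0 T := by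
  rw [← Measure.restrict_pi_pi]
  filter_upwards [ae_restrict_mem (MeasurableSet.univ_pi fun _ ↦ measurableSet_Ioc)] with x hx i
  exact hx i (mem_univ i)

theorem ae_injective (n : ℕ) :
    ∀ᵐ x ∂(Measure.pi fun _ : Fin n ↦ volume.restrict (Ioc (0 : ℝ) T)), Function.Injective x := by
  rw [← Measure.restrict_pi_pi]
  refine ae_restrict_of_ae ?_
  have : ∀ᵐ x : Fin n → ℝ, ∀ i j, i ≠ j → x i ≠ x j := by
    rw [ae_all_iff]; intro i
    rw [ae_all_iff]; intro j
    by_cases hij : i = j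
    · exact Eventually.of_forall fun x h ↦ absurd hij h
    -- The coincidence set is the kernel of a nonzero linear form, a proper subspace, hence null.
    let L : (Fin n → ℝ) →ₗ[ℝ] ℝ := (LinearMap.proj i : (Fin n → ℝ) →ₗ[ℝ] ℝ) - LinearMap.proj j
    have hne : LinearMap.ker L ≠ ⊤ := by
      rw [Ne, LinearMap.ker_eq_top]
      intro h
      have := LinearMap.congr_fun h (Pi.single i 1)
      simp [L, Ne.symm hij] at this
    have h0 := Measure.addHaar_submodule volume _ hne
    rw [ae_iff]
    refine measure_mono_null (fun x hx ↦ ?_) h0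
    simp only [not_forall, not_not, mem_ofPred_eq] at hx
    simp [L, hx.2]
  filter_upwards [this] with x hx i j h
  by_contra hij
  exact hx i j hij h

/-- The law sees the intensity only through integrals, so a merely integrable intensity may be
replaced by a Borel version with everywhere valid bounds. -/
theorem poissonProcess_congr {f g : ℝ → ℝ} (h : f =ᵐ[volume.restrict (Ioc 0 T)] g) :
    poissonProcess T f = poissonProcess T g := by
  have h1 : intensityMeasure T f = intensityMeasure T g :=
    withDensity_congr_ae (h.mono fun t ht ↦ by simp only [ht])
  rw [poissonProcess, poissonProcess, h1, integral_congr_ae h]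

variable [hT : Fact (0 < T)]

/-- The part with `n` arrivals contributes `(∫ φ)^n / n!`, and the exponential series sums these.
All later integrals over paths reduce to this formula, because powers and products of Poisson
densities are again of the form constant times `pathProd`. -/
theorem lintegral_pathProd {φ : ℝ → ℝ} (hφ : Measurable φ) (h0 : ∀ t, 0 ≤ φ t)
    (hi : IntegrableOn φ (Ioc 0 T)) :
    ∫⁻ ω, ENNReal.ofReal (pathProd φ ω) ∂(reference T) =
      ENNReal.ofReal (Real.exp (∫ t in Ioc 0 T, φ t)) := by
  rw [lintegral_reference (measurable_pathProd hφ).ennreal_ofReal]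
  have hΛ : 0 ≤ ∫ t in Ioc 0 T, φ t := integral_nonneg h0
  have hterm : ∀ n : ℕ, ((Nat.factorial n : ℝ≥0∞)⁻¹) *
      ∫⁻ x, ENNReal.ofReal (pathProd φ (countingPath T x))
        ∂(Measure.pi fun _ : Fin n ↦ volume.restrict (Ioc 0 T)) =
      ENNReal.ofReal ((∫ t in Ioc 0 T, φ t) ^ n / n.factorial) := by
    intro n
    have h1 : ∫⁻ x, ENNReal.ofReal (pathProd φ (countingPath T x))
        ∂(Measure.pi fun _ : Fin n ↦ volume.restrict (Ioc 0 T)) =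
        ∫⁻ x, ∏ i, ENNReal.ofReal (φ (x i))
        ∂(Measure.pi fun _ : Fin n ↦ volume.restrict (Ioc 0 T)) := by
      refine lintegral_congr_ae ?_
      filter_upwards [ae_mem_Ioc n] with x hx
      rw [pathProd_countingPath φ hx, ENNReal.ofReal_prod_of_nonneg fun i _ ↦ h0 _]
    rw [h1, lintegral_pi_fin_prod _ n (fun _ t ↦ ENNReal.ofReal (φ t)) fun _ ↦ hφ.ennreal_ofReal,
      Finset.prod_const, Finset.card_univ, Fintype.card_fin,
      ← ofReal_integral_eq_lintegral_ofReal hi (Eventually.of_forall h0),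
      ENNReal.ofReal_div_of_pos (by positivity), ENNReal.ofReal_pow hΛ, ENNReal.ofReal_natCast,
      ENNReal.div_eq_inv_mul]
  simp_rw [hterm]
  rw [← ENNReal.ofReal_tsum_of_nonneg (fun n ↦ by positivity) (Real.summable_pow_div_factorial _),
    ← NormedSpace.exp_eq_tsum_div (𝔸 := ℝ) |> fun h ↦ congrFun h _, ← Real.exp_eq_exp_ℝ]

theorem pathProd_one : pathProd (fun _ ↦ 1) = fun _ : SamplePath T ↦ (1 : ℝ) := by
  ext ω; simp [pathProd]

instance isFiniteMeasure_reference : IsFiniteMeasure (reference T) := by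
  constructor
  have h := lintegral_pathProd (T := T) (φ := fun _ ↦ 1) measurable_const (fun _ ↦ zero_le_one)
    (by simp)
  rw [pathProd_one] at h
  simp only [ENNReal.ofReal_one, lintegral_const, one_mul] at h
  rw [h]
  exact ENNReal.ofReal_lt_top

/-- The density of the Poisson process with intensity `f` with respect to `reference T`. -/
noncomputable def pathDensity (f : ℝ → ℝ) (ω : SamplePath T) : ℝ :=
  Real.exp (-∫ t in Ioc 0 T, f t) * pathProd f ω

theorem measurable_pathDensity {f : ℝ → ℝ} (hf : Measurable f) :
    Measurable (pathDensity f : SamplePath T → ℝ) := (measurable_pathProd hf).const_mul _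

theorem pathDensity_nonneg {f : ℝ → ℝ} (hf : ∀ t, 0 ≤ f t) (ω : SamplePath T) :
    0 ≤ pathDensity f ω := mul_nonneg (Real.exp_pos _).le (pathProd_nonneg hf ω)

theorem poissonProcess_eq_withDensity {f : ℝ → ℝ} (hf : Measurable f) (h0 : ∀ t, 0 ≤ f t)
    (hi : IntegrableOn f (Ioc 0 T)) :
    poissonProcess T f = (reference T).withDensity fun ω ↦ ENNReal.ofReal (pathDensity f ω) := by
  have hfin : IsFiniteMeasure (intensityMeasure T f) := by
    rw [intensityMeasure]
    exact isFiniteMeasure_withDensity_ofReal hi.2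
  ext s hs
  have hmd := (measurable_pathDensity (T := T) hf).ennreal_ofReal
  rw [withDensity_apply _ hs, ← lintegral_indicator hs, lintegral_reference (hmd.indicator hs),
    poissonProcess, Measure.smul_apply, Measure.sum_apply _ hs, smul_eq_mul, ← ENNReal.tsum_mul_left]
  refine tsum_congr fun n ↦ ?_
  have hpre := measurable_countingPath T n hs
  rw [Measure.smul_apply, Measure.map_apply (measurable_countingPath T n) hs, smul_eq_mul,
    mul_left_comm]
  congr 1
  have hpi : (Measure.pi fun _ : Fin n ↦ intensityMeasure T f) =
      (Measure.pi fun _ : Fin n ↦ volume.restrict (Ioc 0 T)).withDensity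
        fun x ↦ ∏ i, ENNReal.ofReal (f (x i)) := by
    have : SigmaFinite ((volume.restrict (Ioc 0 T)).withDensity fun t ↦ ENNReal.ofReal (f t)) := by
      change SigmaFinite (intensityMeasure T f)
      infer_instance
    exact pi_withDensity_fin _ n hf.ennreal_ofReal
  rw [hpi, withDensity_apply _ hpre, ← lintegral_indicator hpre, ← lintegral_const_mul]
  · refine lintegral_congr_ae ?_
    filter_upwards [ae_mem_Ioc n] with x hx
    by_cases hxs : countingPath T x ∈ s
    · rw [indicator_of_mem (show x ∈ countingPath T ⁻¹' s from hxs), indicator_of_mem hxs,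
        pathDensity, pathProd_countingPath f hx, ENNReal.ofReal_mul (Real.exp_pos _).le,
        ENNReal.ofReal_prod_of_nonneg fun i _ ↦ h0 _]
    · rw [indicator_of_notMem (show x ∉ countingPath T ⁻¹' s from hxs), indicator_of_notMem hxs,
        mul_zero]
  · exact Measurable.indicator (by fun_prop) hpre

theorem rnDeriv_poissonProcess {f : ℝ → ℝ} (hf : Measurable f) (h0 : ∀ t, 0 ≤ f t)
    (hi : IntegrableOn f (Ioc 0 T)) :
    (poissonProcess T f).rnDeriv (reference T) =ᵐ[reference T]
      fun ω ↦ ENNReal.ofReal (pathDensity f ω) := by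
  rw [poissonProcess_eq_withDensity hf h0 hi]
  exact Measure.rnDeriv_withDensity _ (measurable_pathDensity hf).ennreal_ofReal

theorem poissonProcess_absolutelyContinuous {f : ℝ → ℝ} (hf : Measurable f) (h0 : ∀ t, 0 ≤ f t)
    (hi : IntegrableOn f (Ioc 0 T)) : poissonProcess T f ≪ reference T := by
  rw [poissonProcess_eq_withDensity hf h0 hi]
  exact withDensity_absolutelyContinuous _ _

/-- Almost surely the arrival times are distinct points of `(0,T]`. -/
theorem ae_arrival : ∀ᵐ ω ∂(reference T), (∀ k < arrivalCount ω, arrival k ω ∈ Ioc 0 T) ∧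
    ∀ j < arrivalCount ω, ∀ k < arrivalCount ω, arrival j ω = arrival k ω → j = k := by
  have hms : MeasurableSet {ω : SamplePath T |
      (∀ k < arrivalCount ω, arrival k ω ∈ Ioc 0 T) ∧
      ∀ j < arrivalCount ω, ∀ k < arrivalCount ω, arrival j ω = arrival k ω → j = k} := by
    have hlt : ∀ k : ℕ, MeasurableSet {ω : SamplePath T | k < arrivalCount ω} := fun k ↦
      measurableSet_lt measurable_const measurable_arrivalCount
    rw [measurableSet_setOfPred]
    refine Measurable.and (Measurable.forall fun k ↦ Measurable.imp
      (measurableSet_setOfPred.1 (hlt k)) ?_) (Measurable.forall fun j ↦ Measurable.imp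
      (measurableSet_setOfPred.1 (hlt j)) (Measurable.forall fun k ↦ Measurable.imp
      (measurableSet_setOfPred.1 (hlt k)) (Measurable.imp ?_ measurable_const)))
    · exact measurableSet_setOfPred.1 (measurable_arrival k measurableSet_Ioc)
    · exact measurableSet_setOfPred.1 (measurableSet_eq_fun (measurable_arrival j)
        (measurable_arrival k))
  rw [reference, Measure.ae_sum_iff' hms]
  intro n
  refine Measure.ae_smul_measure ?_ _
  rw [ae_map_iff (measurable_countingPath T n).aemeasurable hms]
  filter_upwards [ae_mem_Ioc n, ae_injective n] with x hx hinj
  rw [arrivalCount_countingPath hx]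
  refine ⟨fun k hk ↦ ?_, fun j hj k hk h ↦ ?_⟩
  · rw [arrival_countingPath hx ⟨k, hk⟩]; exact hx _
  · rw [arrival_countingPath hx ⟨k, hk⟩, arrival_countingPath hx ⟨j, hj⟩] at h
    have := (Tuple.sort x).injective (hinj h)
    simpa using this

end ReferenceMeasure
end RenyiPoisson

namespace RenyiPoisson

open Filter Topology

/-! ### The local divergence as a function of the order -/

section LocalDivergence

/-- The divergence of order `α`, per unit of the second argument. -/
noncomputable def entropyFun (α u : ℝ) : ℝ :=
  if α = 1 then u * Real.log u - u + 1 else (u ^ α - α * u - (1 - α)) / (α - 1)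

/-- The Rényi divergence rate of Poisson processes with intensities `x` and `q`. -/
noncomputable def localDiv (α x q : ℝ) : ℝ :=
  if α = 1 then x * Real.log (x / q) - x + q
  else (x ^ α * q ^ (1 - α) - α * x - (1 - α) * q) / (α - 1)

theorem localDiv_zero_zero {α : ℝ} (hα : 0 < α) : localDiv α 0 0 = 0 := by
  unfold localDiv
  split_ifs with h
  · simp
  · simp [Real.zero_rpow hα.ne']

theorem localDiv_eq {α x q : ℝ} (hα : 0 < α) (hx : 0 ≤ x) (hq : 0 ≤ q) (h : q = 0 → x = 0) :
    localDiv α x q = q * entropyFun α (x / q) := by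
  rcases hq.eq_or_lt with h0 | h0
  · rw [← h0, h h0.symm, localDiv_zero_zero hα, zero_mul]
  · unfold localDiv entropyFun
    split_ifs with h1
    · field_simp
    · have : α - 1 ≠ 0 := sub_ne_zero.2 h1
      rw [Real.div_rpow hx hq, Real.rpow_sub h0, Real.rpow_one]
      field_simp

/-- Bernoulli's inequality for `u = 1 + (u - 1)`: its direction reverses at `α = 1` together with
the sign of the denominator. -/
theorem entropyFun_nonneg {α u : ℝ} (hα : 0 < α) (hu : 0 ≤ u) : 0 ≤ entropyFun α u := by
  unfold entropyFun
  split_ifs with h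
  · have := InformationTheory.klFun_nonneg hu
    rw [InformationTheory.klFun_apply] at this
    linarith
  · rcases lt_or_gt_of_ne h with hlt | hgt
    · rw [div_nonneg_iff]
      right
      have := rpow_one_add_le_one_add_mul_self (s := u - 1) (by linarith) hα.le hlt.le
      rw [add_sub_cancel] at this
      exact ⟨by linarith, by linarith⟩
    · refine div_nonneg ?_ (by linarith)
      have := one_add_mul_self_le_rpow_one_add (s := u - 1) (by linarith) hgt.le
      rw [add_sub_cancel] at this
      linarith

/-- The bound is uniform in the order near one, which is what dominated convergence in `α` requires.
Writing `u^α = u · u^(α-1)` leaves a Bernoulli or logarithm bound for the second factor. -/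
theorem entropyFun_le {α u : ℝ} (hα : 0 < α) (h2 : α ≤ 2) (hu : 0 ≤ u) :
    entropyFun α u ≤ (u - 1) ^ 2 := by
  have hlog : ∀ v : ℝ, 0 < v → Real.log v ≤ v - 1 := fun v hv ↦ Real.log_le_sub_one_of_pos hv
  unfold entropyFun
  rcases hu.eq_or_lt with h0 | h0
  · rw [← h0]
    split_ifs with h
    · simp
    · have : α - 1 ≠ 0 := sub_ne_zero.2 h
      have e : (0 ^ α - α * 0 - (1 - α)) / (α - 1) = 1 := by
        rw [Real.zero_rpow hα.ne', div_eq_one_iff_eq this]; ring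
      rw [e]; norm_num
  split_ifs with h
  · nlinarith [hlog u h0]
  · have e : u ^ α = u * u ^ (α - 1) := by
      rw [← Real.rpow_one_add' hu (by linarith)]; ring_nf
    rcases lt_or_gt_of_ne h with hlt | hgt
    · rw [div_le_iff_of_neg (by linarith), e]
      have h1 : 1 + (α - 1) * Real.log u ≤ u ^ (α - 1) := by
        rw [← Real.log_rpow h0]
        linarith [hlog _ (Real.rpow_pos_of_pos h0 (α - 1))]
      have h3 : u * (1 + (α - 1) * (u - 1)) ≤ u * u ^ (α - 1) := by
        gcongr
        nlinarith [hlog u h0]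
      nlinarith
    · rw [div_le_iff₀ (by linarith), e]
      have h1 := rpow_one_add_le_one_add_mul_self (s := u - 1) (p := α - 1) (by linarith)
        (by linarith) (by linarith)
      rw [add_sub_cancel] at h1
      nlinarith [mul_le_mul_of_nonneg_left h1 hu]

/-- For `α ≠ 1` the expression is, up to `1 - u`, the slope at `1` of `α ↦ u^α`, whose derivative
there is `u log u`. At `u = 0` it is constantly one for positive orders. -/
theorem tendsto_entropyFun {u : ℝ} (hu : 0 ≤ u) :
    Tendsto (fun α ↦ entropyFun α u) (𝓝[≠] 1) (𝓝 (entropyFun 1 u)) := by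
  rcases hu.eq_or_lt with h0 | h0
  · refine Tendsto.congr' ?_ (tendsto_const_nhds (x := entropyFun 1 u))
    have hpos : ∀ᶠ α : ℝ in 𝓝[≠] 1, 0 < α :=
      nhdsWithin_le_nhds (eventually_gt_nhds zero_lt_one)
    filter_upwards [self_mem_nhdsWithin, hpos] with α h1 hα
    have h2 : α ≠ 1 := h1
    have h1' : α - 1 ≠ 0 := sub_ne_zero.2 h2
    rw [entropyFun, entropyFun, if_pos rfl, if_neg h2, ← h0, Real.zero_rpow hα.ne']
    field_simp
    ring
  · have hd : HasDerivAt (fun α : ℝ ↦ u ^ α) (u ^ (1 : ℝ) * Real.log u) 1 :=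
      (Real.hasStrictDerivAt_const_rpow h0 1).hasDerivAt
    have hs := (hasDerivAt_iff_tendsto_slope.1 hd).sub_const u |>.add_const 1
    rw [entropyFun, if_pos rfl]
    rw [Real.rpow_one] at hs
    refine hs.congr' ?_
    filter_upwards [self_mem_nhdsWithin] with α h1
    have h2 : α ≠ 1 := h1
    have h1' : α - 1 ≠ 0 := sub_ne_zero.2 h2
    rw [entropyFun, if_neg h2, slope_def_field, Real.rpow_one]
    field_simp
    ring

end LocalDivergence

/-! ### Divergences between Poisson processes -/

section PoissonDivergence

variable {T : ℝ} {f q : ℝ → ℝ} {K : ℝ}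

theorem measurable_localDiv {α : ℝ} (hf : Measurable f) (hq : Measurable q) :
    Measurable fun t ↦ localDiv α (f t) (q t) := by
  unfold localDiv
  split_ifs <;> fun_prop

theorem eq_zero_of_le_mul (hf0 : ∀ t, 0 ≤ f t) (hfq : ∀ t, f t ≤ K * q t) (t : ℝ) (h : q t = 0) :
    f t = 0 := le_antisymm (by simpa [h] using hfq t) (hf0 t)

theorem div_mem_of_le_mul (hK : 0 ≤ K) (hf0 : ∀ t, 0 ≤ f t) (hq0 : ∀ t, 0 ≤ q t)
    (hfq : ∀ t, f t ≤ K * q t) (t : ℝ) : f t / q t ∈ Icc 0 K :=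
  ⟨div_nonneg (hf0 t) (hq0 t), div_le_of_le_mul₀ (hq0 t) hK (hfq t)⟩

theorem localDiv_bound {α : ℝ} (hα : 0 < α) (h2 : α ≤ 2) (hK : 0 ≤ K) (hf0 : ∀ t, 0 ≤ f t)
    (hq0 : ∀ t, 0 ≤ q t) (hfq : ∀ t, f t ≤ K * q t) (t : ℝ) :
    ‖localDiv α (f t) (q t)‖ ≤ (K + 1) ^ 2 * q t := by
  have hu := div_mem_of_le_mul hK hf0 hq0 hfq t
  rw [localDiv_eq hα (hf0 t) (hq0 t) (eq_zero_of_le_mul hf0 hfq t), Real.norm_eq_abs,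
    abs_of_nonneg (mul_nonneg (hq0 t) (entropyFun_nonneg hα hu.1)), mul_comm]
  refine mul_le_mul_of_nonneg_right ((entropyFun_le hα h2 hu.1).trans ?_) (hq0 t)
  have h3 := hu.1
  have h4 := hu.2
  nlinarith

/-- The local divergences converge as the order tends to one. -/
theorem tendsto_integral_localDiv (hK : 0 ≤ K) (hf : Measurable f) (hq : Measurable q)
    (hf0 : ∀ t, 0 ≤ f t) (hq0 : ∀ t, 0 ≤ q t) (hfq : ∀ t, f t ≤ K * q t)
    (hi : IntegrableOn q (Ioc 0 T)) :
    Tendsto (fun α ↦ ∫ t in Ioc 0 T, localDiv α (f t) (q t)) (𝓝[≠] 1)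
      (𝓝 (∫ t in Ioc 0 T, localDiv 1 (f t) (q t))) := by
  have hpos : ∀ᶠ α : ℝ in 𝓝[≠] 1, 0 < α ∧ α ≤ 2 :=
    nhdsWithin_le_nhds ((eventually_gt_nhds zero_lt_one).and
      (eventually_le_nhds one_lt_two))
  refine tendsto_integral_filter_of_dominated_convergence (fun t ↦ (K + 1) ^ 2 * q t) ?_ ?_
    (hi.const_mul _) ?_
  · exact Eventually.of_forall fun α ↦ (measurable_localDiv hf hq).aestronglyMeasurable
  · filter_upwards [hpos] with α hα
    exact Eventually.of_forall fun t ↦ localDiv_bound hα.1 hα.2 hK hf0 hq0 hfq t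
  · refine Eventually.of_forall fun t ↦ ?_
    have hu := div_mem_of_le_mul hK hf0 hq0 hfq t
    rw [localDiv_eq one_pos (hf0 t) (hq0 t) (eq_zero_of_le_mul hf0 hfq t)]
    refine ((tendsto_entropyFun hu.1).const_mul (q t)).congr' ?_
    filter_upwards [hpos] with α hα
    rw [localDiv_eq hα.1 (hf0 t) (hq0 t) (eq_zero_of_le_mul hf0 hfq t)]

theorem rpow_mul_rpow_le {α : ℝ} (hα : 0 < α) (hK : 0 ≤ K) (hf0 : ∀ t, 0 ≤ f t)
    (hq0 : ∀ t, 0 ≤ q t) (hfq : ∀ t, f t ≤ K * q t) (t : ℝ) :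
    f t ^ α * q t ^ (1 - α) ≤ K ^ α * q t := by
  rcases (hq0 t).eq_or_lt with h0 | h0
  · rw [eq_zero_of_le_mul hf0 hfq t h0.symm, ← h0, Real.zero_rpow hα.ne']; simp
  · calc f t ^ α * q t ^ (1 - α) ≤ (K * q t) ^ α * q t ^ (1 - α) := by
          gcongr
          · exact hf0 t
          · exact hfq t
      _ = K ^ α * q t := by
          rw [Real.mul_rpow hK h0.le, mul_assoc, ← Real.rpow_add h0, add_sub_cancel, Real.rpow_one]

theorem integrableOn_rpow_mul_rpow {α : ℝ} (hα : 0 < α) (hK : 0 ≤ K)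
    (hf : Measurable f) (hq : Measurable q) (hf0 : ∀ t, 0 ≤ f t)
    (hq0 : ∀ t, 0 ≤ q t) (hfq : ∀ t, f t ≤ K * q t) (hi : IntegrableOn q (Ioc 0 T)) :
    IntegrableOn (fun t ↦ f t ^ α * q t ^ (1 - α)) (Ioc 0 T) := by
  refine (hi.const_mul (K ^ α)).mono' (by fun_prop) (Eventually.of_forall fun t ↦ ?_)
  rw [Real.norm_eq_abs, abs_of_nonneg (mul_nonneg (Real.rpow_nonneg (hf0 t) _)
    (Real.rpow_nonneg (hq0 t) _))]
  exact rpow_mul_rpow_le hα hK hf0 hq0 hfq t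

theorem integrableOn_of_le_mul (hf : Measurable f) (hf0 : ∀ t, 0 ≤ f t)
    (hfq : ∀ t, f t ≤ K * q t) (hi : IntegrableOn q (Ioc 0 T)) : IntegrableOn f (Ioc 0 T) := by
  refine (hi.const_mul K).mono' hf.aestronglyMeasurable (Eventually.of_forall fun t ↦ ?_)
  rw [Real.norm_eq_abs, abs_of_nonneg (hf0 t)]
  exact hfq t

theorem integral_localDiv {α : ℝ} (hα : 0 < α) (h1 : α ≠ 1) (hK : 0 ≤ K)
    (hf : Measurable f) (hq : Measurable q) (hf0 : ∀ t, 0 ≤ f t)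
    (hq0 : ∀ t, 0 ≤ q t) (hfq : ∀ t, f t ≤ K * q t) (hi : IntegrableOn q (Ioc 0 T)) :
    (α - 1) * ∫ t in Ioc 0 T, localDiv α (f t) (q t) =
      (∫ t in Ioc 0 T, f t ^ α * q t ^ (1 - α)) - α * (∫ t in Ioc 0 T, f t) -
        (1 - α) * ∫ t in Ioc 0 T, q t := by
  have hα1 : α - 1 ≠ 0 := sub_ne_zero.2 h1
  have hif : IntegrableOn f (Ioc 0 T) := integrableOn_of_le_mul hf hf0 hfq hi
  have hip : IntegrableOn (fun t ↦ f t ^ α * q t ^ (1 - α)) (Ioc 0 T) :=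
    integrableOn_rpow_mul_rpow hα hK hf hq hf0 hq0 hfq hi
  rw [← integral_const_mul, ← integral_const_mul, ← integral_const_mul,
    ← integral_sub hip (hif.const_mul _), ← integral_sub (f := fun t ↦ f t ^ α * q t ^ (1 - α) - α * f t)
      (hip.sub (hif.const_mul _)) (hi.const_mul _)]
  refine integral_congr_ae (Eventually.of_forall fun t ↦ ?_)
  simp only [localDiv, if_neg h1]
  field_simp

theorem coe_div_mul_log_ofReal_exp {κ : ℝ} (hκ : κ ≠ 0) (x : ℝ) :
    ((1 / κ : ℝ) : EReal) * ENNReal.log (ENNReal.ofReal (Real.exp (κ * x))) = (x : EReal) := by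
  rw [ENNReal.log_ofReal_of_pos (Real.exp_pos _), Real.log_exp]
  norm_cast
  field_simp

variable [hT : Fact (0 < T)]

/-- Multiplicativity of `pathProd`. If `q` vanishes at an arrival, so does `f` because `f ≤ K q`,
and both sides are zero even when `1 - α < 0` makes the second factor infinite. -/
theorem ofReal_pathDensity_rpow_mul {α : ℝ} (hα : 0 < α) (hf0 : ∀ t, 0 ≤ f t)
    (hq0 : ∀ t, 0 ≤ q t) (hfq : ∀ t, f t ≤ K * q t) (ω : SamplePath T) :
    ENNReal.ofReal (pathDensity f ω) ^ α * ENNReal.ofReal (pathDensity q ω) ^ (1 - α) =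
      ENNReal.ofReal (Real.exp (-(α * (∫ t in Ioc 0 T, f t) + (1 - α) * ∫ t in Ioc 0 T, q t))) *
        ENNReal.ofReal (pathProd (fun t ↦ f t ^ α * q t ^ (1 - α)) ω) := by
  by_cases hz : ∃ k ∈ Finset.range (arrivalCount ω), q (arrival k ω) = 0
  · obtain ⟨k, hk, hqk⟩ := hz
    have hfk := eq_zero_of_le_mul hf0 hfq _ hqk
    have e1 : pathDensity f ω = 0 := by
      rw [pathDensity, pathProd, Finset.prod_eq_zero hk hfk, mul_zero]
    have e2 : pathProd (fun t ↦ f t ^ α * q t ^ (1 - α)) ω = 0 :=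
      Finset.prod_eq_zero hk (by simp only [hfk, Real.zero_rpow hα.ne', zero_mul])
    rw [e1, e2]
    simp [hα]
  · push Not at hz
    have hpos : 0 < pathProd q ω :=
      Finset.prod_pos fun k hk ↦ lt_of_le_of_ne (hq0 _) (Ne.symm (hz k hk))
    have hpf := pathProd_nonneg hf0 ω
    have hdq : 0 < pathDensity q ω := mul_pos (Real.exp_pos _) hpos
    rw [ENNReal.ofReal_rpow_of_nonneg (pathDensity_nonneg hf0 ω) hα.le,
      ENNReal.ofReal_rpow_of_pos hdq, ← ENNReal.ofReal_mul (by have := pathDensity_nonneg hf0 ω; positivity),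
      ← ENNReal.ofReal_mul (Real.exp_pos _).le]
    congr 1
    have e : pathProd (fun t ↦ f t ^ α * q t ^ (1 - α)) ω =
        pathProd f ω ^ α * pathProd q ω ^ (1 - α) := by
      rw [pathProd, pathProd, pathProd, ← Real.finsetProd_rpow _ _ fun k _ ↦ hf0 _,
        ← Real.finsetProd_rpow _ _ fun k _ ↦ hq0 _, ← Finset.prod_mul_distrib]
    rw [e, pathDensity, pathDensity, Real.mul_rpow (Real.exp_pos _).le hpf,
      Real.mul_rpow (Real.exp_pos _).le hpos.le, ← Real.exp_mul, ← Real.exp_mul, mul_mul_mul_comm,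
      ← Real.exp_add]
    ring_nf

theorem hellinger_poissonProcess {α : ℝ} (hα : 0 < α) (h1 : α ≠ 1) (hK : 0 ≤ K)
    (hf : Measurable f) (hq : Measurable q) (hf0 : ∀ t, 0 ≤ f t)
    (hq0 : ∀ t, 0 ≤ q t) (hfq : ∀ t, f t ≤ K * q t) (hi : IntegrableOn q (Ioc 0 T)) :
    hellinger (reference T) α (poissonProcess T f) (poissonProcess T q) =
      ENNReal.ofReal (Real.exp ((α - 1) * ∫ t in Ioc 0 T, localDiv α (f t) (q t))) := by
  have hif : IntegrableOn f (Ioc 0 T) := integrableOn_of_le_mul hf hf0 hfq hi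
  have h : hellinger (reference T) α (poissonProcess T f) (poissonProcess T q) =
      ∫⁻ ω, ENNReal.ofReal (Real.exp (-(α * (∫ t in Ioc 0 T, f t) +
        (1 - α) * ∫ t in Ioc 0 T, q t))) *
        ENNReal.ofReal (pathProd (fun t ↦ f t ^ α * q t ^ (1 - α)) ω) ∂(reference T) := by
    refine lintegral_congr_ae ?_
    filter_upwards [rnDeriv_poissonProcess hf hf0 hif, rnDeriv_poissonProcess hq hq0 hi]
      with ω e1 e2
    rw [e1, e2]
    exact ofReal_pathDensity_rpow_mul hα hf0 hq0 hfq ω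
  have hm : Measurable fun t ↦ f t ^ α * q t ^ (1 - α) := by fun_prop
  rw [h, lintegral_const_mul _ (measurable_pathProd hm).ennreal_ofReal,
    lintegral_pathProd hm (fun t ↦ mul_nonneg (Real.rpow_nonneg (hf0 t) _)
      (Real.rpow_nonneg (hq0 t) _)) (integrableOn_rpow_mul_rpow hα hK hf hq hf0 hq0 hfq hi),
    ← ENNReal.ofReal_mul (Real.exp_pos _).le, ← Real.exp_add,
    integral_localDiv hα h1 hK hf hq hf0 hq0 hfq hi]
  ring_nf

theorem renyiDivergence_poissonProcess_of_ne_one {α : ℝ} (hα : 0 < α) (h1 : α ≠ 1) (hK : 0 ≤ K)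
    (hf : Measurable f) (hq : Measurable q) (hf0 : ∀ t, 0 ≤ f t)
    (hq0 : ∀ t, 0 ≤ q t) (hfq : ∀ t, f t ≤ K * q t) (hi : IntegrableOn q (Ioc 0 T)) :
    renyiDivergence α (poissonProcess T f) (poissonProcess T q) =
      ((∫ t in Ioc 0 T, localDiv α (f t) (q t) : ℝ) : EReal) := by
  have hif : IntegrableOn f (Ioc 0 T) := integrableOn_of_le_mul hf hf0 hfq hi
  have := isProbabilityMeasure_poissonProcess T f hif fun t _ ↦ hf0 t
  have := isProbabilityMeasure_poissonProcess T q hi fun t _ ↦ hq0 t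
  rw [renyiDivergence_eq hα h1 (poissonProcess_absolutelyContinuous hf hf0 hif),
    hellinger_poissonProcess hα h1 hK hf hq hf0 hq0 hfq hi,
    coe_div_mul_log_ofReal_exp (sub_ne_zero.2 h1)]

/-- The Rényi divergence of Poisson processes. -/
theorem renyiDivergence_poissonProcess {α : ℝ} (hα : 0 < α) (hK : 0 ≤ K)
    (hf : Measurable f) (hq : Measurable q) (hf0 : ∀ t, 0 ≤ f t)
    (hq0 : ∀ t, 0 ≤ q t) (hfq : ∀ t, f t ≤ K * q t) (hi : IntegrableOn q (Ioc 0 T)) :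
    renyiDivergence α (poissonProcess T f) (poissonProcess T q) =
      ((∫ t in Ioc 0 T, localDiv α (f t) (q t) : ℝ) : EReal) := by
  by_cases h1 : α = 1
  swap
  · exact renyiDivergence_poissonProcess_of_ne_one hα h1 hK hf hq hf0 hq0 hfq hi
  subst h1
  have hif : IntegrableOn f (Ioc 0 T) := integrableOn_of_le_mul hf hf0 hfq hi
  have := isProbabilityMeasure_poissonProcess T f hif fun t _ ↦ hf0 t
  have := isProbabilityMeasure_poissonProcess T q hi fun t _ ↦ hq0 t
  -- The divergence of order one lies above all those of order below one and below all those of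
  -- order above one; the local integrals of both kinds converge to the same value.
  have hlim := (continuous_coe_real_ereal.tendsto _).comp
    (tendsto_integral_localDiv hK hf hq hf0 hq0 hfq hi)
  refine le_antisymm ?_ ?_
  · refine ge_of_tendsto (hlim.mono_left (nhdsGT_le_nhdsNE 1)) ?_
    filter_upwards [self_mem_nhdsWithin] with β hβ
    have hβ' : 1 < β := hβ
    have h := renyiDivergence_one_le (W := poissonProcess T f) (Q := poissonProcess T q) hβ'
    rwa [renyiDivergence_poissonProcess_of_ne_one (by linarith) hβ'.ne' hK hf hq hf0 hq0 hfq hi]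
      at h
  · refine le_of_tendsto (hlim.mono_left (nhdsLT_le_nhdsNE 1)) ?_
    have hpos : ∀ᶠ β : ℝ in 𝓝[<] 1, 0 < β :=
      nhdsWithin_le_nhds (eventually_gt_nhds zero_lt_one)
    filter_upwards [self_mem_nhdsWithin, hpos] with β hβ hβ0
    have hβ' : β < 1 := hβ
    have h := renyiDivergence_le_one (W := poissonProcess T f) (Q := poissonProcess T q) hβ0 hβ'
    rwa [renyiDivergence_poissonProcess_of_ne_one hβ0 hβ'.ne hK hf hq hf0 hq0 hfq hi] at h

end PoissonDivergence
end RenyiPoisson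

namespace RenyiPoisson

open Filter Topology

/-! ### Uniform averages on finite sets and independence -/

section Average

/-- The uniform average of a function on a finite type. -/
noncomputable def avg {ι : Type*} [Fintype ι] (g : ι → ℝ) : ℝ :=
  (Fintype.card ι : ℝ)⁻¹ * ∑ i, g i

variable {ι κ : Type*} [Fintype ι] [Fintype κ]

theorem avg_const [Nonempty ι] (c : ℝ) : avg (fun _ : ι ↦ c) = c := by
  rw [avg, Finset.sum_const, Finset.card_univ, nsmul_eq_mul, inv_mul_cancel_left₀]
  exact_mod_cast Fintype.card_ne_zero

theorem avg_add (f g : ι → ℝ) : avg (fun i ↦ f i + g i) = avg f + avg g := by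
  rw [avg, avg, avg, Finset.sum_add_distrib, mul_add]

theorem avg_sub (f g : ι → ℝ) : avg (fun i ↦ f i - g i) = avg f - avg g := by
  rw [avg, avg, avg, Finset.sum_sub_distrib, mul_sub]

theorem avg_const_mul (c : ℝ) (f : ι → ℝ) : avg (fun i ↦ c * f i) = c * avg f := by
  rw [avg, avg, ← Finset.mul_sum, mul_left_comm]

theorem avg_mono {f g : ι → ℝ} (h : ∀ i, f i ≤ g i) : avg f ≤ avg g := by
  unfold avg
  gcongr
  exact h _

theorem avg_nonneg {f : ι → ℝ} (h : ∀ i, 0 ≤ f i) : 0 ≤ avg f := by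
  unfold avg
  have := Finset.sum_nonneg fun i (_ : i ∈ Finset.univ) ↦ h i
  positivity

theorem avg_le [Nonempty ι] {f : ι → ℝ} {c : ℝ} (h : ∀ i, f i ≤ c) : avg f ≤ c :=
  (avg_mono h).trans_eq (avg_const c)

theorem abs_avg_le (f : ι → ℝ) : |avg f| ≤ avg fun i ↦ |f i| := by
  unfold avg
  rw [abs_mul, abs_of_nonneg (by positivity : (0 : ℝ) ≤ (Fintype.card ι : ℝ)⁻¹)]
  gcongr
  exact Finset.abs_sum_le_sum_abs _ _

theorem sq_avg_le [Nonempty ι] (f : ι → ℝ) : avg f ^ 2 ≤ avg fun i ↦ f i ^ 2 := by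
  have h : 0 ≤ avg fun i ↦ (f i - avg f) ^ 2 := avg_nonneg fun i ↦ sq_nonneg _
  have e : (fun i ↦ (f i - avg f) ^ 2) = fun i ↦ (f i ^ 2 - 2 * avg f * f i) + avg f ^ 2 := by
    ext i; ring
  rw [e, avg_add, avg_sub, avg_const_mul, avg_const] at h
  linarith

theorem avg_comp_equiv (e : ι ≃ ι) (f : ι → ℝ) : avg (fun i ↦ f (e i)) = avg f := by
  rw [avg, avg, Equiv.sum_comp e f]

theorem integral_avg {X : Type*} [MeasurableSpace X] {μ : Measure X} {F : ι → X → ℝ}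
    (h : ∀ i, Integrable (F i) μ) :
    ∫ x, avg (fun i ↦ F i x) ∂μ = avg fun i ↦ ∫ x, F i x ∂μ := by
  unfold avg
  rw [integral_const_mul, integral_finsetSum _ fun i _ ↦ h i]

variable [DecidableEq ι] [Nonempty κ]

/-- Independence of the coordinates of a uniformly distributed function. -/
theorem avg_prod_apply {S : Type*} (s : Finset S) {c : S → ι} (hc : Set.InjOn c s)
    (ψ : S → κ → ℝ) :
    avg (fun u : ι → κ ↦ ∏ k ∈ s, ψ k (u (c k))) = ∏ k ∈ s, avg (ψ k) := by
  have h1 : ∀ i : ι, avg (fun j ↦ ∏ k ∈ s with c k = i, ψ k j) =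
      ∏ k ∈ s with c k = i, avg (ψ k) := by
    intro i
    -- Injectivity of `c` means that each coordinate of `u` occurs in at most one factor, which is
    -- all that independence needs here.
    have hcard : (s.filter fun k ↦ c k = i).card ≤ 1 := by
      rw [Finset.card_le_one]
      intro x hx y hy
      rw [Finset.mem_filter] at hx hy
      exact hc hx.1 hy.1 (hx.2.trans hy.2.symm)
    rcases Nat.le_one_iff_eq_zero_or_eq_one.1 hcard with h | h
    · rw [Finset.card_eq_zero] at h
      simp [h, avg_const]
    · obtain ⟨k, hk⟩ := Finset.card_eq_one.1 h
      simp [hk]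
  rw [← Finset.prod_fiberwise s c]
  have h2 : ∀ u : ι → κ, ∏ k ∈ s, ψ k (u (c k)) = ∏ i, ∏ k ∈ s with c k = i, ψ k (u i) := by
    intro u
    rw [← Finset.prod_fiberwise s c]
    refine Finset.prod_congr rfl fun i _ ↦ Finset.prod_congr rfl fun k hk ↦ ?_
    rw [(Finset.mem_filter.1 hk).2]
  simp_rw [h2, ← h1, avg]
  rw [Finset.prod_mul_distrib, Finset.prod_univ_sum, Fintype.piFinset_univ, Finset.prod_const,
    Fintype.card_fun, Finset.card_univ]
  push_cast
  rw [inv_pow]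

end Average

/-! ### Random intensities with independent cyclic shifts in each cell -/

section Cells

variable (T : ℝ) (N : ℕ)

/-- The time `t` in units of `T / (N+1)²`. -/
noncomputable def scaledTime (t : ℝ) : ℝ := ((N + 1 : ℕ) : ℝ) ^ 2 / T * t

/-- The index of the cell of length `T / (N+1)` that contains `t`. -/
noncomputable def cell (t : ℝ) : Fin (N + 2) := Fin.ofNat (N + 2) (⌊scaledTime T N t⌋₊ / (N + 1))

/-- The index of the subcell of length `T / (N+1)²`, within its cell, that contains `t`. -/
noncomputable def subcell (t : ℝ) : Fin (N + 1) := Fin.ofNat (N + 1) ⌊scaledTime T N t⌋₊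

/-- The level `b t` or `a t` of the random intensity for the shift `j`. -/
noncomputable def levelIntensity (a b w : ℝ → ℝ) (t : ℝ) (j : Fin (N + 1)) : ℝ :=
  if ((j + subcell T N t : Fin (N + 1)) : ℕ) + Int.fract (scaledTime T N t)
    < ((N + 1 : ℕ) : ℝ) * w t then b t else a t

/-- The intensity that takes the value `b` on a (cyclically shifted) fraction `w` of each cell, and
the value `a` on the rest; the shifts of the cells are given by `u`. -/
noncomputable def shiftIntensity (a b w : ℝ → ℝ) (u : Fin (N + 2) → Fin (N + 1)) (t : ℝ) : ℝ :=
  levelIntensity T N a b w t (u (cell T N t))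

variable {T N}

/-- The endpoint `t = T` gets the index `N + 1`; this is why there are `N + 2` indices for `N + 1`
cells, and why the reduction modulo `N + 2` is harmless. -/
theorem cell_val (hT : 0 < T) {t : ℝ} (ht : t ∈ Ioc 0 T) :
    (cell T N t : ℕ) = ⌊((N + 1 : ℕ) : ℝ) / T * t⌋₊ := by
  have e : scaledTime T N t / ((N + 1 : ℕ) : ℝ) = ((N + 1 : ℕ) : ℝ) / T * t := by
    unfold scaledTime
    have : ((N + 1 : ℕ) : ℝ) ≠ 0 := by positivity
    field_simp
  have h : ⌊((N + 1 : ℕ) : ℝ) / T * t⌋₊ < N + 2 := by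
    refine (Nat.floor_lt' (by omega)).2 ?_
    calc ((N + 1 : ℕ) : ℝ) / T * t ≤ ((N + 1 : ℕ) : ℝ) / T * T := by gcongr; exact ht.2
      _ = ((N + 1 : ℕ) : ℝ) := by field_simp
      _ < ((N + 2 : ℕ) : ℝ) := by push_cast; linarith
  rw [cell, Fin.val_ofNat, ← Nat.floor_div_natCast, e, Nat.mod_eq_of_lt h]

/-- Once the cell length `T / (N+1)` is below the distance of the two points, they cannot share a
cell. -/
theorem eventually_cell_ne (hT : 0 < T) {s t : ℝ} (hs : s ∈ Ioc 0 T) (ht : t ∈ Ioc 0 T)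
    (hst : s ≠ t) : ∀ᶠ N : ℕ in atTop, cell T N s ≠ cell T N t := by
  wlog hlt : s < t generalizing s t
  · filter_upwards [this ht hs hst.symm (lt_of_le_of_ne (not_lt.1 hlt) hst.symm)] with N hN
      using hN.symm
  obtain ⟨M, hM⟩ := exists_nat_gt (T / (t - s))
  filter_upwards [eventually_ge_atTop M] with N hN heq
  have h := congrArg (fun c : Fin (N + 2) ↦ (c : ℕ)) heq
  simp only [cell_val hT hs, cell_val hT ht] at h
  have hpos : 0 < t - s := by linarith
  have h1 : 1 ≤ ((N + 1 : ℕ) : ℝ) / T * t - ((N + 1 : ℕ) : ℝ) / T * s := by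
    have : (M : ℝ) ≤ N := by exact_mod_cast hN
    have h2 : T < ((N + 1 : ℕ) : ℝ) * (t - s) := by
      rw [div_lt_iff₀ hpos] at hM
      push_cast
      nlinarith
    rw [← mul_sub, div_mul_eq_mul_div, le_div_iff₀ hT]
    linarith
  have h3 := Nat.lt_floor_add_one (((N + 1 : ℕ) : ℝ) / T * t)
  have h4 := Nat.floor_le (a := ((N + 1 : ℕ) : ℝ) / T * s) (by have := hs.1; positivity)
  rw [← h] at h3
  linarith

theorem measurable_scaledTime : Measurable (scaledTime T N) := by unfold scaledTime; fun_prop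

theorem measurable_cell : Measurable (cell T N) :=
  (measurable_of_countable fun n : ℕ ↦ Fin.ofNat (N + 2) (n / (N + 1))).comp
    (Nat.measurable_floor.comp measurable_scaledTime)

theorem measurable_subcell : Measurable (subcell T N) :=
  (measurable_of_countable fun n : ℕ ↦ Fin.ofNat (N + 1) n).comp
    (Nat.measurable_floor.comp measurable_scaledTime)

variable {a b w : ℝ → ℝ}

theorem measurable_shiftIntensity (ha : Measurable a) (hb : Measurable b) (hw : Measurable w)
    (u : Fin (N + 2) → Fin (N + 1)) : Measurable (shiftIntensity T N a b w u) := by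
  have h0 : Measurable fun p : Fin (N + 2) × Fin (N + 1) ↦
      (((u p.1 + p.2 : Fin (N + 1)) : ℕ) : ℝ) := measurable_of_countable _
  have hc : Measurable fun t ↦ (cell T N t, subcell T N t) :=
    measurable_cell.prodMk measurable_subcell
  have h1 := h0.comp hc
  exact Measurable.ite (measurableSet_lt (h1.add (measurable_scaledTime.fract))
    (hw.const_mul _)) hb ha

theorem levelIntensity_mem (hab : ∀ t, a t ≤ b t) (t : ℝ) (j : Fin (N + 1)) :
    levelIntensity T N a b w t j ∈ Icc (a t) (b t) := by
  unfold levelIntensity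
  split_ifs
  · exact ⟨hab t, le_rfl⟩
  · exact ⟨le_rfl, hab t⟩

theorem shiftIntensity_mem (hab : ∀ t, a t ≤ b t) (u : Fin (N + 2) → Fin (N + 1)) (t : ℝ) :
    shiftIntensity T N a b w u t ∈ Icc (a t) (b t) := levelIntensity_mem hab t _

/-- The fraction of the shifts for which the level at time `t` is `b t`. -/
noncomputable def activeFraction (T : ℝ) (N : ℕ) (w : ℝ → ℝ) (t : ℝ) : ℝ :=
  avg fun j : Fin (N + 1) ↦
    if (j : ℕ) + Int.fract (scaledTime T N t) < ((N + 1 : ℕ) : ℝ) * w t then 1 else 0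

/-- Adding the subcell of `t` is a permutation of the shifts, so it disappears from the average and
only the number of active shifts remains. -/
theorem avg_levelIntensity (g : ℝ → ℝ) (t : ℝ) :
    avg (fun j ↦ g (levelIntensity T N a b w t j)) =
      activeFraction T N w t * g (b t) + (1 - activeFraction T N w t) * g (a t) := by
  have h1 : avg (fun j ↦ g (levelIntensity T N a b w t j)) =
      avg fun j : Fin (N + 1) ↦
        g (if (j : ℕ) + Int.fract (scaledTime T N t) < ((N + 1 : ℕ) : ℝ) * w t
          then b t else a t) :=
    avg_comp_equiv (Equiv.addRight (subcell T N t)) fun j : Fin (N + 1) ↦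
      g (if (j : ℕ) + Int.fract (scaledTime T N t) < ((N + 1 : ℕ) : ℝ) * w t
          then b t else a t)
  have h2 : ∀ j : Fin (N + 1),
      g (if (j : ℕ) + Int.fract (scaledTime T N t) < ((N + 1 : ℕ) : ℝ) * w t
        then b t else a t) = g (a t) + (g (b t) - g (a t)) *
          (if (j : ℕ) + Int.fract (scaledTime T N t) < ((N + 1 : ℕ) : ℝ) * w t then 1 else 0) := by
    intro j
    split_ifs <;> ring
  rw [h1]
  simp_rw [h2]
  rw [avg_add, avg_const, avg_const_mul, activeFraction]
  ring

theorem abs_activeFraction_sub_le {t : ℝ} (h0 : 0 ≤ w t) (h1 : w t ≤ 1) :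
    |activeFraction T N w t - w t| ≤ 1 / ((N + 1 : ℕ) : ℝ) := by
  set ε := Int.fract (scaledTime T N t) with hε
  have hε0 : 0 ≤ ε := Int.fract_nonneg _
  have hε1 : ε < 1 := Int.fract_lt_one _
  set m : ℝ := ((N + 1 : ℕ) : ℝ) with hm
  have hmpos : 0 < m := by positivity
  -- The active shifts are those `j` with `j < m w - ε`; their number is this ceiling, within one of
  -- `m w`.
  set n := ⌈m * w t - ε⌉₊ with hn
  have hnm : n ≤ N + 1 := by
    rw [hn, Nat.ceil_le]
    nlinarith
  have hcount : (∑ j : Fin (N + 1), if ((j : ℕ) : ℝ) + ε < m * w t then (1 : ℝ) else 0) = n := by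
    rw [← Finset.sum_range fun j ↦ if (j : ℝ) + ε < m * w t then (1 : ℝ) else 0, Finset.sum_boole]
    congr 1
    have : (Finset.range (N + 1)).filter (fun j : ℕ ↦ (j : ℝ) + ε < m * w t) = Finset.range n := by
      ext j
      rw [Finset.mem_filter, Finset.mem_range, Finset.mem_range, hn, Nat.lt_ceil, lt_sub_iff_add_lt]
      constructor
      · exact fun h ↦ h.2
      · intro h
        refine ⟨?_, h⟩
        have : j < n := by rw [hn, Nat.lt_ceil, lt_sub_iff_add_lt]; exact h
        omega
    rw [this, Finset.card_range]
  have hval : activeFraction T N w t = n / m := by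
    rw [activeFraction, avg, Fintype.card_fin, hcount, ← hm, inv_mul_eq_div]
  have hlow : m * w t - ε ≤ n := Nat.le_ceil _
  have hup : (n : ℝ) ≤ m * w t + 1 := by
    by_cases hx : 0 ≤ m * w t - ε
    · have := Nat.ceil_lt_add_one hx
      rw [← hn] at this
      linarith
    · have : n = 0 := by rw [hn, Nat.ceil_eq_zero]; linarith
      rw [this]
      push_cast
      positivity
  have e : (n : ℝ) / m - w t = (n - m * w t) / m := by field_simp
  rw [hval, e, abs_div, abs_of_pos hmpos]
  gcongr
  rw [abs_le]
  constructor <;> linarith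

theorem tendsto_activeFraction (T : ℝ) {t : ℝ} (h0 : 0 ≤ w t) (h1 : w t ≤ 1) :
    Tendsto (fun N ↦ activeFraction T N w t) atTop (𝓝 (w t)) := by
  rw [tendsto_iff_norm_sub_tendsto_zero]
  refine squeeze_zero (fun _ ↦ norm_nonneg _) (fun N ↦ abs_activeFraction_sub_le h0 h1) ?_
  have := tendsto_one_div_add_atTop_nhds_zero_nat (𝕜 := ℝ)
  simpa using this

theorem tendsto_avg_levelIntensity (T : ℝ) {t : ℝ} (h0 : 0 ≤ w t) (h1 : w t ≤ 1) (g : ℝ → ℝ) :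
    Tendsto (fun N ↦ avg fun j ↦ g (levelIntensity T N a b w t j)) atTop
      (𝓝 (w t * g (b t) + (1 - w t) * g (a t))) := by
  simp_rw [avg_levelIntensity]
  have h := tendsto_activeFraction T h0 h1
  exact (h.mul_const _).add ((h.const_sub 1).mul_const _)

end Cells
end RenyiPoisson

namespace RenyiPoisson

open Filter Topology

/-! ### The shift intensities have exactly the prescribed mean -/

section ExactMean

theorem intervalIntegrable_of_bounded {g : ℝ → ℝ} (hg : Measurable g) {C : ℝ}
    (hC : ∀ s, |g s| ≤ C) (x y : ℝ) : IntervalIntegrable g volume x y := by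
  refine (intervalIntegrable_const (c := C)).mono_fun hg.aestronglyMeasurable
    (Eventually.of_forall fun s ↦ ?_)
  change |g s| ≤ |C|
  exact (hC s).trans (le_abs_self C)

theorem abs_ite_le (p : Prop) [Decidable p] (A B : ℝ) : |if p then B else A| ≤ |A| + |B| := by
  split_ifs
  · linarith [abs_nonneg A]
  · linarith [abs_nonneg B]

/-- Write an index as `m` times a cell plus a subcell. Within each cell the shift `v` only permutes
the subcells cyclically, so every cell contributes the same sum. -/
theorem sum_range_sq_cyclic (m : ℕ) [NeZero m] (J : ℕ → ℝ) (v : ℕ → Fin m) :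
    ∑ l ∈ Finset.range (m * m), J ((v (l / m) + Fin.ofNat m l : Fin m) : ℕ) =
      m * ∑ r ∈ Finset.range m, J r := by
  rw [Finset.sum_range, ← Equiv.sum_comp finProdFinEquiv, Fintype.sum_prod_type]
  have hm : 0 < m := Nat.pos_of_neZero m
  have h : ∀ i : Fin m, ∑ r : Fin m, J ((v ((finProdFinEquiv (i, r) : ℕ) / m) +
      Fin.ofNat m (finProdFinEquiv (i, r) : ℕ) : Fin m) : ℕ) = ∑ r ∈ Finset.range m, J r := by
    intro i
    rw [Finset.sum_range, ← Equiv.sum_comp (Equiv.addLeft (v (i : ℕ))) fun r : Fin m ↦ J r]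
    refine Finset.sum_congr rfl fun r _ ↦ ?_
    have h1 : (finProdFinEquiv (i, r) : ℕ) / m = i := by
      rw [finProdFinEquiv_apply_val, Nat.add_mul_div_left _ _ hm, Nat.div_eq_of_lt r.2, zero_add]
    have h2 : Fin.ofNat m (finProdFinEquiv (i, r) : ℕ) = r := by
      ext
      rw [Fin.val_ofNat, finProdFinEquiv_apply_val, Nat.add_mul_mod_self_left,
        Nat.mod_eq_of_lt r.2]
    rw [h1, h2, Equiv.coe_addLeft]
  rw [Finset.sum_congr rfl fun i _ ↦ h i, Finset.sum_const, Finset.card_univ, Fintype.card_fin,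
    nsmul_eq_mul]

theorem integral_step {A B x m : ℝ} (hx : 0 ≤ x) (hxm : x ≤ m) :
    ∫ s in (0 : ℝ)..m, (if s < x then B else A) = x * B + (m - x) * A := by
  have hm : Measurable fun s : ℝ ↦ if s < x then B else A :=
    Measurable.ite measurableSet_Iio measurable_const measurable_const
  have hi := intervalIntegrable_of_bounded hm (C := |A| + |B|) fun s ↦ abs_ite_le _ _ _
  rw [← intervalIntegral.integral_add_adjacent_intervals (hi 0 x) (hi x m)]
  have h1 : ∫ s in (0 : ℝ)..x, (if s < x then B else A) = ∫ s in (0 : ℝ)..x, B := by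
    refine intervalIntegral.integral_congr_ae ?_
    filter_upwards [compl_mem_ae_iff.2 (measure_singleton x)] with s hs hs'
    rw [uIoc_of_le hx] at hs'
    exact if_pos (lt_of_le_of_ne hs'.2 hs)
  have h2 : ∫ s in x..m, (if s < x then B else A) = ∫ s in x..m, A := by
    refine intervalIntegral.integral_congr_ae (Eventually.of_forall fun s hs' ↦ ?_)
    rw [uIoc_of_le hxm] at hs'
    exact if_neg (not_lt.2 hs'.1.le)
  rw [h1, h2, intervalIntegral.integral_const, intervalIntegral.integral_const, smul_eq_mul,
    smul_eq_mul, sub_zero]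

/-- For constant levels and weights, each shift intensity has exactly the prescribed mean. -/
theorem integral_shiftIntensity_const {T : ℝ} (hT : 0 < T) (N : ℕ) {A B w : ℝ} (h0 : 0 ≤ w)
    (h1 : w ≤ 1) (u : Fin (N + 2) → Fin (N + 1)) :
    ∫ t in Ioc 0 T, shiftIntensity T N (fun _ ↦ A) (fun _ ↦ B) (fun _ ↦ w) u t =
      T * (w * B + (1 - w) * A) := by
  have hmpos : (0 : ℝ) < ((N + 1 : ℕ) : ℝ) := by positivity
  -- In units where subcells have length one, the intensity on subcell `l` is a copy of the unit
  -- piece number `k l` of the step function `g` below.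
  set k : ℕ → Fin (N + 1) := fun l ↦ u (Fin.ofNat (N + 2) (l / (N + 1))) + Fin.ofNat (N + 1) l with hk
  let G : ℝ → ℝ := fun s ↦ if ((k ⌊s⌋₊ : Fin (N + 1)) : ℕ) + Int.fract s < ((N + 1 : ℕ) : ℝ) * w then B else A
  let g : ℝ → ℝ := fun s ↦ if s < ((N + 1 : ℕ) : ℝ) * w then B else A
  have hGm : Measurable G := by
    have hk1 : Measurable fun n : ℕ ↦ (((k n : Fin (N + 1)) : ℕ) : ℝ) := measurable_of_countable _
    have hk2 := hk1.comp (Nat.measurable_floor (R := ℝ))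
    exact Measurable.ite (measurableSet_lt (hk2.add measurable_fract) measurable_const)
      measurable_const measurable_const
  have hgm : Measurable g :=
    Measurable.ite (measurableSet_lt measurable_id measurable_const) measurable_const
      measurable_const
  have hGi := intervalIntegrable_of_bounded hGm (C := |A| + |B|) fun s ↦ abs_ite_le _ _ _
  have hgi := intervalIntegrable_of_bounded hgm (C := |A| + |B|) fun s ↦ abs_ite_le _ _ _
  have e1 : ∫ t in Ioc 0 T, shiftIntensity T N (fun _ ↦ A) (fun _ ↦ B) (fun _ ↦ w) u t =
      ∫ t in (0 : ℝ)..T, G (((N + 1 : ℕ) : ℝ) ^ 2 / T * t) := by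
    rw [intervalIntegral.integral_of_le hT.le]
    rfl
  have hc : ((N + 1 : ℕ) : ℝ) ^ 2 / T ≠ 0 := by positivity
  have e2 : ((N + 1 : ℕ) : ℝ) ^ 2 / T * T = (((N + 1) * (N + 1) : ℕ) : ℝ) := by push_cast; field_simp
  rw [e1, intervalIntegral.integral_comp_mul_left _ hc, mul_zero, e2]
  have e3 : ∀ l : ℕ, ∫ s in (l : ℝ)..((l + 1 : ℕ) : ℝ), G s =
      ∫ s in (((k l : Fin (N + 1)) : ℕ) : ℝ)..((((k l : Fin (N + 1)) : ℕ) + 1 : ℕ) : ℝ), g s := by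
    intro l
    have s1 := intervalIntegral.integral_comp_add_left (a := 0) (b := 1) G (l : ℝ)
    have s2 := intervalIntegral.integral_comp_add_left (a := 0) (b := 1) g
      (((k l : Fin (N + 1)) : ℕ) : ℝ)
    push_cast
    rw [add_zero] at s1 s2
    rw [← s1, ← s2]
    refine intervalIntegral.integral_congr_ae ?_
    filter_upwards [compl_mem_ae_iff.2 (measure_singleton (1 : ℝ))] with s hs hs'
    rw [uIoc_of_le zero_le_one] at hs'
    have hlt : s < 1 := lt_of_le_of_ne hs'.2 hs
    have hf : ⌊(l : ℝ) + s⌋₊ = l := by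
      rw [Nat.floor_eq_iff (by have := hs'.1; positivity)]
      constructor <;> linarith [hs'.1]
    have hfr : Int.fract ((l : ℝ) + s) = s := by
      rw [Int.fract_natCast_add, Int.fract_eq_self.2 ⟨hs'.1.le, hlt⟩]
    simp only [G, g, hf, hfr]
  have e4 : ∫ s in (0 : ℝ)..(((N + 1) * (N + 1) : ℕ) : ℝ), G s =
      ∑ l ∈ Finset.range ((N + 1) * (N + 1)), ∫ s in (l : ℝ)..((l + 1 : ℕ) : ℝ), G s := by
    rw [intervalIntegral.sum_integral_adjacent_intervals (a := fun l : ℕ ↦ (l : ℝ))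
      fun l _ ↦ hGi _ _]
    simp
  have e5 : ∑ r ∈ Finset.range (N + 1), (∫ s in (r : ℝ)..((r + 1 : ℕ) : ℝ), g s) =
      ∫ s in (0 : ℝ)..((N + 1 : ℕ) : ℝ), g s := by
    rw [intervalIntegral.sum_integral_adjacent_intervals (a := fun l : ℕ ↦ (l : ℝ))
      fun l _ ↦ hgi _ _]
    simp
  rw [e4, Finset.sum_congr rfl fun l _ ↦ e3 l, sum_range_sq_cyclic (N + 1)
    (fun r ↦ ∫ s in (r : ℝ)..((r + 1 : ℕ) : ℝ), g s) (fun i ↦ u (Fin.ofNat (N + 2) i)), e5,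
    integral_step (by positivity) (by nlinarith), smul_eq_mul]
  field_simp

end ExactMean

/-! ### Independence at distinct times and concentration of the integral -/

section Concentration

variable {T : ℝ} {a b w : ℝ → ℝ}

theorem shiftIntensity_integrableOn (ha : Measurable a) (hb : Measurable b) (hw : Measurable w)
    (h0 : ∀ t, 0 ≤ a t) (hab : ∀ t, a t ≤ b t) (hi : IntegrableOn b (Ioc 0 T)) {N : ℕ}
    (u : Fin (N + 2) → Fin (N + 1)) : IntegrableOn (shiftIntensity T N a b w u) (Ioc 0 T) := by
  refine Integrable.mono' hi (measurable_shiftIntensity ha hb hw u).aestronglyMeasurable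
    (Eventually.of_forall fun t ↦ ?_)
  have h := shiftIntensity_mem (T := T) (N := N) (w := w) hab u t
  rw [Real.norm_eq_abs, abs_of_nonneg ((h0 t).trans h.1)]
  exact h.2

/-- The average of products of functions of the shift intensity at times in distinct cells. -/
theorem tendsto_avg_prod_shiftIntensity {S : Type*} (s : Finset S) {x : S → ℝ}
    (hx : ∀ k ∈ s, x k ∈ Ioc 0 T) (hinj : Set.InjOn x s) (hT : 0 < T) (hw0 : ∀ t, 0 ≤ w t)
    (hw1 : ∀ t, w t ≤ 1) (g : ℝ → ℝ) :
    Tendsto (fun N ↦ avg fun u : Fin (N + 2) → Fin (N + 1) ↦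
      ∏ k ∈ s, g (shiftIntensity T N a b w u (x k))) atTop
      (𝓝 (∏ k ∈ s, (w (x k) * g (b (x k)) + (1 - w (x k)) * g (a (x k))))) := by
  have hev : ∀ᶠ N : ℕ in atTop, Set.InjOn (fun k ↦ cell T N (x k)) s := by
    have : ∀ᶠ N : ℕ in atTop, ∀ j ∈ s, ∀ k ∈ s, x j ≠ x k →
        cell T N (x j) ≠ cell T N (x k) := by
      rw [eventually_all_finset]; intro j hj
      rw [eventually_all_finset]; intro k hk
      by_cases hjk : x j = x k
      · exact Eventually.of_forall fun N h ↦ absurd hjk h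
      · exact (eventually_cell_ne hT (hx j hj) (hx k hk) hjk).mono fun N h _ ↦ h
    filter_upwards [this] with N hN j hj k hk hjk
    by_contra hne
    exact hN j hj k hk (fun h ↦ hne (hinj hj hk h)) hjk
  have hlim : Tendsto (fun N ↦ ∏ k ∈ s, avg fun j ↦ g (levelIntensity T N a b w (x k) j)) atTop
      (𝓝 (∏ k ∈ s, (w (x k) * g (b (x k)) + (1 - w (x k)) * g (a (x k))))) :=
    tendsto_finsetProd _ fun k _ ↦ tendsto_avg_levelIntensity T (hw0 _) (hw1 _) g
  refine hlim.congr' ?_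
  filter_upwards [hev] with N hN
  exact (avg_prod_apply s hN fun k j ↦ g (levelIntensity T N a b w (x k) j)).symm

theorem avg_mem_of_mem {ι : Type*} [Fintype ι] [Nonempty ι] {f : ι → ℝ} {c : ℝ}
    (h : ∀ i, f i ∈ Icc 0 c) : ‖avg f‖ ≤ c := by
  rw [Real.norm_eq_abs, abs_of_nonneg (avg_nonneg fun i ↦ (h i).1)]
  exact avg_le fun i ↦ (h i).2

/-- The mean of the random intensity. -/
def meanLevel (a b w : ℝ → ℝ) (t : ℝ) : ℝ := w t * b t + (1 - w t) * a t

theorem meanLevel_mem (hab : ∀ t, a t ≤ b t) (hw0 : ∀ t, 0 ≤ w t)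
    (hw1 : ∀ t, w t ≤ 1) (t : ℝ) : meanLevel a b w t ∈ Icc (a t) (b t) := by
  unfold meanLevel
  constructor <;> nlinarith [hab t, hw0 t, hw1 t]

theorem ae_prod_ne {μ : Measure ℝ} [SFinite μ] [NullSingletonClass μ] :
    ∀ᵐ z ∂(μ.prod μ), z.1 ≠ z.2 := by
  have hs : MeasurableSet {z : ℝ × ℝ | z.1 = z.2} :=
    measurableSet_eq_fun measurable_fst measurable_snd
  have h0 : (μ.prod μ) {z : ℝ × ℝ | z.1 = z.2} = 0 := by
    rw [Measure.measure_prod_null hs]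
    refine Eventually.of_forall fun x ↦ ?_
    have : Prod.mk x ⁻¹' {z : ℝ × ℝ | z.1 = z.2} = {x} := by ext y; simp [eq_comm]
    change μ (Prod.mk x ⁻¹' {z : ℝ × ℝ | z.1 = z.2}) = 0
    rw [this]
    exact measure_singleton x
  rw [ae_iff]
  simpa using h0

/-- The integral of the random intensity concentrates at its mean. -/
theorem tendsto_avg_sq_integral (hT : 0 < T) (ha : Measurable a) (hb : Measurable b)
    (hw : Measurable w) (h0 : ∀ t, 0 ≤ a t) (hab : ∀ t, a t ≤ b t) (hw0 : ∀ t, 0 ≤ w t)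
    (hw1 : ∀ t, w t ≤ 1) (hi : IntegrableOn b (Ioc 0 T)) :
    Tendsto (fun N ↦ avg fun u : Fin (N + 2) → Fin (N + 1) ↦
      ((∫ t in Ioc 0 T, shiftIntensity T N a b w u t) -
        ∫ t in Ioc 0 T, meanLevel a b w t) ^ 2) atTop (𝓝 0) := by
  set μ := (volume : Measure ℝ).restrict (Ioc 0 T) with hμ
  set c := ∫ t, meanLevel a b w t ∂μ with hc
  have hmem : ∀ {N : ℕ} (u : Fin (N + 2) → Fin (N + 1)) (t : ℝ),
      shiftIntensity T N a b w u t ∈ Icc 0 (b t) := fun u t ↦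
    ⟨(h0 t).trans (shiftIntensity_mem hab u t).1, (shiftIntensity_mem hab u t).2⟩
  have hint : ∀ {N : ℕ} (u : Fin (N + 2) → Fin (N + 1)),
      Integrable (shiftIntensity T N a b w u) μ :=
    fun u ↦ shiftIntensity_integrableOn ha hb hw h0 hab hi u
  have hms : ∀ {N : ℕ} (u : Fin (N + 2) → Fin (N + 1)),
      Measurable (shiftIntensity T N a b w u) := fun u ↦ measurable_shiftIntensity ha hb hw u
  have haemem : ∀ᵐ t ∂μ, t ∈ Ioc 0 T := ae_restrict_mem measurableSet_Ioc
  have first : Tendsto (fun N ↦ avg fun u : Fin (N + 2) → Fin (N + 1) ↦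
      ∫ t, shiftIntensity T N a b w u t ∂μ) atTop (𝓝 c) := by
    simp_rw [← integral_avg fun u ↦ hint u]
    refine tendsto_integral_of_dominated_convergence b (fun N ↦ ?_) hi (fun N ↦ ?_) ?_
    · have h := fun u : Fin (N + 2) → Fin (N + 1) ↦ hms u
      unfold avg
      fun_prop
    · exact Eventually.of_forall fun t ↦ avg_mem_of_mem fun u ↦ hmem u t
    · filter_upwards [haemem] with t ht
      have := tendsto_avg_prod_shiftIntensity (T := T) (a := a) (b := b) (w := w) {()}
        (x := fun _ ↦ t) (fun _ _ ↦ ht) (by simp) hT hw0 hw1 id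
      simpa [meanLevel] using this
  -- The square of the integral is a double integral. Off the null diagonal the two times eventually
  -- lie in different cells, so the average of the product tends to the product of the means.
  have second : Tendsto (fun N ↦ avg fun u : Fin (N + 2) → Fin (N + 1) ↦
      (∫ t, shiftIntensity T N a b w u t ∂μ) ^ 2) atTop (𝓝 (c ^ 2)) := by
    have e : ∀ f : ℝ → ℝ, (∫ t, f t ∂μ) ^ 2 = ∫ z, f z.1 * f z.2 ∂(μ.prod μ) := fun f ↦ by
      rw [integral_prod_mul, sq]
    simp_rw [hc, e]
    simp_rw [← integral_avg fun u ↦ (hint u).mul_prod (hint u)]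
    refine tendsto_integral_of_dominated_convergence (fun z ↦ b z.1 * b z.2) (fun N ↦ ?_)
      (hi.mul_prod hi) (fun N ↦ ?_) ?_
    · have h := fun u : Fin (N + 2) → Fin (N + 1) ↦ hms u
      unfold avg
      fun_prop
    · refine Eventually.of_forall fun z ↦ avg_mem_of_mem fun u ↦ ?_
      exact ⟨mul_nonneg (hmem u _).1 (hmem u _).1, mul_le_mul (hmem u _).2 (hmem u _).2
        (hmem u _).1 ((hmem u z.1).1.trans (hmem u z.1).2)⟩
    · filter_upwards [ae_prod_ne (μ := μ), Measure.quasiMeasurePreserving_fst.ae haemem,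
        Measure.quasiMeasurePreserving_snd.ae haemem] with z hz h1 h2
      have := tendsto_avg_prod_shiftIntensity (T := T) (a := a) (b := b) (w := w)
        (Finset.univ : Finset (Fin 2)) (x := ![z.1, z.2])
        (fun k _ ↦ by fin_cases k <;> simpa) (by
          intro j _ k _ hjk
          fin_cases j <;> fin_cases k <;> simp_all) hT hw0 hw1 id
      simpa [Fin.prod_univ_two, meanLevel] using this
  have hlim := (second.sub (first.const_mul (2 * c))).add_const (c ^ 2)
  have hz : c ^ 2 - 2 * c * c + c ^ 2 = 0 := by ring
  rw [hz] at hlim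
  refine hlim.congr fun N ↦ ?_
  rw [← avg_const_mul, ← avg_sub, ← avg_const (ι := Fin (N + 2) → Fin (N + 1)) (c ^ 2), ← avg_add]
  congr 1
  ext u
  ring

theorem tendsto_avg_abs_of_sq {ι : ℕ → Type*} [∀ N, Fintype (ι N)] [∀ N, Nonempty (ι N)]
    {X : ∀ N, ι N → ℝ} (h : Tendsto (fun N ↦ avg fun i ↦ X N i ^ 2) atTop (𝓝 0)) :
    Tendsto (fun N ↦ avg fun i ↦ |X N i|) atTop (𝓝 0) := by
  have hs := (Real.continuous_sqrt.tendsto 0).comp h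
  rw [Real.sqrt_zero] at hs
  refine squeeze_zero (fun N ↦ avg_nonneg fun i ↦ abs_nonneg _) (fun N ↦ ?_) hs
  refine Real.le_sqrt_of_sq_le ((sq_avg_le _).trans_eq ?_)
  simp_rw [sq_abs]

theorem abs_exp_neg_sub_le {x y : ℝ} (hx : 0 ≤ x) (hy : 0 ≤ y) :
    |Real.exp (-x) - Real.exp (-y)| ≤ |x - y| := by
  wlog hxy : x ≤ y generalizing x y
  · rw [abs_sub_comm, abs_sub_comm x]; exact this hy hx (le_of_not_ge hxy)
  have h1 : Real.exp (-y) ≤ Real.exp (-x) := Real.exp_le_exp.2 (by linarith)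
  rw [abs_of_nonneg (by linarith), abs_sub_comm, abs_of_nonneg (by linarith)]
  have h2 : Real.exp (-y) = Real.exp (-x) * Real.exp (x - y) := by rw [← Real.exp_add]; ring_nf
  have h3 := Real.add_one_le_exp (x - y)
  have h4 : Real.exp (-x) ≤ 1 := Real.exp_le_one_iff.2 (by linarith)
  rw [h2]
  nlinarith [Real.exp_pos (-x)]

end Concentration

/-! ### Limits of the mean densities along the shift intensities -/

section DensityLimit

variable {T : ℝ} [hT : Fact (0 < T)] {a b w : ℝ → ℝ}

/-- The mean of order `α` of the levels. -/
noncomputable def powMean (α : ℝ) (a b w : ℝ → ℝ) (t : ℝ) : ℝ :=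
  (w t * b t ^ α + (1 - w t) * a t ^ α) ^ (1 / α)

/-- The limit of the densities of the mean measures of the uniform priors on the shift
intensities. -/
noncomputable def limitDensity (α : ℝ) (a b w : ℝ → ℝ) (ω : SamplePath T) : ℝ :=
  Real.exp (-∫ t in Ioc 0 T, meanLevel a b w t) * pathProd (powMean α a b w) ω

/-- The density is an exponential of the integral times a product over arrivals. Concentration
replaces the exponential by its deterministic limit, with an error controlled by the first absolute
moment since `exp (-·)` is 1-Lipschitz on the half-line and the product is bounded by that of `b`.
Independence at the distinct arrival times then evaluates the average of the products. -/
theorem tendsto_avg_pathDensity {α : ℝ} (hα : 0 < α) (ha : Measurable a) (hb : Measurable b)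
    (hw : Measurable w) (h0 : ∀ t, 0 ≤ a t) (hab : ∀ t, a t ≤ b t) (hw0 : ∀ t, 0 ≤ w t)
    (hw1 : ∀ t, w t ≤ 1) (hi : IntegrableOn b (Ioc 0 T)) {ω : SamplePath T}
    (hω1 : ∀ k < arrivalCount ω, arrival k ω ∈ Ioc 0 T)
    (hω2 : ∀ j < arrivalCount ω, ∀ k < arrivalCount ω, arrival j ω = arrival k ω → j = k) :
    Tendsto (fun N ↦ (avg fun u : Fin (N + 2) → Fin (N + 1) ↦
      pathDensity (shiftIntensity T N a b w u) ω ^ α) ^ (1 / α)) atTop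
      (𝓝 (limitDensity α a b w ω)) := by
  set c := ∫ t in Ioc 0 T, meanLevel a b w t with hc
  have hc0 : 0 ≤ c := integral_nonneg fun t ↦ (h0 t).trans (meanLevel_mem hab hw0 hw1 t).1
  have hb0 : ∀ t, 0 ≤ b t := fun t ↦ (h0 t).trans (hab t)
  have hf0 : ∀ {N : ℕ} (u : Fin (N + 2) → Fin (N + 1)) (t : ℝ), 0 ≤ shiftIntensity T N a b w u t :=
    fun u t ↦ (h0 t).trans (shiftIntensity_mem hab u t).1
  set L := ∏ k ∈ Finset.range (arrivalCount ω),
    (w (arrival k ω) * b (arrival k ω) ^ α + (1 - w (arrival k ω)) * a (arrival k ω) ^ α) with hL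
  have hprod : Tendsto (fun N ↦ avg fun u : Fin (N + 2) → Fin (N + 1) ↦
      pathProd (shiftIntensity T N a b w u) ω ^ α) atTop (𝓝 L) := by
    have := tendsto_avg_prod_shiftIntensity (a := a) (b := b) (w := w)
      (Finset.range (arrivalCount ω)) (x := fun k ↦ arrival k ω)
      (fun k hk ↦ hω1 k (Finset.mem_range.1 hk))
      (fun j hj k hk h ↦ hω2 j (by simpa using hj) k (by simpa using hk) h) hT.out hw0 hw1
      (fun y ↦ y ^ α)
    refine this.congr fun N ↦ ?_
    congr 1
    ext u
    rw [pathProd, Real.finsetProd_rpow _ _ fun k _ ↦ hf0 u _]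
  have habs : Tendsto (fun N ↦ avg fun u : Fin (N + 2) → Fin (N + 1) ↦
      |(∫ t in Ioc 0 T, shiftIntensity T N a b w u t) - c|) atTop (𝓝 0) :=
    tendsto_avg_abs_of_sq (tendsto_avg_sq_integral hT.out ha hb hw h0 hab hw0 hw1 hi)
  set P := pathProd b ω ^ α with hP
  have hP0 : 0 ≤ P := Real.rpow_nonneg (pathProd_nonneg hb0 ω) _
  have hdiff : Tendsto (fun N ↦ (avg fun u : Fin (N + 2) → Fin (N + 1) ↦
      pathDensity (shiftIntensity T N a b w u) ω ^ α) - Real.exp (-(α * c)) *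
      avg fun u : Fin (N + 2) → Fin (N + 1) ↦ pathProd (shiftIntensity T N a b w u) ω ^ α)
      atTop (𝓝 0) := by
    have hbound := habs.const_mul (P * α)
    rw [mul_zero] at hbound
    refine squeeze_zero_norm (fun N ↦ ?_) hbound
    rw [← avg_const_mul, ← avg_sub, ← avg_const_mul, Real.norm_eq_abs]
    refine (abs_avg_le _).trans (avg_mono fun u ↦ ?_)
    set I := ∫ t in Ioc 0 T, shiftIntensity T N a b w u t with hI
    have hI0 : 0 ≤ I := integral_nonneg (hf0 u)
    have hpp := pathProd_nonneg (hf0 u) ω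
    have e1 : pathDensity (shiftIntensity T N a b w u) ω ^ α =
        Real.exp (-(α * I)) * pathProd (shiftIntensity T N a b w u) ω ^ α := by
      rw [pathDensity, Real.mul_rpow (Real.exp_pos _).le hpp, ← Real.exp_mul, ← hI]
      ring_nf
    have hle : pathProd (shiftIntensity T N a b w u) ω ^ α ≤ P :=
      Real.rpow_le_rpow hpp (pathProd_mono (hf0 u) (fun t ↦ (shiftIntensity_mem hab u t).2) ω) hα.le
    rw [e1, ← sub_mul, abs_mul, abs_of_nonneg (Real.rpow_nonneg hpp α)]
    have h2 := abs_exp_neg_sub_le (x := α * I) (y := α * c) (by positivity) (by positivity)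
    rw [← mul_sub, abs_mul, abs_of_pos hα] at h2
    calc _ ≤ (α * |I - c|) * P := by gcongr
      _ = _ := by ring
  have hsum := hdiff.add (hprod.const_mul (Real.exp (-(α * c))))
  simp only [sub_add_cancel, zero_add] at hsum
  have hfin := hsum.rpow_const (p := 1 / α) (Or.inr (by positivity))
  have hval : (Real.exp (-(α * c)) * L) ^ (1 / α) = limitDensity α a b w ω := by
    have hq : ∀ t, 0 ≤ w t * b t ^ α + (1 - w t) * a t ^ α := fun t ↦
      add_nonneg (mul_nonneg (hw0 t) (Real.rpow_nonneg (hb0 t) _))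
        (mul_nonneg (by linarith [hw1 t]) (Real.rpow_nonneg (h0 t) _))
    rw [Real.mul_rpow (Real.exp_pos _).le (Finset.prod_nonneg fun k _ ↦ hq _), ← Real.exp_mul,
      ← Real.finsetProd_rpow _ _ fun k _ ↦ hq _, limitDensity, pathProd, ← hc]
    congr 2
    field_simp
  rwa [hval] at hfin

end DensityLimit
end RenyiPoisson

namespace RenyiPoisson

open Filter Topology

/-! ### Uniform priors on indexed families -/

section UniformPrior

variable {Ω : Type*} [MeasurableSpace Ω] {F : Set (Measure Ω)} {ι : Type*} [Fintype ι] [Nonempty ι]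

open Classical in
/-- The prior that is the law of `W i` for a uniformly distributed index `i`. -/
noncomputable def uniformPrior (W : ι → Measure Ω) (hW : ∀ i, W i ∈ F) : Prior F where
  -- Different indices may give the same measure; summing point masses adds their weights.
  mass := ∑ i, Finsupp.single (W i) (Fintype.card ι : ℝ≥0)⁻¹
  support_subset := by
    intro V hV
    by_contra hVF
    rw [SetLike.mem_coe, Finsupp.mem_support_iff, Finsupp.finsetSum_apply] at hV
    refine hV (Finset.sum_eq_zero fun i _ ↦ ?_)
    rw [Finsupp.single_apply, if_neg]
    rintro rfl
    exact hVF (hW i)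
  sum_eq_one := by
    change (∑ i, Finsupp.single (W i) (Fintype.card ι : ℝ≥0)⁻¹).sum (fun _ m ↦ m) = 1
    rw [← Finsupp.sum_finsetSum_index (fun _ ↦ rfl) (fun _ _ _ ↦ rfl)]
    simp

theorem uniformPrior_sum (W : ι → Measure Ω) (hW : ∀ i, W i ∈ F) (Φ : Measure Ω → ℝ≥0∞) :
    ∑ V ∈ (uniformPrior W hW).mass.support, ((uniformPrior W hW).mass V : ℝ≥0∞) * Φ V =
      ∑ i, ENNReal.ofReal (Fintype.card ι : ℝ)⁻¹ * Φ (W i) := by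
  classical
  change (∑ i, Finsupp.single (W i) (Fintype.card ι : ℝ≥0)⁻¹).sum
    (fun V m ↦ (m : ℝ≥0∞) * Φ V) = _
  rw [← Finsupp.sum_finsetSum_index (fun _ ↦ by simp) (fun _ _ _ ↦ by push_cast; ring)]
  refine Finset.sum_congr rfl fun i _ ↦ ?_
  rw [Finsupp.sum_single_index (by simp)]
  congr 1
  rw [ENNReal.ofReal]
  congr 1
  ext
  simp

theorem uniformPrior_meanDensity {ν : Measure Ω} (W : ι → Measure Ω) (hW : ∀ i, W i ∈ F)
    {D : ι → Ω → ℝ} (hD : ∀ i y, 0 ≤ D i y)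
    (h : ∀ i, (W i).rnDeriv ν =ᵐ[ν] fun y ↦ ENNReal.ofReal (D i y)) {α : ℝ} (hα : 0 < α) :
    ∀ᵐ y ∂ν, (uniformPrior W hW).meanDensity α ν y =
      ENNReal.ofReal ((avg fun i ↦ D i y ^ α) ^ (1 / α)) := by
  filter_upwards [ae_all_iff.2 h] with y hy
  rw [Prior.meanDensity, uniformPrior_sum W hW fun V ↦ (V.rnDeriv ν y) ^ α,
    ← ENNReal.ofReal_rpow_of_nonneg (avg_nonneg fun i ↦ Real.rpow_nonneg (hD i y) α)
      (by positivity), avg, Finset.mul_sum, ENNReal.ofReal_sum_of_nonneg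
      fun i _ ↦ mul_nonneg (by positivity) (Real.rpow_nonneg (hD i y) α)]
  congr 1
  refine Finset.sum_congr rfl fun i _ ↦ ?_
  rw [hy i, ENNReal.ofReal_mul (by positivity), ENNReal.ofReal_rpow_of_nonneg (hD i y) hα.le]

end UniformPrior

/-- Measurable levels `0 ≤ a ≤ b` with `b` integrable on `(0,T]`, and weights `w` in `[0,1]`. -/
structure AdmissibleLevels (T : ℝ) (a b w : ℝ → ℝ) : Prop where
  measurable_a : Measurable a
  measurable_b : Measurable b
  measurable_w : Measurable w
  nonneg : ∀ t, 0 ≤ a t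
  le : ∀ t, a t ≤ b t
  w_nonneg : ∀ t, 0 ≤ w t
  w_le_one : ∀ t, w t ≤ 1
  integrableOn : IntegrableOn b (Ioc 0 T)

/-! ### Power means of the levels and the information rate -/

section PowerMean

variable {T : ℝ} {a b w : ℝ → ℝ} {α : ℝ}

theorem AdmissibleLevels.b_nonneg (h : AdmissibleLevels T a b w) (t : ℝ) : 0 ≤ b t :=
  (h.nonneg t).trans (h.le t)

theorem AdmissibleLevels.base_nonneg (h : AdmissibleLevels T a b w) (α t : ℝ) :
    0 ≤ w t * b t ^ α + (1 - w t) * a t ^ α :=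
  add_nonneg (mul_nonneg (h.w_nonneg t) (Real.rpow_nonneg (h.b_nonneg t) _))
    (mul_nonneg (by linarith [h.w_le_one t]) (Real.rpow_nonneg (h.nonneg t) _))

theorem measurable_powMean (h : AdmissibleLevels T a b w) : Measurable (powMean α a b w) := by
  have h1 := h.measurable_a
  have h2 := h.measurable_b
  have h3 := h.measurable_w
  unfold powMean
  fun_prop

theorem powMean_mem (h : AdmissibleLevels T a b w) (hα : 0 < α) (t : ℝ) :
    powMean α a b w t ∈ Icc (a t) (b t) := by
  have hp : a t ^ α ≤ b t ^ α := Real.rpow_le_rpow (h.nonneg t) (h.le t) hα.le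
  have e : ∀ x : ℝ, 0 ≤ x → (x ^ α) ^ (1 / α) = x := fun x hx ↦ by
    rw [← Real.rpow_mul hx, mul_one_div_cancel hα.ne', Real.rpow_one]
  have h0 := h.w_nonneg t
  have h1 := h.w_le_one t
  constructor
  · rw [← e (a t) (h.nonneg t)]
    refine Real.rpow_le_rpow (Real.rpow_nonneg (h.nonneg t) _) ?_ (by positivity)
    nlinarith
  · rw [← e (b t) (h.b_nonneg t)]
    refine Real.rpow_le_rpow (h.base_nonneg α t) ?_ (by positivity)
    nlinarith

theorem powMean_nonneg (h : AdmissibleLevels T a b w) (hα : 0 < α) (t : ℝ) :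
    0 ≤ powMean α a b w t := (h.nonneg t).trans (powMean_mem h hα t).1

theorem integrableOn_of_mem {f : ℝ → ℝ} (h : AdmissibleLevels T a b w) (hf : Measurable f)
    (hm : ∀ t, f t ∈ Icc (a t) (b t)) : IntegrableOn f (Ioc 0 T) := by
  refine Integrable.mono' h.integrableOn hf.aestronglyMeasurable (Eventually.of_forall fun t ↦ ?_)
  rw [Real.norm_eq_abs, abs_of_nonneg ((h.nonneg t).trans (hm t).1)]
  exact (hm t).2

theorem powMean_integrableOn (h : AdmissibleLevels T a b w) (hα : 0 < α) :
    IntegrableOn (powMean α a b w) (Ioc 0 T) :=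
  integrableOn_of_mem h (measurable_powMean h) (powMean_mem h hα)

theorem measurable_meanLevel (h : AdmissibleLevels T a b w) : Measurable (meanLevel a b w) := by
  have h1 := h.measurable_a
  have h2 := h.measurable_b
  have h3 := h.measurable_w
  unfold meanLevel
  fun_prop

theorem meanLevel_integrableOn (h : AdmissibleLevels T a b w) :
    IntegrableOn (meanLevel a b w) (Ioc 0 T) :=
  integrableOn_of_mem h (measurable_meanLevel h) (meanLevel_mem h.le h.w_nonneg h.w_le_one)

theorem powMean_one (t : ℝ) : powMean 1 a b w t = meanLevel a b w t := by
  simp [powMean, meanLevel]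

theorem powMean_rpow (h : AdmissibleLevels T a b w) (hα : 0 < α) (t : ℝ) :
    powMean α a b w t ^ α = w t * b t ^ α + (1 - w t) * a t ^ α := by
  rw [powMean, ← Real.rpow_mul (h.base_nonneg α t), one_div_mul_cancel hα.ne', Real.rpow_one]

/-- The Rényi information rate of order `α`. -/
noncomputable def infoRate (α : ℝ) (a b w : ℝ → ℝ) (t : ℝ) : ℝ :=
  w t * localDiv α (b t) (powMean α a b w t) + (1 - w t) * localDiv α (a t) (powMean α a b w t)

/-- With `q` the power mean, the weighted average of `b^α` and `a^α` is `q^α`, and `q^α q^(1-α) =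
q`; the terms linear in the levels average to the mean level. -/
theorem infoRate_of_ne_one (h : AdmissibleLevels T a b w) (hα : 0 < α) (h1 : α ≠ 1) (t : ℝ) :
    infoRate α a b w t = α / (α - 1) * (powMean α a b w t - meanLevel a b w t) := by
  have hα1 : α - 1 ≠ 0 := sub_ne_zero.2 h1
  have hq := powMean_nonneg h hα t
  have e := powMean_rpow h hα t
  have e2 : powMean α a b w t ^ α * powMean α a b w t ^ (1 - α) = powMean α a b w t := by
    rw [← Real.rpow_add' hq (by simp), add_sub_cancel, Real.rpow_one]
  unfold infoRate localDiv meanLevel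
  rw [if_neg h1, if_neg h1]
  rw [e] at e2
  generalize powMean α a b w t = q at *
  field_simp
  linear_combination e2

theorem infoRate_one (t : ℝ) :
    infoRate 1 a b w t = w t * (b t * Real.log (b t / meanLevel a b w t)) +
      (1 - w t) * (a t * Real.log (a t / meanLevel a b w t)) := by
  unfold infoRate localDiv
  rw [if_pos rfl, if_pos rfl, powMean_one]
  unfold meanLevel
  ring

theorem infoRate_nonneg (h : AdmissibleLevels T a b w) (hα : 0 < α) (t : ℝ) :
    0 ≤ infoRate α a b w t := by
  have hq := powMean_nonneg h hα t
  have hb := h.b_nonneg t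
  have ha := h.nonneg t
  -- A single local divergence from zero need not be nonnegative under the conventions for division
  -- by zero, but when the power mean vanishes each level is zero or has weight zero.
  have key : ∀ v x : ℝ, 0 ≤ v → 0 ≤ x → (powMean α a b w t = 0 → v * x ^ α = 0) →
      0 ≤ v * localDiv α x (powMean α a b w t) := by
    intro v x hv hx h0
    by_cases hq0 : powMean α a b w t = 0
    · rcases mul_eq_zero.1 (h0 hq0) with hv0 | hx0
      · rw [hv0, zero_mul]
      · rw [(Real.rpow_eq_zero hx hα.ne').1 hx0, hq0, localDiv_zero_zero hα, mul_zero]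
    · rw [localDiv_eq hα hx hq fun h ↦ absurd h hq0]
      exact mul_nonneg hv (mul_nonneg hq (entropyFun_nonneg hα (by positivity)))
  have h1 : 0 ≤ w t * b t ^ α := mul_nonneg (h.w_nonneg t) (Real.rpow_nonneg hb _)
  have h2 : 0 ≤ (1 - w t) * a t ^ α :=
    mul_nonneg (by linarith [h.w_le_one t]) (Real.rpow_nonneg ha _)
  have hz : powMean α a b w t = 0 → w t * b t ^ α + (1 - w t) * a t ^ α = 0 := fun hq0 ↦ by
    rw [← powMean_rpow h hα, hq0, Real.zero_rpow hα.ne']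
  refine add_nonneg (key _ _ (h.w_nonneg t) hb fun hq0 ↦ ?_)
    (key _ _ (by linarith [h.w_le_one t]) ha fun hq0 ↦ ?_)
  · linarith [hz hq0]
  · linarith [hz hq0]

theorem measurable_infoRate (h : AdmissibleLevels T a b w) : Measurable (infoRate α a b w) := by
  have h1 := h.measurable_a
  have h2 := h.measurable_b
  have h3 := h.measurable_w
  have h4 := measurable_powMean (α := α) h
  have h5 := measurable_localDiv (α := α) h2 h4
  have h6 := measurable_localDiv (α := α) h1 h4
  unfold infoRate
  fun_prop

/-- The lower level contributes a nonpositive term, and in the upper one `log u ≤ u` together with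
`w b ≤ meanLevel` suffices. This gives integrability at order one, where the rate is not a
difference of integrable functions as it is for other orders. -/
theorem infoRate_one_le (h : AdmissibleLevels T a b w) (t : ℝ) : infoRate 1 a b w t ≤ b t := by
  rw [infoRate_one]
  have hc := meanLevel_mem h.le h.w_nonneg h.w_le_one t
  have hb := h.b_nonneg t
  have ha := h.nonneg t
  have hw0 := h.w_nonneg t
  have hw1 := h.w_le_one t
  have h1 : w t * b t ≤ meanLevel a b w t := by unfold meanLevel; nlinarith
  rcases (ha.trans hc.1).eq_or_lt with h0 | h0
  · rw [← h0]; simpa using hb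
  have h2 : (1 - w t) * (a t * Real.log (a t / meanLevel a b w t)) ≤ 0 := by
    refine mul_nonpos_of_nonneg_of_nonpos (by linarith) (mul_nonpos_of_nonneg_of_nonpos ha ?_)
    exact Real.log_nonpos (by positivity) ((div_le_one h0).2 hc.1)
  have h3 : w t * (b t * Real.log (b t / meanLevel a b w t)) ≤ b t := by
    have hlog : Real.log (b t / meanLevel a b w t) ≤ b t / meanLevel a b w t := by
      rcases (show 0 ≤ b t / meanLevel a b w t by positivity).eq_or_lt with h | h
      · rw [← h]; simp
      · linarith [Real.log_le_sub_one_of_pos h]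
    calc w t * (b t * Real.log (b t / meanLevel a b w t))
        ≤ w t * (b t * (b t / meanLevel a b w t)) := by gcongr
      _ = b t * (w t * b t / meanLevel a b w t) := by ring
      _ ≤ b t * 1 := by
          gcongr
          exact (div_le_one h0).2 h1
      _ = b t := mul_one _
  linarith

theorem infoRate_integrableOn (h : AdmissibleLevels T a b w) (hα : 0 < α) :
    IntegrableOn (infoRate α a b w) (Ioc 0 T) := by
  by_cases h1 : α = 1
  · subst h1
    refine Integrable.mono' h.integrableOn (measurable_infoRate h).aestronglyMeasurable
      (Eventually.of_forall fun t ↦ ?_)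
    rw [Real.norm_eq_abs, abs_of_nonneg (infoRate_nonneg h hα t)]
    exact infoRate_one_le h t
  · rw [show infoRate α a b w = fun t ↦ α / (α - 1) * (powMean α a b w t - meanLevel a b w t) from
      funext fun t ↦ infoRate_of_ne_one h hα h1 t]
    exact ((powMean_integrableOn h hα).sub (meanLevel_integrableOn h)).const_mul _

theorem integral_infoRate (h : AdmissibleLevels T a b w) (hα : 0 < α) (h1 : α ≠ 1) :
    (α - 1) / α * ∫ t in Ioc 0 T, infoRate α a b w t =
      (∫ t in Ioc 0 T, powMean α a b w t) - ∫ t in Ioc 0 T, meanLevel a b w t := by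
  have hα1 : α - 1 ≠ 0 := sub_ne_zero.2 h1
  rw [← integral_sub (powMean_integrableOn h hα) (meanLevel_integrableOn h), ← integral_const_mul]
  refine integral_congr_ae (Eventually.of_forall fun t ↦ ?_)
  simp only [infoRate_of_ne_one h hα h1 t]
  field_simp

theorem hasDerivAt_const_rpow_one {x : ℝ} (hx : 0 ≤ x) :
    HasDerivAt (fun α : ℝ ↦ x ^ α) (x * Real.log x) 1 := by
  rcases hx.eq_or_lt with h0 | h0
  · rw [← h0, zero_mul]
    refine (hasDerivAt_const (1 : ℝ) (0 : ℝ)).congr_of_eventuallyEq ?_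
    filter_upwards [eventually_gt_nhds zero_lt_one] with α hα
    exact Real.zero_rpow hα.ne'
  · have := (Real.hasStrictDerivAt_const_rpow h0 1).hasDerivAt
    rwa [Real.rpow_one] at this

/-- For `α ≠ 1` the rate is `α` times the slope at `1` of `α ↦ powMean α`, so this derivative is
what makes the rates converge to the rate of order one. A vanishing mean level is treated apart:
there the power mean is zero for all positive orders. -/
theorem hasDerivAt_powMean (h : AdmissibleLevels T a b w) (t : ℝ) :
    HasDerivAt (fun α ↦ powMean α a b w t) (infoRate 1 a b w t) 1 := by
  have hc := meanLevel_mem h.le h.w_nonneg h.w_le_one t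
  rcases ((h.nonneg t).trans hc.1).eq_or_lt with h0 | h0
  · have hr : infoRate 1 a b w t = 0 := by rw [infoRate_one, ← h0]; simp
    rw [hr]
    refine (hasDerivAt_const (1 : ℝ) (0 : ℝ)).congr_of_eventuallyEq ?_
    filter_upwards [eventually_gt_nhds zero_lt_one] with α hα
    have h1 : 0 ≤ w t * b t := mul_nonneg (h.w_nonneg t) (h.b_nonneg t)
    have h2 : 0 ≤ (1 - w t) * a t := mul_nonneg (by linarith [h.w_le_one t]) (h.nonneg t)
    have h3 : w t * b t + (1 - w t) * a t = 0 := h0.symm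
    have h4 : w t * b t ^ α = 0 := by
      rcases mul_eq_zero.1 (show w t * b t = 0 by linarith) with h | h <;> simp [h, hα.ne']
    have h5 : (1 - w t) * a t ^ α = 0 := by
      rcases mul_eq_zero.1 (show (1 - w t) * a t = 0 by linarith) with h | h <;> simp [h, hα.ne']
    rw [powMean, h4, h5, add_zero, Real.zero_rpow (by positivity)]
  · have hs : HasDerivAt (fun α : ℝ ↦ w t * b t ^ α + (1 - w t) * a t ^ α)
        (w t * (b t * Real.log (b t)) + (1 - w t) * (a t * Real.log (a t))) 1 :=
      ((hasDerivAt_const_rpow_one (h.b_nonneg t)).const_mul _).add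
        ((hasDerivAt_const_rpow_one (h.nonneg t)).const_mul _)
    have hi : HasDerivAt (fun α : ℝ ↦ 1 / α) (-1) 1 := by
      have := hasDerivAt_inv (x := (1 : ℝ)) one_ne_zero
      simpa using this
    have hv : w t * b t ^ (1 : ℝ) + (1 - w t) * a t ^ (1 : ℝ) = meanLevel a b w t := by
      simp [meanLevel]
    have hd := hs.rpow hi (by rw [hv]; exact h0)
    refine hd.congr_deriv ?_
    rw [hv, infoRate_one]
    have hlog : ∀ x : ℝ, x * Real.log (x / meanLevel a b w t) =
        x * Real.log x - x * Real.log (meanLevel a b w t) := by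
      intro x
      by_cases hx : x = 0
      · simp [hx]
      · rw [Real.log_div hx h0.ne']; ring
    rw [hlog, hlog]
    simp only [div_one, sub_self, Real.rpow_zero, Real.rpow_one]
    have : meanLevel a b w t = w t * b t + (1 - w t) * a t := rfl
    generalize Real.log (meanLevel a b w t) = l
    rw [this]
    ring

theorem tendsto_powMean (h : AdmissibleLevels T a b w) (t : ℝ) :
    Tendsto (fun α ↦ powMean α a b w t) (𝓝[≠] 1) (𝓝 (meanLevel a b w t)) := by
  have := (hasDerivAt_powMean h t).continuousAt.tendsto
  rw [powMean_one] at this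
  exact this.mono_left nhdsWithin_le_nhds

theorem tendsto_infoRate (h : AdmissibleLevels T a b w) (t : ℝ) :
    Tendsto (fun α ↦ infoRate α a b w t) (𝓝[≠] 1) (𝓝 (infoRate 1 a b w t)) := by
  have hs := hasDerivAt_iff_tendsto_slope.1 (hasDerivAt_powMean h t)
  have hid : Tendsto (fun α : ℝ ↦ α) (𝓝[≠] 1) (𝓝 1) := tendsto_id.mono_left nhdsWithin_le_nhds
  have := hid.mul hs
  rw [one_mul] at this
  refine this.congr' ?_
  have hpos : ∀ᶠ α : ℝ in 𝓝[≠] 1, 0 < α := nhdsWithin_le_nhds (eventually_gt_nhds zero_lt_one)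
  filter_upwards [self_mem_nhdsWithin, hpos] with α hα h0
  rw [infoRate_of_ne_one h h0 hα, slope_def_field, powMean_one]
  ring

/-- The capacity rates of orders tending to one have the rate of order one as a lower limit. -/
theorem eventually_lt_integral_infoRate (h : AdmissibleLevels T a b w) {s : ℕ → ℝ}
    (hs : Tendsto s atTop (𝓝[≠] 1)) {r : ℝ} (hr : r < ∫ t in Ioc 0 T, infoRate 1 a b w t) :
    ∀ᶠ k in atTop, r < ∫ t in Ioc 0 T, infoRate (s k) a b w t := by
  have hpos : ∀ᶠ k in atTop, 0 < s k :=
    hs.eventually (nhdsWithin_le_nhds (eventually_gt_nhds zero_lt_one))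
  by_cases hr0 : r < 0
  · filter_upwards [hpos] with k hk
    exact hr0.trans_le (integral_nonneg fun t ↦ infoRate_nonneg h hk t)
  have e : ∀ α : ℝ, 0 < α → ∫⁻ t in Ioc 0 T, ENNReal.ofReal (infoRate α a b w t) =
      ENNReal.ofReal (∫ t in Ioc 0 T, infoRate α a b w t) := fun α hα ↦
    (ofReal_integral_eq_lintegral_ofReal (infoRate_integrableOn h hα)
      (Eventually.of_forall fun t ↦ infoRate_nonneg h hα t)).symm
  -- Only a lower limit is required, so nonnegativity and Fatou's lemma replace a domination uniform
  -- in the order.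
  have hfatou : ∫⁻ t in Ioc 0 T, liminf (fun k ↦ ENNReal.ofReal (infoRate (s k) a b w t)) atTop ≤
      liminf (fun k ↦ ∫⁻ t in Ioc 0 T, ENNReal.ofReal (infoRate (s k) a b w t)) atTop :=
    lintegral_liminf_le fun k ↦ (measurable_infoRate h).ennreal_ofReal
  have hlim : ∀ t, liminf (fun k ↦ ENNReal.ofReal (infoRate (s k) a b w t)) atTop =
      ENNReal.ofReal (infoRate 1 a b w t) := fun t ↦
    (ENNReal.tendsto_ofReal ((tendsto_infoRate h t).comp hs)).liminf_eq
  simp_rw [hlim] at hfatou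
  rw [e 1 one_pos] at hfatou
  have hlt : ENNReal.ofReal r < ENNReal.ofReal (∫ t in Ioc 0 T, infoRate 1 a b w t) :=
    (ENNReal.ofReal_lt_ofReal_iff_of_nonneg (not_lt.1 hr0)).2 hr
  have hev := eventually_lt_of_lt_liminf (hlt.trans_le hfatou)
  filter_upwards [hev, hpos] with k hk hk0
  rw [e _ hk0] at hk
  exact (ENNReal.ofReal_lt_ofReal_iff_of_nonneg (not_lt.1 hr0)).1 hk

end PowerMean
end RenyiPoisson

namespace RenyiPoisson

open Filter Topology

/-! ### Asymptotics of the shift priors: lower bounds and uniqueness -/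

section ShiftPrior

theorem lintegral_rnDeriv_reference_le {T : ℝ} [Fact (0 < T)] (Q : Measure (SamplePath T)) [IsProbabilityMeasure Q] :
    ∫⁻ ω, Q.rnDeriv (reference T) ω ∂(reference T) ≤ 1 := by
  simpa using Measure.lintegral_rnDeriv_le (μ := Q) (ν := reference T)

variable {T : ℝ} [hT : Fact (0 < T)] {a b w : ℝ → ℝ} {F : Set (Measure (SamplePath T))} {α : ℝ}

/-- All Poisson processes with shift intensities belong to `F`. -/
def ContainsShifts (T : ℝ) (a b w : ℝ → ℝ) (F : Set (Measure (SamplePath T))) : Prop :=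
  ∀ (N : ℕ) (u : Fin (N + 2) → Fin (N + 1)), poissonProcess T (shiftIntensity T N a b w u) ∈ F

/-- The uniform prior on the Poisson processes with the shift intensities. -/
noncomputable def shiftPrior (hF : ContainsShifts T a b w F) (N : ℕ) : Prior F :=
  uniformPrior (fun u : Fin (N + 2) → Fin (N + 1) ↦
    poissonProcess T (shiftIntensity T N a b w u)) (hF N)

theorem lintegral_pathProd_b_ne_top (h : AdmissibleLevels T a b w) :
    ∫⁻ ω, ENNReal.ofReal (pathProd b ω) ∂(reference T) ≠ ⊤ := by
  rw [lintegral_pathProd h.measurable_b h.b_nonneg h.integrableOn]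
  exact ENNReal.ofReal_ne_top

theorem pathDensity_le_pathProd {f : ℝ → ℝ} (h : AdmissibleLevels T a b w)
    (hf : ∀ t, f t ∈ Icc (a t) (b t)) (ω : SamplePath T) : pathDensity f ω ≤ pathProd b ω := by
  have h0 : ∀ t, 0 ≤ f t := fun t ↦ (h.nonneg t).trans (hf t).1
  calc pathDensity f ω ≤ 1 * pathProd f ω := by
        refine mul_le_mul_of_nonneg_right ?_ (pathProd_nonneg h0 ω)
        rw [Real.exp_le_one_iff]
        linarith [integral_nonneg (μ := volume.restrict (Ioc 0 T)) (f := f) h0]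
    _ ≤ pathProd b ω := by
        rw [one_mul]
        exact pathProd_mono h0 (fun t ↦ (hf t).2) ω

theorem ae_meanDensity_shiftPrior (h : AdmissibleLevels T a b w)
    (hF : ContainsShifts T a b w F) (hα : 0 < α) :
    ∀ᵐ ω ∂(reference T), ∀ N, (shiftPrior hF N).meanDensity α (reference T) ω =
      ENNReal.ofReal ((avg fun u : Fin (N + 2) → Fin (N + 1) ↦
        pathDensity (shiftIntensity T N a b w u) ω ^ α) ^ (1 / α)) := by
  rw [ae_all_iff]
  intro N
  have h0 : ∀ (u : Fin (N + 2) → Fin (N + 1)) t, 0 ≤ shiftIntensity T N a b w u t := fun u t ↦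
    (h.nonneg t).trans (shiftIntensity_mem h.le u t).1
  exact uniformPrior_meanDensity _ _ (fun u ω ↦ pathDensity_nonneg (h0 u) ω) (fun u ↦
    rnDeriv_poissonProcess (measurable_shiftIntensity h.measurable_a h.measurable_b h.measurable_w u)
      (h0 u) (shiftIntensity_integrableOn h.measurable_a h.measurable_b h.measurable_w h.nonneg h.le
        h.integrableOn u)) hα

/-- Every shift intensity is at most `b` and the exponential factors are at most one. The bound does
not depend on `N` and is integrable, so it serves as the dominating function for every order. -/
theorem ae_meanDensity_le (h : AdmissibleLevels T a b w)
    (hF : ContainsShifts T a b w F) (hα : 0 < α) :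
    ∀ᵐ ω ∂(reference T), ∀ N, (shiftPrior hF N).meanDensity α (reference T) ω ≤
      ENNReal.ofReal (pathProd b ω) := by
  filter_upwards [ae_meanDensity_shiftPrior h hF hα] with ω hω N
  have h0 : ∀ (u : Fin (N + 2) → Fin (N + 1)), 0 ≤ pathDensity (shiftIntensity T N a b w u) ω :=
    fun u ↦ pathDensity_nonneg (fun t ↦ (h.nonneg t).trans (shiftIntensity_mem h.le u t).1) ω
  have hb := pathProd_nonneg h.b_nonneg ω
  rw [hω N]
  refine ENNReal.ofReal_le_ofReal ?_
  calc _ ≤ (pathProd b ω ^ α) ^ (1 / α) := by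
        refine Real.rpow_le_rpow (avg_nonneg fun u ↦ Real.rpow_nonneg (h0 u) _)
          (avg_le fun u ↦ Real.rpow_le_rpow (h0 u) ?_ hα.le) (by positivity)
        exact pathDensity_le_pathProd h (shiftIntensity_mem h.le u) ω
    _ = _ := by rw [← Real.rpow_mul hb, mul_one_div_cancel hα.ne', Real.rpow_one]

theorem ae_tendsto_meanDensity (h : AdmissibleLevels T a b w)
    (hF : ContainsShifts T a b w F) (hα : 0 < α) :
    ∀ᵐ ω ∂(reference T), Tendsto (fun N ↦ (shiftPrior hF N).meanDensity α (reference T) ω) atTop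
      (𝓝 (ENNReal.ofReal (limitDensity α a b w ω))) := by
  filter_upwards [ae_meanDensity_shiftPrior h hF hα, ae_arrival] with ω hω hω'
  simp_rw [hω]
  exact ENNReal.tendsto_ofReal (tendsto_avg_pathDensity hα h.measurable_a h.measurable_b
    h.measurable_w h.nonneg h.le h.w_nonneg h.w_le_one h.integrableOn hω'.1 hω'.2)

/-- The limit has the product over arrivals of the power mean but the exponential of the mean level;
the discrepancy of the two integrals is the information, by `integral_infoRate`. This is how the
candidate center emerges from the priors. -/
theorem limitDensity_eq (h : AdmissibleLevels T a b w) (hα : 0 < α) (h1 : α ≠ 1)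
    (ω : SamplePath T) : limitDensity α a b w ω =
      Real.exp ((α - 1) / α * ∫ t in Ioc 0 T, infoRate α a b w t) *
        pathDensity (powMean α a b w) ω := by
  rw [integral_infoRate h hα h1, limitDensity, pathDensity, ← mul_assoc, ← Real.exp_add]
  congr 2
  ring

theorem limitDensity_one (ω : SamplePath T) :
    limitDensity 1 a b w ω = pathDensity (powMean 1 a b w) ω := by
  rw [limitDensity, pathDensity]
  simp_rw [powMean_one]

theorem measurable_limitDensity (h : AdmissibleLevels T a b w) :
    Measurable (limitDensity α a b w : SamplePath T → ℝ) :=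
  (measurable_pathProd (measurable_powMean h)).const_mul _

theorem limitDensity_le (h : AdmissibleLevels T a b w) (hα : 0 < α) (ω : SamplePath T) :
    limitDensity α a b w ω ≤ pathProd b ω := by
  have h0 := powMean_nonneg h hα
  calc limitDensity α a b w ω ≤ 1 * pathProd (powMean α a b w) ω := by
        refine mul_le_mul_of_nonneg_right ?_ (pathProd_nonneg h0 ω)
        rw [Real.exp_le_one_iff]
        have := integral_nonneg (μ := volume.restrict (Ioc 0 T)) (f := meanLevel a b w) fun t ↦
          (h.nonneg t).trans (meanLevel_mem h.le h.w_nonneg h.w_le_one t).1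
        linarith
    _ ≤ pathProd b ω := by
        rw [one_mul]
        exact pathProd_mono h0 (fun t ↦ (powMean_mem h hα t).2) ω

theorem tendsto_limitDensity (h : AdmissibleLevels T a b w) (ω : SamplePath T) :
    Tendsto (fun α ↦ limitDensity α a b w ω) (𝓝[≠] 1) (𝓝 (limitDensity 1 a b w ω)) := by
  have : Tendsto (fun α ↦ pathProd (powMean α a b w) ω) (𝓝[≠] 1)
      (𝓝 (pathProd (powMean 1 a b w) ω)) := by
    refine tendsto_finsetProd _ fun k _ ↦ ?_
    rw [powMean_one]
    exact tendsto_powMean h _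
  exact this.const_mul _

theorem lintegral_limitDensity (h : AdmissibleLevels T a b w) (hα : 0 < α) (h1 : α ≠ 1) :
    ∫⁻ ω, ENNReal.ofReal (limitDensity α a b w ω) ∂(reference T) =
      ENNReal.ofReal (Real.exp ((α - 1) / α * ∫ t in Ioc 0 T, infoRate α a b w t)) := by
  have hm := measurable_powMean (α := α) h
  have h0 := powMean_nonneg h hα
  simp_rw [limitDensity]
  simp_rw [ENNReal.ofReal_mul (Real.exp_pos _).le]
  rw [lintegral_const_mul _ (measurable_pathProd hm).ennreal_ofReal,
    lintegral_pathProd hm h0 (powMean_integrableOn h hα), ← ENNReal.ofReal_mul (Real.exp_pos _).le,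
    ← Real.exp_add, integral_infoRate h hα h1]
  congr 2
  ring

theorem tendsto_renyiInformation_shiftPrior (hF : ContainsShifts T a b w F)
    (h : AdmissibleLevels T a b w) (hα : 0 < α)
    (h1 : α ≠ 1) (hp : ∀ W ∈ F, IsProbabilityMeasure W) (hac : ∀ W ∈ F, W ≪ reference T) :
    Tendsto (fun N ↦ renyiInformation α (shiftPrior hF N)) atTop
      (𝓝 ((∫ t in Ioc 0 T, infoRate α a b w t : ℝ) : EReal)) := by
  have hlim : Tendsto (fun N ↦ (shiftPrior hF N).meanMeasure α univ) atTop
      (𝓝 (ENNReal.ofReal (Real.exp ((α - 1) / α * ∫ t in Ioc 0 T, infoRate α a b w t)))) := by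
    rw [← lintegral_limitDensity h hα h1]
    refine Tendsto.congr (fun N ↦ ((shiftPrior hF N).meanMeasure_univ hα
      (fun W hW ↦ hp W ((shiftPrior hF N).mem hW))
      (fun W hW ↦ hac W ((shiftPrior hF N).mem hW))).symm) ?_
    exact tendsto_lintegral_of_dominated_convergence (fun ω ↦ ENNReal.ofReal (pathProd b ω))
      (fun N ↦ Prior.measurable_meanDensity _ _ _)
      (ae_all_iff.1 (ae_meanDensity_le h hF hα)) (lintegral_pathProd_b_ne_top h)
      (ae_tendsto_meanDensity h hF hα)
  have hc : α / (α - 1) ≠ 0 := div_ne_zero hα.ne' (sub_ne_zero.2 h1)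
  have hlog := (ENNReal.continuous_log.tendsto _).comp hlim
  have hpair := (tendsto_const_nhds (x := ((α / (α - 1) : ℝ) : EReal))).prodMk_nhds hlog
  -- Multiplication of extended reals is continuous here because the factor `α / (α - 1)` is finite
  -- and nonzero.
  have hmul := (EReal.continuousAt_mul (p := (((α / (α - 1) : ℝ) : EReal), ENNReal.log
    (ENNReal.ofReal (Real.exp ((α - 1) / α * ∫ t in Ioc 0 T, infoRate α a b w t)))))
    (Or.inl (EReal.coe_ne_zero.2 hc)) (Or.inl (EReal.coe_ne_zero.2 hc))
    (Or.inl (EReal.coe_ne_bot _)) (Or.inl (EReal.coe_ne_top _))).tendsto.comp hpair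
  have e : ((α / (α - 1) : ℝ) : EReal) * ENNReal.log
      (ENNReal.ofReal (Real.exp ((α - 1) / α * ∫ t in Ioc 0 T, infoRate α a b w t))) =
      ((∫ t in Ioc 0 T, infoRate α a b w t : ℝ) : EReal) := by
    rw [ENNReal.log_ofReal_of_pos (Real.exp_pos _), Real.log_exp, ← EReal.coe_mul]
    congr 1
    have := sub_ne_zero.2 h1
    field_simp
  dsimp only at hmul
  rw [e] at hmul
  refine hmul.congr fun N ↦ ?_
  rw [renyiInformation, if_neg h1]
  rfl

theorem tendsto_one_sub_inv : Tendsto (fun k : ℕ ↦ 1 - 1 / ((k : ℝ) + 2)) atTop (𝓝[≠] 1) := by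
  refine tendsto_nhdsWithin_iff.2 ⟨?_, Eventually.of_forall fun k ↦ ?_⟩
  · have h1 : Tendsto (fun k : ℕ ↦ (k : ℝ) + 2) atTop atTop :=
      tendsto_atTop_add_const_right _ _ tendsto_natCast_atTop_atTop
    simpa using (tendsto_inv_atTop_zero.comp h1).const_sub 1
  · have : (0 : ℝ) < 1 / ((k : ℝ) + 2) := by positivity
    simp only [mem_compl_iff, mem_singleton_iff]
    linarith

theorem one_sub_inv_mem (k : ℕ) : 1 - 1 / ((k : ℝ) + 2) ∈ Ico (1 / 2 : ℝ) 1 := by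
  have h2 : (1 : ℝ) / ((k : ℝ) + 2) ≤ 1 / 2 :=
    one_div_le_one_div_of_le two_pos (by linarith [k.cast_nonneg (α := ℝ)])
  have : (0 : ℝ) < 1 / ((k : ℝ) + 2) := by positivity
  constructor <;> linarith

/-- The integrated rate is at most the capacity. -/
theorem integral_infoRate_le_renyiCapacity (hF : ContainsShifts T a b w F)
    (h : AdmissibleLevels T a b w) (hα : 0 < α)
    (hp : ∀ W ∈ F, IsProbabilityMeasure W) (hac : ∀ W ∈ F, W ≪ reference T) :
    ((∫ t in Ioc 0 T, infoRate α a b w t : ℝ) : EReal) ≤ renyiCapacity α F := by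
  by_cases h1 : α = 1
  · subst h1
    -- For `r` below the rate of order one, some order slightly below one has rate above `r`; its
    -- information along the shift priors exceeds `r`, and mutual information is larger still.
    refine EReal.ge_of_forall_gt_iff_ge.1 fun r hr ↦ ?_
    rw [EReal.coe_lt_coe_iff] at hr
    obtain ⟨k, hk⟩ := (eventually_lt_integral_infoRate h tendsto_one_sub_inv hr).exists
    have hm := one_sub_inv_mem k
    have h0 : 0 < 1 - 1 / ((k : ℝ) + 2) := by linarith [hm.1]
    have hlim := tendsto_renyiInformation_shiftPrior hF h h0 hm.2.ne hp hac
    obtain ⟨N, hN⟩ := (hlim.eventually_const_lt (EReal.coe_lt_coe_iff.2 hk)).exists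
    exact hN.le.trans ((renyiInformation_le_mutualInformation _ h0 hm.2
      fun W hW ↦ hp W (Prior.mem _ hW)).trans (le_iSup (renyiInformation 1) (shiftPrior hF N)))
  · exact le_of_tendsto' (tendsto_renyiInformation_shiftPrior hF h hα h1 hp hac)
      fun N ↦ le_iSup (renyiInformation α) (shiftPrior hF N)

/-- The integrated rate is at most the radius relative to any probability measure. -/
theorem integral_infoRate_le_of_renyiDivergence_le (hF : ContainsShifts T a b w F)
    (h : AdmissibleLevels T a b w) (hα : 0 < α)
    (hp : ∀ W ∈ F, IsProbabilityMeasure W) (hac : ∀ W ∈ F, W ≪ reference T)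
    {Q : Measure (SamplePath T)} [IsProbabilityMeasure Q] {R : ℝ}
    (hR : ∀ W ∈ F, renyiDivergence α W Q ≤ (R : EReal)) :
    ∫ t in Ioc 0 T, infoRate α a b w t ≤ R := by
  by_cases h1 : α = 1
  · subst h1
    refine le_of_forall_lt_imp_le_of_dense fun r hr ↦ ?_
    obtain ⟨k, hk⟩ := (eventually_lt_integral_infoRate h tendsto_one_sub_inv hr).exists
    have hm := one_sub_inv_mem k
    have h0 : 0 < 1 - 1 / ((k : ℝ) + 2) := by linarith [hm.1]
    have hlim := tendsto_renyiInformation_shiftPrior hF h h0 hm.2.ne hp hac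
    refine hk.le.trans (EReal.coe_le_coe_iff.1 (le_of_tendsto' hlim fun N ↦ ?_))
    refine renyiInformation_le_of_ne_one _ (Q := Q) h0 hm.2.ne (fun W hW ↦ hp W (Prior.mem _ hW))
      fun W hW ↦ ?_
    have := hp W (Prior.mem _ hW)
    exact (renyiDivergence_le_one h0 hm.2).trans (hR W (Prior.mem _ hW))
  · exact EReal.coe_le_coe_iff.1 (le_of_tendsto' (tendsto_renyiInformation_shiftPrior hF h hα h1 hp
      hac) fun N ↦ renyiInformation_le_of_ne_one _ (Q := Q) hα h1
      (fun W hW ↦ hp W (Prior.mem _ hW)) fun W hW ↦ hR W (Prior.mem _ hW))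

/-- The limit in `N` of Sibson's inequality for the shift priors. For `α < 1` both exponents are
positive, and Hölder makes the dominating function built from `pathProd b` integrable. -/
theorem le_lintegral_limitDensity (hF : ContainsShifts T a b w F)
    (h : AdmissibleLevels T a b w) (h0 : 0 < α) (h1 : α < 1)
    (hp : ∀ W ∈ F, IsProbabilityMeasure W) (hac : ∀ W ∈ F, W ≪ reference T)
    {Q : Measure (SamplePath T)} [IsProbabilityMeasure Q] {R : ℝ}
    (hR : ∀ W ∈ F, renyiDivergence α W Q ≤ (R : EReal)) :
    ENNReal.ofReal (Real.exp ((α - 1) * R)) ≤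
      ∫⁻ ω, ENNReal.ofReal (limitDensity α a b w ω) ^ α *
        Q.rnDeriv (reference T) ω ^ (1 - α) ∂(reference T) := by
  have hb : Measurable fun ω : SamplePath T ↦ ENNReal.ofReal (pathProd b ω) :=
    (measurable_pathProd h.measurable_b).ennreal_ofReal
  refine ge_of_tendsto' (tendsto_lintegral_of_dominated_convergence
    (fun ω ↦ ENNReal.ofReal (pathProd b ω) ^ α * Q.rnDeriv (reference T) ω ^ (1 - α))
    (F := fun N ω ↦ (shiftPrior hF N).meanDensity α (reference T) ω ^ α *
      Q.rnDeriv (reference T) ω ^ (1 - α)) (fun N ↦ ?_) (fun N ↦ ?_) ?_ ?_) fun N ↦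
    (shiftPrior hF N).le_lintegral_meanDensity_rpow h0 h1 (fun W hW ↦ hp W (Prior.mem _ hW))
      (fun W hW ↦ hac W (Prior.mem _ hW)) fun W hW ↦ hR W (Prior.mem _ hW)
  · have := (shiftPrior hF N).measurable_meanDensity α (reference T)
    fun_prop
  · filter_upwards [ae_meanDensity_le h hF h0] with ω hω
    have := hω N
    gcongr
  · refine ((lintegral_rpow_mul_rpow_one_sub_le hb (Measure.measurable_rnDeriv _ _)
      (lintegral_rnDeriv_reference_le Q) h0 h1).trans_lt ?_).ne
    exact ENNReal.rpow_lt_top_of_nonneg h0.le (lintegral_pathProd_b_ne_top h)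
  · filter_upwards [ae_tendsto_meanDensity h hF h0, Q.rnDeriv_lt_top (reference T)] with ω hω hω'
    exact ENNReal.Tendsto.mul_const ((ENNReal.continuous_rpow_const.tendsto _).comp hω)
      (Or.inr (ENNReal.rpow_ne_top_of_nonneg (by linarith) hω'.ne))

/-- For `α > 1` the density of `Q` enters with a negative exponent and no domination is at hand, but
the inequality sought is the one that Fatou's lemma provides. -/
theorem lintegral_limitDensity_le (hF : ContainsShifts T a b w F)
    (h : AdmissibleLevels T a b w) (h1 : 1 < α)
    (hp : ∀ W ∈ F, IsProbabilityMeasure W) (hac : ∀ W ∈ F, W ≪ reference T)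
    {Q : Measure (SamplePath T)} [IsProbabilityMeasure Q] {R : ℝ}
    (hR : ∀ W ∈ F, renyiDivergence α W Q ≤ (R : EReal)) :
    ∫⁻ ω, ENNReal.ofReal (limitDensity α a b w ω) ^ α *
        Q.rnDeriv (reference T) ω ^ (1 - α) ∂(reference T) ≤
      ENNReal.ofReal (Real.exp ((α - 1) * R)) := by
  have h0 : 0 < α := by linarith
  calc _ ≤ ∫⁻ ω, liminf (fun N ↦ (shiftPrior hF N).meanDensity α (reference T) ω ^ α *
          Q.rnDeriv (reference T) ω ^ (1 - α)) atTop ∂(reference T) := by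
        refine lintegral_mono_ae ?_
        filter_upwards [ae_tendsto_meanDensity h hF h0] with ω hω
        -- Multiplication by a possibly infinite constant is discontinuous at zero; where the limit
        -- density vanishes the left side is zero and nothing is needed.
        by_cases hz : ENNReal.ofReal (limitDensity α a b w ω) = 0
        · rw [hz, ENNReal.zero_rpow_of_pos h0, zero_mul]
          exact zero_le
        · exact (ENNReal.Tendsto.mul_const ((ENNReal.continuous_rpow_const.tendsto _).comp hω)
            (Or.inl (by simp [hz]))).liminf_eq.ge
    _ ≤ liminf (fun N ↦ ∫⁻ ω, (shiftPrior hF N).meanDensity α (reference T) ω ^ α *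
          Q.rnDeriv (reference T) ω ^ (1 - α) ∂(reference T)) atTop := by
        refine lintegral_liminf_le fun N ↦ ?_
        have := (shiftPrior hF N).measurable_meanDensity α (reference T)
        fun_prop
    _ ≤ liminf (fun _ : ℕ ↦ ENNReal.ofReal (Real.exp ((α - 1) * R))) atTop := by
        refine liminf_le_liminf (Eventually.of_forall fun N ↦ ?_)
        exact (shiftPrior hF N).lintegral_meanDensity_rpow_le h1 (fun W hW ↦ hp W (Prior.mem _ hW))
          (fun W hW ↦ hac W (Prior.mem _ hW)) fun W hW ↦ hR W (Prior.mem _ hW)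
    _ = _ := liminf_const _

theorem lintegral_limitDensity_rpow_mul (h : AdmissibleLevels T a b w) (hα : 0 < α) (h1 : α ≠ 1)
    (Q : Measure (SamplePath T)) :
    ∫⁻ ω, ENNReal.ofReal (limitDensity α a b w ω) ^ α *
        Q.rnDeriv (reference T) ω ^ (1 - α) ∂(reference T) =
      ENNReal.ofReal (Real.exp ((α - 1) * ∫ t in Ioc 0 T, infoRate α a b w t)) *
        hellinger (reference T) α (poissonProcess T (powMean α a b w)) Q := by
  have hm := measurable_powMean (α := α) h
  have h0 := powMean_nonneg h hα
  rw [hellinger, ← lintegral_const_mul _ (by fun_prop)]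
  refine lintegral_congr_ae ?_
  filter_upwards [rnDeriv_poissonProcess hm h0 (powMean_integrableOn h hα)] with ω hω
  rw [hω, limitDensity_eq h hα h1, ENNReal.ofReal_mul (Real.exp_pos _).le,
    ENNReal.mul_rpow_of_nonneg _ _ hα.le, mul_assoc,
    ENNReal.ofReal_rpow_of_pos (Real.exp_pos _), ← Real.exp_mul]
  congr 3
  field_simp

/-- The limit density is a constant times that of the candidate center, and with `R` equal to the
integrated rate this constant cancels. What remains is a Hellinger integral at least one for `α <
1`, at most one for `α > 1`, so rigidity applies. -/
theorem eq_of_renyiDivergence_le_of_ne_one (hF : ContainsShifts T a b w F)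
    (h : AdmissibleLevels T a b w) (hα : 0 < α) (h1 : α ≠ 1)
    (hp : ∀ W ∈ F, IsProbabilityMeasure W) (hac : ∀ W ∈ F, W ≪ reference T)
    {Q : Measure (SamplePath T)} [IsProbabilityMeasure Q] (hR : ∀ W ∈ F, renyiDivergence α W Q ≤
      ((∫ t in Ioc 0 T, infoRate α a b w t : ℝ) : EReal)) :
    Q = poissonProcess T (powMean α a b w) := by
  have hm := measurable_powMean (α := α) h
  have h0 := powMean_nonneg h hα
  have hi := powMean_integrableOn h hα
  have := isProbabilityMeasure_poissonProcess T _ hi fun t _ ↦ h0 t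
  have hP := poissonProcess_absolutelyContinuous hm h0 hi
  have e1 := lintegral_limitDensity_rpow_mul h hα h1 Q
  have hpos : ENNReal.ofReal (Real.exp ((α - 1) * ∫ t in Ioc 0 T, infoRate α a b w t)) ≠ 0 := by
    simp [Real.exp_pos]
  rcases lt_or_gt_of_ne h1 with hlt | hgt
  · have := le_lintegral_limitDensity hF h hα hlt hp hac hR
    rw [e1] at this
    refine eq_of_one_le_hellinger hP hα hlt ?_
    rw [← ENNReal.mul_le_mul_iff_right hpos ENNReal.ofReal_ne_top, mul_one]
    exact this
  · have := lintegral_limitDensity_le hF h hgt hp hac hR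
    rw [e1] at this
    refine eq_of_hellinger_le_one hP hgt ?_
    rw [← ENNReal.mul_le_mul_iff_right hpos ENNReal.ofReal_ne_top, mul_one]
    exact this

end ShiftPrior
end RenyiPoisson

namespace RenyiPoisson

open Filter Topology

/-! ### The saddle point theorem: capacity, center and uniqueness -/

section Saddle

variable {T : ℝ} {a b w : ℝ → ℝ} {F : Set (Measure (SamplePath T))} {α : ℝ}

/-- A family of Poisson processes for which the power mean of the levels is the minimax intensity:
all members are at most as far from it as the average of the two levels. -/
structure IsSaddle (α T : ℝ) (a b w : ℝ → ℝ) (F : Set (Measure (SamplePath T))) : Prop where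
  levels : AdmissibleLevels T a b w
  shifts : ContainsShifts T a b w F
  bound : ∀ W ∈ F, ∃ (f : ℝ → ℝ) (K : ℝ), 0 ≤ K ∧ Measurable f ∧ (∀ t, 0 ≤ f t) ∧
    (∀ t, f t ≤ K * powMean α a b w t) ∧ W = poissonProcess T f ∧
    ∫ t in Ioc 0 T, localDiv α (f t) (powMean α a b w t) ≤ ∫ t in Ioc 0 T, infoRate α a b w t

theorem IsSaddle.isProbabilityMeasure (h : IsSaddle α T a b w F) (hα : 0 < α) :
    ∀ W ∈ F, IsProbabilityMeasure W := by
  intro W hW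
  obtain ⟨f, K, hK, hf, hf0, hfq, rfl, -⟩ := h.bound W hW
  exact isProbabilityMeasure_poissonProcess T f
    (integrableOn_of_le_mul hf hf0 hfq (powMean_integrableOn h.levels hα)) fun t _ ↦ hf0 t

variable [hT : Fact (0 < T)]

/-- As `α` tends to one the inequality of order `α` degenerates. Interpolating to order one half and
extracting the root of order `2(1-α)` leaves a bound with a meaningful limit, `exp (-R/2 + C/2)`
with `C` the limiting rate. -/
theorem ofReal_exp_le_affinity (hF : ContainsShifts T a b w F) (h : AdmissibleLevels T a b w)
    (h0 : 1 / 2 ≤ α) (h1 : α < 1)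
    (hp : ∀ W ∈ F, IsProbabilityMeasure W) (hac : ∀ W ∈ F, W ≪ reference T)
    {Q : Measure (SamplePath T)} [IsProbabilityMeasure Q] {R : ℝ}
    (hR : ∀ W ∈ F, renyiDivergence α W Q ≤ (R : EReal)) :
    ENNReal.ofReal (Real.exp (-R / 2 +
        (2 * α - 1) / (2 * α) * ∫ t in Ioc 0 T, infoRate α a b w t)) ≤
      ∫⁻ ω, ENNReal.ofReal (limitDensity α a b w ω) ^ (1 / 2 : ℝ) *
        Q.rnDeriv (reference T) ω ^ (1 / 2 : ℝ) ∂(reference T) := by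
  have hα : 0 < α := by linarith
  have hl := lintegral_limitDensity h hα h1.ne
  have key := (le_lintegral_limitDensity hF h hα h1 hp hac hR).trans
    (lintegral_rpow_mul_le_half (measurable_limitDensity h).ennreal_ofReal
      (Measure.measurable_rnDeriv Q (reference T)) (by rw [hl]; exact ENNReal.ofReal_ne_top)
      ((lintegral_rnDeriv_reference_le Q).trans_lt ENNReal.one_lt_top).ne h0 h1)
  rw [hl, ENNReal.ofReal_rpow_of_pos (Real.exp_pos _), ← Real.exp_mul] at key
  generalize (∫⁻ ω, ENNReal.ofReal (limitDensity α a b w ω) ^ (1 / 2 : ℝ) *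
    Q.rnDeriv (reference T) ω ^ (1 / 2 : ℝ) ∂(reference T)) = X at key ⊢
  generalize (∫ t in Ioc 0 T, infoRate α a b w t) = C at key ⊢
  have hκ : 0 < 2 * (1 - α) := by linarith
  rw [← ENNReal.rpow_le_rpow_iff hκ, ENNReal.ofReal_rpow_of_pos (Real.exp_pos _), ← Real.exp_mul,
    ← ENNReal.mul_le_mul_iff_left (c := ENNReal.ofReal (Real.exp ((α - 1) / α * C * (2 * α - 1))))
      (by simp [Real.exp_pos]) ENNReal.ofReal_ne_top,
    ← ENNReal.ofReal_mul (Real.exp_pos _).le, ← Real.exp_add]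
  have e : (-R / 2 + (2 * α - 1) / (2 * α) * C) * (2 * (1 - α)) + (α - 1) / α * C * (2 * α - 1) =
      (α - 1) * R := by
    field_simp
    ring
  rw [e]
  exact key

theorem tendsto_affinity (h : AdmissibleLevels T a b w) (Q : Measure (SamplePath T))
    [IsProbabilityMeasure Q] {s : ℕ → ℝ} (hs : Tendsto s atTop (𝓝[≠] 1)) (hs0 : ∀ k, 0 < s k) :
    Tendsto (fun k ↦ ∫⁻ ω, ENNReal.ofReal (limitDensity (s k) a b w ω) ^ (1 / 2 : ℝ) *
        Q.rnDeriv (reference T) ω ^ (1 / 2 : ℝ) ∂(reference T)) atTop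
      (𝓝 (∫⁻ ω, ENNReal.ofReal (limitDensity 1 a b w ω) ^ (1 / 2 : ℝ) *
        Q.rnDeriv (reference T) ω ^ (1 / 2 : ℝ) ∂(reference T))) := by
  have hb : Measurable fun ω : SamplePath T ↦ ENNReal.ofReal (pathProd b ω) :=
    (measurable_pathProd h.measurable_b).ennreal_ofReal
  refine tendsto_lintegral_of_dominated_convergence (fun ω ↦ ENNReal.ofReal (pathProd b ω) ^
    (1 / 2 : ℝ) * Q.rnDeriv (reference T) ω ^ (1 / 2 : ℝ)) (fun k ↦ ?_) (fun k ↦ ?_) ?_ ?_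
  · have := (measurable_limitDensity (α := s k) (T := T) h).ennreal_ofReal
    fun_prop
  · refine Eventually.of_forall fun ω ↦ ?_
    have := limitDensity_le h (hs0 k) ω
    dsimp only
    gcongr
  · refine ((lintegral_rpow_mul_rpow_le hb (Measure.measurable_rnDeriv Q _) (by norm_num)
      (by norm_num) (by norm_num)).trans_lt (ENNReal.mul_lt_top ?_ ?_)).ne
    · exact ENNReal.rpow_lt_top_of_nonneg (by norm_num) (lintegral_pathProd_b_ne_top h)
    · exact ENNReal.rpow_lt_top_of_nonneg (by norm_num)
        ((lintegral_rnDeriv_reference_le Q).trans_lt ENNReal.one_lt_top).ne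
  · filter_upwards [Q.rnDeriv_lt_top (reference T)] with ω hω'
    exact ENNReal.Tendsto.mul_const ((ENNReal.continuous_rpow_const.tendsto _).comp
      (ENNReal.tendsto_ofReal ((tendsto_limitDensity h ω).comp hs)))
      (Or.inr (ENNReal.rpow_ne_top_of_nonneg (by norm_num) hω'.ne))

/-- A bound on the divergences of order one also bounds those of lower order, so the affinity
estimate holds along orders increasing to one. In the limit the affinity with the candidate center
is at least `exp (-C/2 + C/2) = 1`. -/
theorem eq_of_renyiDivergence_one_le (hF : ContainsShifts T a b w F) (h : AdmissibleLevels T a b w)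
    (hp : ∀ W ∈ F, IsProbabilityMeasure W) (hac : ∀ W ∈ F, W ≪ reference T)
    {Q : Measure (SamplePath T)} [IsProbabilityMeasure Q] (hR : ∀ W ∈ F, renyiDivergence 1 W Q ≤
      ((∫ t in Ioc 0 T, infoRate 1 a b w t : ℝ) : EReal)) :
    Q = poissonProcess T (powMean 1 a b w) := by
  have hm := measurable_powMean (α := 1) h
  have h0 := powMean_nonneg h one_pos
  have hi := powMean_integrableOn h one_pos
  have := isProbabilityMeasure_poissonProcess T _ hi fun t _ ↦ h0 t
  refine eq_of_one_le_affinity (poissonProcess_absolutelyContinuous hm h0 hi) ?_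
  have e : ∫⁻ ω, (poissonProcess T (powMean 1 a b w)).rnDeriv (reference T) ω ^ (1 / 2 : ℝ) *
      Q.rnDeriv (reference T) ω ^ (1 / 2 : ℝ) ∂(reference T) =
      ∫⁻ ω, ENNReal.ofReal (limitDensity 1 a b w ω) ^ (1 / 2 : ℝ) *
        Q.rnDeriv (reference T) ω ^ (1 / 2 : ℝ) ∂(reference T) := by
    refine lintegral_congr_ae ?_
    filter_upwards [rnDeriv_poissonProcess hm h0 hi] with ω hω
    rw [hω, limitDensity_one]
  rw [e]
  set C := ∫ t in Ioc 0 T, infoRate 1 a b w t with hC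
  have hs0 : ∀ k : ℕ, 0 < 1 - 1 / ((k : ℝ) + 2) := fun k ↦ by linarith [(one_sub_inv_mem k).1]
  have hlim := tendsto_affinity h Q tendsto_one_sub_inv hs0
  generalize (∫⁻ ω, ENNReal.ofReal (limitDensity 1 a b w ω) ^ (1 / 2 : ℝ) *
    Q.rnDeriv (reference T) ω ^ (1 / 2 : ℝ) ∂(reference T)) = X at hlim ⊢
  have hs : Tendsto (fun k : ℕ ↦ 1 - 1 / ((k : ℝ) + 2)) atTop (𝓝 1) :=
    tendsto_one_sub_inv.mono_right nhdsWithin_le_nhds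
  -- The rates are only known to exceed each `r < C` eventually, so first the order tends to one
  -- with `r` fixed, then `r` tends to `C`.
  have hle : ∀ r < C, ENNReal.ofReal (Real.exp (-C / 2 + r / 2)) ≤ X := by
    intro r hr
    have h1 : Tendsto (fun k : ℕ ↦ ENNReal.ofReal (Real.exp (-C / 2 +
        (2 * (1 - 1 / ((k : ℝ) + 2)) - 1) / (2 * (1 - 1 / ((k : ℝ) + 2))) * r))) atTop
        (𝓝 (ENNReal.ofReal (Real.exp (-C / 2 + (2 * 1 - 1) / (2 * 1) * r)))) := by
      refine ENNReal.tendsto_ofReal ((Real.continuous_exp.tendsto _).comp ?_)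
      exact ((((hs.const_mul 2).sub_const 1).div (hs.const_mul 2) (by norm_num)).mul_const r).const_add
        _
    rw [show (2 * 1 - 1) / (2 * 1) * r = r / 2 by ring] at h1
    refine le_of_tendsto_of_tendsto h1 hlim ?_
    filter_upwards [eventually_lt_integral_infoRate h tendsto_one_sub_inv hr] with k hk
    have hm := one_sub_inv_mem k
    refine le_trans ?_ (ofReal_exp_le_affinity hF h hm.1 hm.2 hp hac (R := C) fun W hW ↦ ?_)
    · have : 0 ≤ (2 * (1 - 1 / ((k : ℝ) + 2)) - 1) / (2 * (1 - 1 / ((k : ℝ) + 2))) :=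
        div_nonneg (by linarith [hm.1]) (by linarith [hm.1])
      gcongr
    · have := hp W hW
      exact (renyiDivergence_le_one (hs0 k) hm.2).trans (hR W hW)
  have h2 : Tendsto (fun r ↦ ENNReal.ofReal (Real.exp (-C / 2 + r / 2))) (𝓝[<] C)
      (𝓝 (ENNReal.ofReal (Real.exp (-C / 2 + C / 2)))) := by
    refine (Continuous.tendsto ?_ C).mono_left nhdsWithin_le_nhds
    exact ENNReal.continuous_ofReal.comp (by fun_prop)
  have h3 := le_of_tendsto h2 (eventually_nhdsWithin_of_forall hle)
  simpa [neg_div] using h3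

theorem IsSaddle.absolutelyContinuous (h : IsSaddle α T a b w F) (hα : 0 < α) :
    ∀ W ∈ F, W ≪ reference T := by
  intro W hW
  obtain ⟨f, K, hK, hf, hf0, hfq, rfl, -⟩ := h.bound W hW
  exact poissonProcess_absolutelyContinuous hf hf0
    (integrableOn_of_le_mul hf hf0 hfq (powMean_integrableOn h.levels hα))

theorem IsSaddle.renyiDivergence_le (h : IsSaddle α T a b w F) (hα : 0 < α) :
    ∀ W ∈ F, renyiDivergence α W (poissonProcess T (powMean α a b w)) ≤
      ((∫ t in Ioc 0 T, infoRate α a b w t : ℝ) : EReal) := by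
  intro W hW
  obtain ⟨f, K, hK, hf, hf0, hfq, rfl, hle⟩ := h.bound W hW
  rw [renyiDivergence_poissonProcess hα hK hf (measurable_powMean h.levels) hf0
    (powMean_nonneg h.levels hα) hfq (powMean_integrableOn h.levels hα)]
  exact_mod_cast hle

theorem IsSaddle.renyiInformation_le (h : IsSaddle α T a b w F) (hα : 0 < α) (p : Prior F) :
    renyiInformation α p ≤ ((∫ t in Ioc 0 T, infoRate α a b w t : ℝ) : EReal) := by
  have hp := h.isProbabilityMeasure hα
  have hm := measurable_powMean (α := α) h.levels
  have h0 := powMean_nonneg h.levels hα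
  have hi := powMean_integrableOn h.levels hα
  have := isProbabilityMeasure_poissonProcess T _ hi fun t _ ↦ h0 t
  by_cases h1 : α = 1
  · subst h1
    refine EReal.le_of_forall_lt_iff_le.1 fun r hr ↦ ?_
    rw [EReal.coe_lt_coe_iff] at hr
    -- Mutual information is below the information of any order `β > 1`. The support being finite, a
    -- single `β` close to one brings all divergences below `r`.
    have hev : ∀ᶠ β : ℝ in 𝓝[>] 1, ∀ W ∈ p.mass.support,
        renyiDivergence β W (poissonProcess T (powMean 1 a b w)) ≤ (r : EReal) := by
      rw [Filter.eventually_all_finset]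
      intro W hW
      obtain ⟨f, K, hK, hf, hf0, hfq, rfl, hle⟩ := h.bound W (p.mem hW)
      have hlim := (tendsto_integral_localDiv hK hf hm hf0 h0 hfq hi).mono_left
        (nhdsWithin_mono (1 : ℝ) fun β (hβ : 1 < β) ↦ hβ.ne')
      filter_upwards [hlim.eventually_lt_const (hle.trans_lt hr), self_mem_nhdsWithin] with β hβ hβ1
      rw [renyiDivergence_poissonProcess (one_pos.trans hβ1) hK hf hm hf0 h0 hfq hi]
      exact_mod_cast hβ.le
    obtain ⟨β, hβ, hβ1⟩ := (hev.and self_mem_nhdsWithin).exists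
    have hβ1 : 1 < β := hβ1
    exact (mutualInformation_le_renyiInformation p hβ1 fun W hW ↦ hp W (p.mem hW)).trans
      (renyiInformation_le_of_ne_one p (one_pos.trans hβ1) hβ1.ne' (fun W hW ↦ hp W (p.mem hW)) hβ)
  · exact renyiInformation_le_of_ne_one p hα h1 (fun W hW ↦ hp W (p.mem hW)) fun W hW ↦
      h.renyiDivergence_le hα W (p.mem hW)

theorem IsSaddle.renyiCapacity_eq (h : IsSaddle α T a b w F) (hα : 0 < α) :
    renyiCapacity α F = ((∫ t in Ioc 0 T, infoRate α a b w t : ℝ) : EReal) :=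
  le_antisymm (iSup_le (h.renyiInformation_le hα)) (integral_infoRate_le_renyiCapacity h.shifts
    h.levels hα (h.isProbabilityMeasure hα) (h.absolutelyContinuous hα))

theorem IsSaddle.isRenyiCenter (h : IsSaddle α T a b w F) (hα : 0 < α) :
    IsRenyiCenter α F (poissonProcess T (powMean α a b w)) := by
  have hp := h.isProbabilityMeasure hα
  have hac := h.absolutelyContinuous hα
  have hP := isProbabilityMeasure_poissonProcess T _ (powMean_integrableOn h.levels hα) fun t _ ↦
    powMean_nonneg h.levels hα t
  have hC := h.renyiCapacity_eq hα
  refine ⟨by rw [hC]; exact EReal.coe_lt_top _, hP, ?_, ?_⟩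
  · rw [hC]
    -- A real number strictly between the radius and the integrated rate would bound all
    -- divergences, yet every such bound is at least the integrated rate.
    refine le_antisymm (iSup₂_le (h.renyiDivergence_le hα)) (not_lt.1 fun hlt ↦ ?_)
    obtain ⟨R, hR1, hR2⟩ := EReal.lt_iff_exists_real_btwn.1 hlt
    exact not_lt.2 (integral_infoRate_le_of_renyiDivergence_le h.shifts h.levels hα hp hac
      fun W hW ↦ (le_iSup₂ (f := fun W (_ : W ∈ F) ↦ renyiDivergence α W _) W hW).trans hR1.le)
      (EReal.coe_lt_coe_iff.1 hR2)
  · intro Q hQ hr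
    have hR : ∀ W ∈ F, renyiDivergence α W Q ≤
        ((∫ t in Ioc 0 T, infoRate α a b w t : ℝ) : EReal) := fun W hW ↦
      (le_iSup₂ (f := fun W (_ : W ∈ F) ↦ renyiDivergence α W Q) W hW).trans (hr.trans hC).le
    by_cases h1 : α = 1
    · subst h1
      exact eq_of_renyiDivergence_one_le h.shifts h.levels hp hac hR
    · exact eq_of_renyiDivergence_le_of_ne_one h.shifts h.levels hα h1 hp hac hR

end Saddle

theorem IsRenyiCenter.iff_eq {Ω : Type*} [MeasurableSpace Ω] {α : ℝ} {F : Set (Measure Ω)}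
    {Q₀ : Measure Ω} (h : IsRenyiCenter α F Q₀) (Q : Measure Ω) : IsRenyiCenter α F Q ↔ Q = Q₀ :=
  ⟨fun hQ ↦ h.unique Q hQ.isProbabilityMeasure hQ.radius_eq, fun e ↦ e ▸ h⟩

end RenyiPoisson

namespace RenyiPoisson

open Filter Topology

/-! ### The chord slope between two levels and the center intensity -/

section LevelGap

variable {α A B q : ℝ}

/-- The difference of the divergences of two levels. -/
noncomputable def levelGap (α A B q : ℝ) : ℝ := localDiv α B q - localDiv α A q

theorem levelGap_of_ne_one (h1 : α ≠ 1) :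
    levelGap α A B q = (q ^ (1 - α) * (B ^ α - A ^ α) - α * (B - A)) / (α - 1) := by
  rw [levelGap, localDiv, localDiv, if_neg h1, if_neg h1, ← sub_div]
  ring

theorem mul_log_div (hq : 0 < q) (x : ℝ) :
    x * Real.log (x / q) = x * Real.log x - x * Real.log q := by
  by_cases hx : x = 0
  · simp [hx]
  · rw [Real.log_div hx hq.ne', mul_sub]

theorem levelGap_one (hq : 0 < q) :
    levelGap 1 A B q = B * Real.log B - A * Real.log A - (B - A) * (Real.log q + 1) := by
  rw [levelGap, localDiv, localDiv, if_pos rfl, if_pos rfl, mul_log_div hq, mul_log_div hq]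
  ring

theorem rpow_sub_rpow_pos (hα : 0 < α) (hA : 0 ≤ A) (hAB : A < B) : 0 < B ^ α - A ^ α :=
  sub_pos.2 (Real.rpow_lt_rpow hA hAB hα)

theorem centerIntensity_of_ne_one (hα : 0 < α) (h1 : α ≠ 1) (hA : 0 ≤ A) (hAB : A < B) :
    centerIntensity α A B = (α * (B - A) / (B ^ α - A ^ α)) ^ (1 / (1 - α)) := by
  have h := rpow_sub_rpow_pos hα hA hAB
  have h2 := sub_pos.2 hAB
  rw [centerIntensity, if_neg hAB.ne, if_neg h1, ← Real.mul_rpow hα.le (by positivity),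
    mul_div_assoc]

theorem centerIntensity_pos (hα : 0 < α) (hA : 0 ≤ A) (hAB : A < B) :
    0 < centerIntensity α A B := by
  by_cases h1 : α = 1
  · rw [centerIntensity, if_neg hAB.ne, if_pos h1]
    have hB : 0 < B := hA.trans_lt hAB
    rcases hA.eq_or_lt with h0 | h0
    · rw [← h0]
      simp only [zero_div, neg_zero, Real.rpow_zero]
      positivity
    · positivity
  · rw [centerIntensity_of_ne_one hα h1 hA hAB]
    have h := rpow_sub_rpow_pos hα hA hAB
    have h2 := sub_pos.2 hAB
    positivity

theorem centerIntensity_rpow (hα : 0 < α) (h1 : α ≠ 1) (hA : 0 ≤ A) (hAB : A < B) :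
    centerIntensity α A B ^ (1 - α) * (B ^ α - A ^ α) = α * (B - A) := by
  have h := rpow_sub_rpow_pos hα hA hAB
  have h2 := sub_pos.2 hAB
  rw [centerIntensity_of_ne_one hα h1 hA hAB, ← Real.rpow_mul (by positivity),
    one_div_mul_cancel (sub_ne_zero.2 h1.symm), Real.rpow_one, div_mul_cancel₀ _ h.ne']

theorem log_centerIntensity_one (hA : 0 ≤ A) (hAB : A < B) :
    (B - A) * (Real.log (centerIntensity 1 A B) + 1) = B * Real.log B - A * Real.log A := by
  have hB : 0 < B := hA.trans_lt hAB
  have h2 := (sub_pos.2 hAB).ne'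
  rw [centerIntensity, if_neg hAB.ne, if_pos rfl]
  rcases hA.eq_or_lt with h0 | h0
  · rw [← h0]
    simp only [zero_div, neg_zero, Real.rpow_zero, sub_zero, div_self hB.ne', Real.rpow_one]
    rw [mul_one, Real.log_mul (Real.exp_pos _).ne' hB.ne', Real.log_exp]
    ring
  · rw [Real.log_mul (by positivity) (by positivity), Real.log_mul (by positivity) (by positivity),
      Real.log_exp, Real.log_rpow hB, Real.log_rpow h0]
    field_simp
    ring

/-- In this form `centerIntensity` is visibly a zero of the gap, and the gap is strictly decreasing
in `q > 0`, since `q^(1-α) / (α - 1)` is. -/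
theorem levelGap_eq_of_ne_one (hα : 0 < α) (h1 : α ≠ 1) (hA : 0 ≤ A) (hAB : A < B) :
    levelGap α A B q =
      (B ^ α - A ^ α) * ((q ^ (1 - α) - centerIntensity α A B ^ (1 - α)) / (α - 1)) := by
  rw [levelGap_of_ne_one h1, ← centerIntensity_rpow hα h1 hA hAB]
  ring

theorem levelGap_eq_one (hA : 0 ≤ A) (hAB : A < B) (hq : 0 < q) :
    levelGap 1 A B q = (B - A) * (Real.log (centerIntensity 1 A B) - Real.log q) := by
  rw [levelGap_one hq, ← log_centerIntensity_one hA hAB]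
  ring

theorem levelGap_centerIntensity (hα : 0 < α) (hA : 0 ≤ A) (hAB : A < B) :
    levelGap α A B (centerIntensity α A B) = 0 := by
  by_cases h1 : α = 1
  · subst h1
    rw [levelGap_eq_one hA hAB (centerIntensity_pos hα hA hAB), sub_self, mul_zero]
  · rw [levelGap_eq_of_ne_one hα h1 hA hAB, sub_self, zero_div, mul_zero]

theorem levelGap_neg (hα : 0 < α) (hA : 0 ≤ A) (hAB : A < B) (h : centerIntensity α A B < q) :
    levelGap α A B q < 0 := by
  have hp := centerIntensity_pos hα hA hAB
  have hd := rpow_sub_rpow_pos hα hA hAB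
  rcases lt_trichotomy α 1 with h1 | h1 | h1
  · rw [levelGap_eq_of_ne_one hα h1.ne hA hAB]
    exact mul_neg_of_pos_of_neg hd (div_neg_of_pos_of_neg
      (sub_pos.2 (Real.rpow_lt_rpow hp.le h (by linarith))) (by linarith))
  · subst h1
    rw [levelGap_eq_one hA hAB (hp.trans h)]
    exact mul_neg_of_pos_of_neg (sub_pos.2 hAB) (sub_neg.2 (Real.log_lt_log hp h))
  · rw [levelGap_eq_of_ne_one hα h1.ne' hA hAB]
    exact mul_neg_of_pos_of_neg hd (div_neg_of_neg_of_pos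
      (sub_neg.2 (Real.rpow_lt_rpow_of_neg hp h (by linarith))) (by linarith))

theorem levelGap_pos (hα : 0 < α) (hA : 0 ≤ A) (hAB : A < B) (hq : 0 < q)
    (h : q < centerIntensity α A B) : 0 < levelGap α A B q := by
  have hd := rpow_sub_rpow_pos hα hA hAB
  rcases lt_trichotomy α 1 with h1 | h1 | h1
  · rw [levelGap_eq_of_ne_one hα h1.ne hA hAB]
    exact mul_pos hd (div_pos_of_neg_of_neg
      (sub_neg.2 (Real.rpow_lt_rpow hq.le h (by linarith))) (by linarith))
  · subst h1
    rw [levelGap_eq_one hA hAB hq]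
    exact mul_pos (sub_pos.2 hAB) (sub_pos.2 (Real.log_lt_log hq h))
  · rw [levelGap_eq_of_ne_one hα h1.ne' hA hAB]
    exact mul_pos hd (div_pos
      (sub_pos.2 (Real.rpow_lt_rpow_of_neg hq h (by linarith))) (by linarith))

theorem le_centerIntensity (hα : 0 < α) (hA : 0 ≤ A) (hAB : A < B)
    (h : 0 ≤ levelGap α A B q) : q ≤ centerIntensity α A B :=
  not_lt.1 fun hlt ↦ h.not_gt (levelGap_neg hα hA hAB hlt)

theorem centerIntensity_le (hα : 0 < α) (hA : 0 ≤ A) (hAB : A < B) (hq : 0 < q)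
    (h : levelGap α A B q ≤ 0) : centerIntensity α A B ≤ q :=
  not_lt.1 fun hlt ↦ h.not_gt (levelGap_pos hα hA hAB hq hlt)

theorem localDiv_self (hα : 0 < α) (hA : 0 ≤ A) : localDiv α A A = 0 := by
  rcases hA.eq_or_lt with h0 | h0
  · rw [← h0, localDiv_zero_zero hα]
  · unfold localDiv
    split_ifs with h
    · rw [div_self h0.ne', Real.log_one]; ring
    · rw [← Real.rpow_add h0, add_sub_cancel, Real.rpow_one]; ring

theorem localDiv_nonneg {x : ℝ} (hα : 0 < α) (hx : 0 ≤ x) (hq : 0 < q) : 0 ≤ localDiv α x q := by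
  rw [localDiv_eq hα hx hq.le fun h ↦ absurd h hq.ne']
  exact mul_nonneg hq.le (entropyFun_nonneg hα (by positivity))

/-- At `q = A` the gap is the divergence of `B` from `A`, at `q = B` it is minus that of `A` from
`B`. Monotonicity places the zero between them. -/
theorem centerIntensity_mem (hα : 0 < α) (hA : 0 ≤ A) (hAB : A < B) :
    centerIntensity α A B ∈ Icc A B := by
  have hB : 0 < B := hA.trans_lt hAB
  constructor
  · rcases hA.eq_or_lt with h0 | h0
    · exact h0.symm.le.trans (centerIntensity_pos hα hA hAB).le
    · refine le_centerIntensity hα hA hAB ?_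
      rw [levelGap, localDiv_self hα hA, sub_zero]
      exact localDiv_nonneg hα hB.le h0
  · refine centerIntensity_le hα hA hAB hB ?_
    rw [levelGap, localDiv_self hα hB.le, zero_sub, neg_nonpos]
    exact localDiv_nonneg hα hA hB

/-- The intensity of the center is comparable to the upper level. -/
theorem exists_mul_le_centerIntensity (hα : 0 < α) : ∃ k : ℝ, 0 < k ∧
    ∀ A B : ℝ, 0 ≤ A → A < B → k * B ≤ centerIntensity α A B := by
  by_cases h1 : α = 1
  · subst h1
    -- The constant is the ratio of the center intensity to `B` in the extreme case `A = 0`; the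
    -- same holds for `α^(1/(1-α))` in the other case.
    refine ⟨Real.exp (-1), Real.exp_pos _, fun A B hA hAB ↦ le_centerIntensity hα hA hAB ?_⟩
    have hB : 0 < B := hA.trans_lt hAB
    rw [levelGap_one (by positivity), Real.log_mul (Real.exp_pos _).ne' hB.ne', Real.log_exp]
    rcases hA.eq_or_lt with h0 | h0
    · rw [← h0]; simp
    · have := mul_le_mul_of_nonneg_left (Real.log_le_log h0 hAB.le) hA
      nlinarith
  · refine ⟨α ^ (1 / (1 - α)), by positivity, fun A B hA hAB ↦ le_centerIntensity hα hA hAB ?_⟩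
    have hB : 0 < B := hA.trans_lt hAB
    have e1 : (α ^ (1 / (1 - α)) * B) ^ (1 - α) = α * B ^ (1 - α) := by
      rw [Real.mul_rpow (by positivity) hB.le, ← Real.rpow_mul hα.le,
        one_div_mul_cancel (sub_ne_zero.2 (Ne.symm h1)), Real.rpow_one]
    have e2 : B ^ (1 - α) * B ^ α = B := by
      rw [← Real.rpow_add hB, sub_add_cancel, Real.rpow_one]
    have e3 : levelGap α A B (α ^ (1 / (1 - α)) * B) =
        α * ((A - A ^ α * B ^ (1 - α)) / (α - 1)) := by
      rw [levelGap_of_ne_one h1, e1]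
      linear_combination (α / (α - 1)) * e2
    rw [e3]
    refine mul_nonneg hα.le ?_
    rcases hA.eq_or_lt with h0 | h0
    · rw [← h0, Real.zero_rpow hα.ne']; simp
    have e4 : A ^ α * A ^ (1 - α) = A := by
      rw [← Real.rpow_add h0, add_sub_cancel, Real.rpow_one]
    rcases lt_or_gt_of_ne h1 with hlt | hgt
    · have := mul_le_mul_of_nonneg_left (Real.rpow_le_rpow hA hAB.le (by linarith : 0 ≤ 1 - α))
        (Real.rpow_nonneg hA α)
      exact div_nonneg_of_nonpos (by linarith) (by linarith)
    · have := mul_le_mul_of_nonneg_left (Real.rpow_le_rpow_of_nonpos h0 hAB.le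
        (by linarith : 1 - α ≤ 0)) (Real.rpow_nonneg hA α)
      exact div_nonneg (by linarith) (by linarith)

theorem convexOn_localDiv (hα : 0 < α) (hq : 0 < q) :
    ConvexOn ℝ (Ici 0) fun x ↦ localDiv α x q := by
  rcases lt_trichotomy α 1 with h1 | h1 | h1
  · have h := ((Real.concaveOn_rpow hα.le h1.le).neg.smul
      (show 0 ≤ q ^ (1 - α) / (1 - α) from div_nonneg (by positivity) (by linarith))).add
      ((LinearMap.convexOn (LinearMap.lsmul ℝ ℝ (-(α / (α - 1)))) (convex_Ici 0)).add_const q)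
    refine h.congr fun x _ ↦ ?_
    have h2 : α - 1 ≠ 0 := by linarith
    have h3 : 1 - α ≠ 0 := by linarith
    rw [localDiv, if_neg h1.ne]
    simp only [Pi.add_apply, Pi.neg_apply, smul_eq_mul, LinearMap.lsmul_apply]
    field_simp
    ring
  · subst h1
    have h := Real.convexOn_mul_log.add
      ((LinearMap.convexOn (LinearMap.lsmul ℝ ℝ (-(Real.log q + 1))) (convex_Ici 0)).add_const q)
    refine h.congr fun x _ ↦ ?_
    rw [localDiv, if_pos rfl, mul_log_div hq]
    simp only [Pi.add_apply, smul_eq_mul, LinearMap.lsmul_apply]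
    ring
  · have h := ((convexOn_rpow h1.le).smul
      (show 0 ≤ q ^ (1 - α) / (α - 1) from div_nonneg (by positivity) (by linarith))).add
      ((LinearMap.convexOn (LinearMap.lsmul ℝ ℝ (-(α / (α - 1)))) (convex_Ici 0)).add_const q)
    refine h.congr fun x _ ↦ ?_
    have h2 : α - 1 ≠ 0 := by linarith
    rw [localDiv, if_neg h1.ne']
    simp only [Pi.add_apply, smul_eq_mul, LinearMap.lsmul_apply]
    field_simp
    ring

/-- The divergence of a level is below the chord. -/
theorem localDiv_le_chord {x : ℝ} (hα : 0 < α) (hA : 0 ≤ A) (hAB : A < B) (hx : x ∈ Icc A B)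
    (hq : 0 < q) : localDiv α x q ≤ localDiv α A q + (x - A) / (B - A) * levelGap α A B q := by
  have h2 := sub_pos.2 hAB
  have ha : 0 ≤ (x - A) / (B - A) := div_nonneg (by linarith [hx.1]) h2.le
  have hb : 0 ≤ (B - x) / (B - A) := div_nonneg (by linarith [hx.2]) h2.le
  have := (convexOn_localDiv hα hq).2 (mem_Ici.2 (hA.trans hAB.le)) (mem_Ici.2 hA) ha hb
    (by field_simp; ring)
  simp only [smul_eq_mul] at this
  have e : (x - A) / (B - A) * B + (B - x) / (B - A) * A = x := by field_simp; ring
  rw [e] at this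
  refine this.trans_eq ?_
  rw [levelGap]
  field_simp
  ring

end LevelGap

/-! ### The optimal mean and the explicit capacity formulas -/

section OptimalMean

variable {α A B c : ℝ}

theorem weight_mem (hc : c ∈ Icc A B) : (c - A) / (B - A) ∈ Icc (0 : ℝ) 1 :=
  ⟨div_nonneg (by linarith [hc.1]) (by linarith [hc.1, hc.2]),
    div_le_one_of_le₀ (by linarith [hc.2]) (by linarith [hc.1, hc.2])⟩

theorem weight_mul_add (hc : c ∈ Icc A B) :
    (c - A) / (B - A) * B + (1 - (c - A) / (B - A)) * A = c := by
  rcases (hc.1.trans hc.2).eq_or_lt with h | h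
  · rw [← h, sub_self, div_zero]
    linarith [hc.1, hc.2]
  · have := (sub_pos.2 h).ne'
    field_simp
    ring

theorem one_sub_weight (hAB : A < B) : 1 - (c - A) / (B - A) = (B - c) / (B - A) := by
  have := (sub_pos.2 hAB).ne'
  field_simp
  ring

theorem meanIntensity_eq (hα : 0 < α) (hA : 0 ≤ A) (hc : c ∈ Icc A B) :
    meanIntensity α A B c =
      ((c - A) / (B - A) * B ^ α + (1 - (c - A) / (B - A)) * A ^ α) ^ (1 / α) := by
  rw [meanIntensity]
  rcases (hc.1.trans hc.2).eq_or_lt with h | h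
  · rw [if_pos h, ← h, sub_self, div_zero, zero_mul, zero_add, sub_zero, one_mul,
      ← Real.rpow_mul hA, mul_one_div_cancel hα.ne', Real.rpow_one]
  · rw [if_neg h.ne, one_sub_weight h]

theorem optimalMean_of_ne_one (hα : 0 < α) (h1 : α ≠ 1) (hAB : A < B) :
    optimalMean α A B = centerIntensity α A B / α +
      (A * B ^ α - B * A ^ α) / (B ^ α - A ^ α) := by
  have hα1 : 1 - α ≠ 0 := sub_ne_zero.2 (Ne.symm h1)
  rw [optimalMean, centerIntensity, if_neg hAB.ne, if_neg h1, if_neg hAB.ne, if_neg h1,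
    show α / (1 - α) = 1 / (1 - α) - 1 by field_simp; ring, Real.rpow_sub hα, Real.rpow_one]
  ring

/-- This form shows that `optimalMean` is the mean whose weight makes the power mean of the two
levels equal to `centerIntensity`, that is, which makes the chord flat. -/
theorem optimalMean_eq (hα : 0 < α) (hA : 0 ≤ A) (hAB : A < B) : optimalMean α A B =
    A + (centerIntensity α A B ^ α - A ^ α) * (B - A) / (B ^ α - A ^ α) := by
  have hp := centerIntensity_pos hα hA hAB
  have h2 := (sub_pos.2 hAB).ne'
  by_cases h1 : α = 1
  · subst h1
    simp only [Real.rpow_one]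
    rw [mul_div_cancel_right₀ _ h2, add_sub_cancel, optimalMean, centerIntensity]
    simp
  · have hd := (rpow_sub_rpow_pos hα hA hAB).ne'
    have hα1 : 1 - α ≠ 0 := sub_ne_zero.2 (Ne.symm h1)
    have e2 := centerIntensity_rpow hα h1 hA hAB
    have e3 : centerIntensity α A B ^ α * centerIntensity α A B ^ (1 - α) =
        centerIntensity α A B := by
      rw [← Real.rpow_add hp, add_sub_cancel, Real.rpow_one]
    rw [optimalMean_of_ne_one hα h1 hAB]
    have e4 : centerIntensity α A B ^ α * (B - A) / (B ^ α - A ^ α) = centerIntensity α A B / α := by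
      rw [div_eq_div_iff hd hα.ne']
      linear_combination (-centerIntensity α A B ^ α) * e2 + (B ^ α - A ^ α) * e3
    rw [← e4]
    field_simp
    ring

theorem weight_optimalMean (hα : 0 < α) (hA : 0 ≤ A) (hAB : A < B) :
    (optimalMean α A B - A) / (B - A) =
      (centerIntensity α A B ^ α - A ^ α) / (B ^ α - A ^ α) := by
  have h2 := (sub_pos.2 hAB).ne'
  rw [optimalMean_eq hα hA hAB]
  field_simp
  ring

theorem optimalMean_mem (hα : 0 < α) (hA : 0 ≤ A) (hAB : A ≤ B) :
    optimalMean α A B ∈ Icc A B := by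
  rcases hAB.eq_or_lt with h | h
  · rw [optimalMean, if_pos h]
    exact ⟨le_rfl, h.le⟩
  have hd := rpow_sub_rpow_pos hα hA h
  have h2 := sub_pos.2 h
  have hp := centerIntensity_mem hα hA h
  have h3 := Real.rpow_le_rpow hA hp.1 hα.le
  have h4 := Real.rpow_le_rpow (hA.trans hp.1) hp.2 hα.le
  rw [optimalMean_eq hα hA h]
  constructor
  · have := div_nonneg (mul_nonneg (sub_nonneg.2 h3) h2.le) hd.le
    linarith
  · have : (centerIntensity α A B ^ α - A ^ α) * (B - A) / (B ^ α - A ^ α) ≤ B - A := by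
      rw [div_le_iff₀ hd, mul_comm]
      gcongr
    linarith

theorem meanIntensity_optimalMean (hα : 0 < α) (hA : 0 ≤ A) (hAB : A ≤ B) :
    meanIntensity α A B (optimalMean α A B) = centerIntensity α A B := by
  rcases hAB.eq_or_lt with h | h
  · rw [meanIntensity, centerIntensity, if_pos h, if_pos h]
  have hd := (rpow_sub_rpow_pos hα hA h).ne'
  rw [meanIntensity_eq hα hA (optimalMean_mem hα hA hAB), weight_optimalMean hα hA h]
  have e : (centerIntensity α A B ^ α - A ^ α) / (B ^ α - A ^ α) * B ^ α +
      (1 - (centerIntensity α A B ^ α - A ^ α) / (B ^ α - A ^ α)) * A ^ α =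
      centerIntensity α A B ^ α := by
    field_simp
    ring
  rw [e, ← Real.rpow_mul (centerIntensity_pos hα hA h).le, mul_one_div_cancel hα.ne', Real.rpow_one]

theorem meanIntensity_mono (hα : 0 < α) (hA : 0 ≤ A) {c' : ℝ} (hc : c ∈ Icc A B)
    (hc' : c' ∈ Icc A B) (h : c ≤ c') : meanIntensity α A B c ≤ meanIntensity α A B c' := by
  have hAB := hc.1.trans hc.2
  have hp := Real.rpow_le_rpow hA hAB hα.le
  have h0 := Real.rpow_nonneg hA α
  have h1 := Real.rpow_nonneg (hA.trans hAB) α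
  have hw := weight_mem hc
  have hle : (c - A) / (B - A) ≤ (c' - A) / (B - A) :=
    div_le_div_of_nonneg_right (by linarith) (by linarith)
  rw [meanIntensity_eq hα hA hc, meanIntensity_eq hα hA hc']
  refine Real.rpow_le_rpow (add_nonneg (mul_nonneg hw.1 h1) (mul_nonneg (by linarith [hw.2]) h0))
    ?_ (by positivity)
  nlinarith

theorem capacityRate_eq (hα : 0 < α) (hA : 0 ≤ A) (hAB : A ≤ B) :
    capacityRate α A B = meanCapacityRate α A B (optimalMean α A B) := by
  rcases hAB.eq_or_lt with h | h
  · rw [capacityRate, meanCapacityRate, if_pos h, if_pos h]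
  have h2 := (sub_pos.2 h).ne'
  have hp := centerIntensity_pos hα hA h
  by_cases h1 : α = 1
  · subst h1
    have hc : optimalMean 1 A B = centerIntensity 1 A B := by
      simp [optimalMean, centerIntensity]
    have hB : 0 < B := hA.trans_lt h
    have e := log_centerIntensity_one hA h
    rw [capacityRate, meanCapacityRate, if_neg h.ne, if_neg h.ne, if_pos rfl, if_pos rfl, hc,
      mul_assoc _ B, mul_assoc _ A, mul_log_div hp, mul_log_div hp]
    have e2 : Real.exp (-1) * B ^ (B / (B - A)) * A ^ (-(A / (B - A))) = centerIntensity 1 A B := by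
      rw [centerIntensity, if_neg h.ne, if_pos rfl]
    rw [e2]
    have e3 : A * B / (B - A) * Real.log (B / A) =
        B / (B - A) * (A * Real.log B - A * Real.log A) := by
      by_cases hA0 : A = 0
      · simp [hA0]
      · rw [Real.log_div hB.ne' hA0]; ring
    rw [e3]
    generalize centerIntensity 1 A B = p at *
    generalize Real.log p = l at *
    field_simp
    linear_combination (p - A) * e + A * e
  · have hd := (rpow_sub_rpow_pos hα hA h).ne'
    have hα1 : 1 - α ≠ 0 := sub_ne_zero.2 (Ne.symm h1)
    have hα2 : α - 1 ≠ 0 := sub_ne_zero.2 h1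
    rw [meanCapacityRate, if_neg h.ne, if_neg h1, meanIntensity_optimalMean hα hA hAB, capacityRate,
      if_neg h.ne, if_neg h1, ← centerIntensity_of_ne_one hα h1 hA h,
      optimalMean_of_ne_one hα h1 h]
    field_simp
    ring

end OptimalMean
end RenyiPoisson

namespace RenyiPoisson

open Filter Topology

/-! ### From means to weights, and measurable versions -/

section Weights

variable {T : ℝ} {a b c : ℝ → ℝ} {α : ℝ}

theorem admissibleLevels_weight (ha : Measurable a) (hb : Measurable b) (hc : Measurable c)
    (h0 : ∀ t, 0 ≤ a t) (hm : ∀ t, c t ∈ Icc (a t) (b t)) (hi : IntegrableOn b (Ioc 0 T)) :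
    AdmissibleLevels T a b fun t ↦ (c t - a t) / (b t - a t) where
  measurable_a := ha
  measurable_b := hb
  measurable_w := by fun_prop
  nonneg := h0
  le t := (hm t).1.trans (hm t).2
  w_nonneg t := (weight_mem (hm t)).1
  w_le_one t := (weight_mem (hm t)).2
  integrableOn := hi

theorem powMean_weight (hα : 0 < α) (h0 : ∀ t, 0 ≤ a t) (hm : ∀ t, c t ∈ Icc (a t) (b t)) :
    powMean α a b (fun t ↦ (c t - a t) / (b t - a t)) =
      fun t ↦ meanIntensity α (a t) (b t) (c t) :=
  funext fun t ↦ (meanIntensity_eq hα (h0 t) (hm t)).symm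

theorem infoRate_weight (hα : 0 < α) (hm : ∀ t, c t ∈ Icc (a t) (b t))
    (h : AdmissibleLevels T a b fun t ↦ (c t - a t) / (b t - a t)) :
    infoRate α a b (fun t ↦ (c t - a t) / (b t - a t)) =
      fun t ↦ meanCapacityRate α (a t) (b t) (c t) := by
  funext t
  rcases (h.le t).eq_or_lt with he | hl
  · have hp : powMean α a b (fun t ↦ (c t - a t) / (b t - a t)) t = a t := by
      rw [powMean_weight hα h.nonneg hm]
      exact if_pos he
    rw [meanCapacityRate, if_pos he, infoRate, hp, ← he, localDiv_self hα (h.nonneg t)]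
    ring
  · rw [meanCapacityRate, if_neg hl.ne]
    by_cases h1 : α = 1
    · subst h1
      rw [if_pos rfl, infoRate_one, meanLevel, weight_mul_add (hm t), one_sub_weight hl]
      ring
    · rw [if_neg h1, infoRate_of_ne_one h hα h1, powMean_weight hα h.nonneg hm, meanLevel,
        weight_mul_add (hm t)]

theorem infoRate_eq_levelGap (w : ℝ → ℝ) (t : ℝ) : infoRate α a b w t =
    localDiv α (a t) (powMean α a b w t) + w t * levelGap α (a t) (b t) (powMean α a b w t) := by
  rw [infoRate, levelGap]
  ring

/-- An intensity has a measurable version between the given levels. -/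
theorem exists_measurable_version {f : ℝ → ℝ} (ha : Measurable a) (hb : Measurable b)
    (hab : ∀ t, a t ≤ b t) (hf : IntegrableOn f (Ioc 0 T))
    (h : ∀ᵐ t ∂volume.restrict (Ioc 0 T), f t ∈ Icc (a t) (b t)) :
    ∃ f' : ℝ → ℝ, Measurable f' ∧ (∀ t, f' t ∈ Icc (a t) (b t)) ∧
      f =ᵐ[volume.restrict (Ioc 0 T)] f' := by
  have hm := hf.1.aemeasurable
  refine ⟨fun t ↦ max (a t) (min (b t) (hm.mk f t)), ?_, fun t ↦ ⟨le_max_left _ _,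
    max_le (hab t) (min_le_left _ _)⟩, ?_⟩
  · have := hm.measurable_mk
    fun_prop
  · filter_upwards [hm.ae_eq_mk, h] with t ht hab'
    rw [← ht, min_eq_right hab'.2, max_eq_right hab'.1]

theorem constantLevels {A B c : ℝ} (hA : 0 ≤ A) (hc : c ∈ Icc A B) :
    AdmissibleLevels T (fun _ ↦ A) (fun _ ↦ B) fun _ ↦ (c - A) / (B - A) :=
  admissibleLevels_weight (c := fun _ ↦ c) measurable_const measurable_const measurable_const
    (fun _ ↦ hA) (fun _ ↦ hc) (by simp)

end Weights

/-! ### Families between two constants -/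

section ConstantLevels

variable {T : ℝ} [hT : Fact (0 < T)] {α A B c : ℝ} {F : Set (Measure (SamplePath T))}

theorem meanIntensity_mem (hα : 0 < α) (hA : 0 ≤ A) (hc : c ∈ Icc A B) :
    meanIntensity α A B c ∈ Icc A B := by
  have hAA : A ∈ Icc A B := ⟨le_rfl, hc.1.trans hc.2⟩
  have hBB : B ∈ Icc A B := ⟨hc.1.trans hc.2, le_rfl⟩
  have hB : 0 ≤ B := hA.trans hAA.2
  have e : ∀ x : ℝ, 0 ≤ x → (x ^ α) ^ (1 / α) = x := fun x hx ↦ by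
    rw [← Real.rpow_mul hx, mul_one_div_cancel hα.ne', Real.rpow_one]
  have e1 : meanIntensity α A B A = A := by
    rw [meanIntensity_eq hα hA hAA, sub_self, zero_div, zero_mul, zero_add, sub_zero, one_mul,
      e A hA]
  have e2 : meanIntensity α A B B = B := by
    rcases hAA.2.eq_or_lt with h | h
    · rw [meanIntensity, if_pos h, h]
    · rw [meanIntensity_eq hα hA hBB, div_self (sub_pos.2 h).ne', one_mul, sub_self, zero_mul,
        add_zero, e B hB]
  have h1 := meanIntensity_mono hα hA hAA hc hc.1
  have h2 := meanIntensity_mono hα hA hc hBB hc.2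
  rw [e1] at h1
  rw [e2] at h2
  exact ⟨h1, h2⟩

/-- The only way for the center to be the empty process when `A < B`. In that case intensities
cannot be dominated by a multiple of the center unless they vanish almost everywhere. -/
theorem eq_zero_of_meanIntensity (hα : 0 < α) (hA : 0 ≤ A) (hAB : A < B) (hc : c ∈ Icc A B)
    (h : meanIntensity α A B c ≤ 0) : A = 0 ∧ c = 0 := by
  have hm := meanIntensity_mem hα hA hc
  have hA0 : A = 0 := le_antisymm (hm.1.trans h) hA
  have hz : meanIntensity α A B c = 0 := le_antisymm h (hA.trans hm.1)
  refine ⟨hA0, ?_⟩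
  have hw := weight_mem hc
  subst hA0
  rw [meanIntensity_eq hα le_rfl hc, Real.zero_rpow hα.ne', mul_zero, add_zero,
    Real.rpow_eq_zero (mul_nonneg hw.1 (Real.rpow_nonneg hAB.le _)) (by positivity)] at hz
  have hB := Real.rpow_pos_of_pos hAB α
  have := (mul_eq_zero.1 hz).resolve_right hB.ne'
  rw [sub_zero, sub_zero, div_eq_zero_iff] at this
  exact this.resolve_right hAB.ne'

theorem optimalMean_pos (hα : 0 < α) (hA : 0 ≤ A) (hAB : A < B) : 0 < optimalMean α A B := by
  by_contra hle
  have hm := optimalMean_mem hα hA hAB.le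
  have hA0 : A = 0 := le_antisymm (hm.1.trans (not_lt.1 hle)) hA
  have hc : optimalMean α A B = 0 := le_antisymm (not_lt.1 hle) (hA.trans hm.1)
  have hp := centerIntensity_pos hα hA hAB
  rw [← meanIntensity_optimalMean hα hA hAB.le, meanIntensity_eq hα hA hm, hc, hA0,
    Real.zero_rpow hα.ne'] at hp
  simp [hα.ne'] at hp

/-- Integrating the chord bound, the divergence of `P_f` from the center exceeds the rate by at most
`levelGap * (∫ f - T c) / (B - A)`. So one sign condition covers equality, one-sided and absent mean
constraints; the other condition on `∫ f` handles the empty center. -/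
theorem isSaddle_const (hα : 0 < α) (hA : 0 ≤ A) (hc : c ∈ Icc A B)
    (hsub : familyEq T A B c ⊆ F)
    (hF : ∀ W ∈ F, ∃ f, IsIntensity T A B f ∧ W = poissonProcess T f ∧
      (A < B → A = 0 → c = 0 → ∫ t in Ioc 0 T, f t ≤ 0) ∧
      (A < B → 0 < meanIntensity α A B c →
        levelGap α A B (meanIntensity α A B c) * ((∫ t in Ioc 0 T, f t) - T * c) ≤ 0)) :
    IsSaddle α T (fun _ ↦ A) (fun _ ↦ B) (fun _ ↦ (c - A) / (B - A)) F := by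
  have hL := constantLevels (T := T) hA hc
  have hAB : A ≤ B := hc.1.trans hc.2
  have hq : ∀ t, powMean α (fun _ ↦ A) (fun _ ↦ B) (fun _ ↦ (c - A) / (B - A)) t =
      meanIntensity α A B c := fun t ↦ (meanIntensity_eq hα hA hc).symm
  refine ⟨hL, fun N u ↦ hsub ⟨_, ⟨shiftIntensity_integrableOn hL.measurable_a hL.measurable_b
    hL.measurable_w hL.nonneg hL.le hL.integrableOn u, fun t _ ↦ shiftIntensity_mem hL.le u t⟩, ?_,
    rfl⟩, fun W hW ↦ ?_⟩
  -- The mean constraint must hold exactly for every shift, not just on average; the cyclic form of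
  -- the shifts guarantees this.
  · rw [integral_shiftIntensity_const hT.out N (weight_mem hc).1 (weight_mem hc).2,
      weight_mul_add hc]
  obtain ⟨f, hf, rfl, hz, hg⟩ := hF W hW
  obtain ⟨f', hfm, hfb, hff⟩ := exists_measurable_version (T := T) measurable_const
    measurable_const (fun _ ↦ hAB) hf.1
    ((ae_restrict_iff' measurableSet_Ioc).2 (Eventually.of_forall hf.2))
  have hf0 : ∀ t, 0 ≤ f' t := fun t ↦ hA.trans (hfb t).1
  have hi' : IntegrableOn f' (Ioc 0 T) := hf.1.congr hff
  have hrate : 0 ≤ ∫ t in Ioc 0 T, infoRate α (fun _ ↦ A) (fun _ ↦ B)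
      (fun _ ↦ (c - A) / (B - A)) t := integral_nonneg fun t ↦ infoRate_nonneg hL hα t
  simp_rw [hq]
  rcases hAB.eq_or_lt with he | hl
  · have hA' : ∀ t, f' t = A := fun t ↦ le_antisymm ((hfb t).2.trans he.ge) (hfb t).1
    refine ⟨f', 1, zero_le_one, hfm, hf0, fun t ↦ ?_, poissonProcess_congr hff, ?_⟩
    · rw [meanIntensity, if_pos he, hA', one_mul]
    · refine le_trans (le_of_eq ?_) hrate
      simp_rw [hA', meanIntensity, if_pos he, localDiv_self hα hA, integral_zero]
  rcases lt_or_ge 0 (meanIntensity α A B c) with hp | hp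
  · have hdiff := sub_pos.2 hl
    refine ⟨f', B / meanIntensity α A B c, div_nonneg (hA.trans hAB) hp.le, hfm, hf0, fun t ↦ ?_,
      poissonProcess_congr hff, ?_⟩
    · rw [div_mul_cancel₀ _ hp.ne']
      exact (hfb t).2
    · have hint : IntegrableOn (fun t ↦ (f' t - A) / (B - A) *
          levelGap α A B (meanIntensity α A B c)) (Ioc 0 T) :=
        ((hi'.sub (by simp)).div_const _).mul_const _
      calc ∫ t in Ioc 0 T, localDiv α (f' t) (meanIntensity α A B c)
          ≤ ∫ t in Ioc 0 T, (localDiv α A (meanIntensity α A B c) +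
              (f' t - A) / (B - A) * levelGap α A B (meanIntensity α A B c)) := by
            refine integral_mono_of_nonneg (Eventually.of_forall fun t ↦
              localDiv_nonneg hα (hf0 t) hp) (Integrable.add (by simp) hint)
              (Eventually.of_forall fun t ↦ localDiv_le_chord hα hA hl (hfb t) hp)
        _ ≤ _ := by
            rw [integral_add (by simp) hint, integral_mul_const, integral_div,
              integral_sub hi' (by simp), ← integral_congr_ae hff]
            simp_rw [infoRate_eq_levelGap, hq]
            have hg' := hg hl hp
            have hT' := hT.out.le
            simp only [integral_const, measureReal_restrict_apply_univ, Real.volume_real_Ioc,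
              sub_zero, max_eq_left hT', smul_eq_mul]
            generalize levelGap α A B (meanIntensity α A B c) = G at hg' ⊢
            have e : ((∫ t in Ioc 0 T, f t) - T * A) / (B - A) * G =
                G * ((∫ t in Ioc 0 T, f t) - T * c) / (B - A) + T * ((c - A) / (B - A) * G) := by
              field_simp
              ring
            rw [e]
            have := div_nonpos_of_nonpos_of_nonneg hg' hdiff.le
            linarith
  · obtain ⟨hA0, hc0⟩ := eq_zero_of_meanIntensity hα hA hl hc hp
    have hq0 : meanIntensity α A B c = 0 := le_antisymm hp (hA.trans (meanIntensity_mem hα hA hc).1)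
    have hint : ∫ t in Ioc 0 T, f' t = 0 := by
      rw [← integral_congr_ae hff]
      refine le_antisymm (hz hl hA0 hc0) (setIntegral_nonneg measurableSet_Ioc fun t ht ↦ ?_)
      exact hA.trans (hf.2 t ht).1
    rw [integral_eq_zero_iff_of_nonneg hf0 hi'] at hint
    -- The intensity vanishes almost everywhere, so its law is that of the zero intensity, for which
    -- domination by the zero center is trivial.
    refine ⟨fun _ ↦ 0, 0, le_rfl, measurable_const, fun _ ↦ le_rfl, fun t ↦ by simp,
      poissonProcess_congr (hff.trans hint), ?_⟩
    rw [hq0]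
    simpa [localDiv_zero_zero hα] using hrate

theorem integral_infoRate_const (hα : 0 < α) (hA : 0 ≤ A) (hc : c ∈ Icc A B) :
    ∫ t in Ioc 0 T, infoRate α (fun _ ↦ A) (fun _ ↦ B) (fun _ ↦ (c - A) / (B - A)) t =
      meanCapacityRate α A B c * T := by
  rw [infoRate_weight (T := T) (c := fun _ ↦ c) hα (fun _ ↦ hc) (constantLevels hA hc)]
  simp [hT.out.le, mul_comm]

theorem capacity_and_center_of_isSaddle (hα : 0 < α) (hA : 0 ≤ A) (hc : c ∈ Icc A B)
    (h : IsSaddle α T (fun _ ↦ A) (fun _ ↦ B) (fun _ ↦ (c - A) / (B - A)) F) :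
    renyiCapacity α F = ((meanCapacityRate α A B c * T : ℝ) : EReal) ∧
      IsRenyiCenter α F (poissonProcess T fun _ ↦ meanIntensity α A B c) := by
  refine ⟨by rw [h.renyiCapacity_eq hα, integral_infoRate_const hα hA hc], ?_⟩
  have := h.isRenyiCenter hα
  rwa [powMean_weight (c := fun _ ↦ c) hα (fun _ ↦ hA) fun _ ↦ hc] at this

theorem capacity_and_center_familyEq (hα : 0 < α) (hA : 0 ≤ A) (hc : c ∈ Icc A B) :
    renyiCapacity α (familyEq T A B c) = ((meanCapacityRate α A B c * T : ℝ) : EReal) ∧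
      IsRenyiCenter α (familyEq T A B c) (poissonProcess T fun _ ↦ meanIntensity α A B c) := by
  refine capacity_and_center_of_isSaddle hα hA hc (isSaddle_const hα hA hc subset_rfl ?_)
  rintro W ⟨f, hf, he, rfl⟩
  refine ⟨f, hf, rfl, fun _ _ h0 ↦ ?_, fun _ _ ↦ ?_⟩
  · rw [he, h0, mul_zero]
  · rw [he, sub_self, mul_zero]

theorem levelGap_optimalMean (hα : 0 < α) (hA : 0 ≤ A) (hAB : A < B) :
    levelGap α A B (meanIntensity α A B (optimalMean α A B)) = 0 := by
  rw [meanIntensity_optimalMean hα hA hAB.le, levelGap_centerIntensity hα hA hAB]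

/-- If `c` is at most the optimal mean, the power mean is at most `centerIntensity`, the gap is
nonnegative, and a smaller mean only lowers the chord bound. Otherwise the optimal mean is feasible
and the gap is zero. The lower constraint is symmetric. -/
theorem capacity_and_center_familyLe (hα : 0 < α) (hA : 0 ≤ A) (hc : c ∈ Icc A B) :
    renyiCapacity α (familyLe T A B c) =
        ((meanCapacityRate α A B (min c (optimalMean α A B)) * T : ℝ) : EReal) ∧
      IsRenyiCenter α (familyLe T A B c)
        (poissonProcess T fun _ ↦ meanIntensity α A B (min c (optimalMean α A B))) := by
  have ho := optimalMean_mem hα hA (hc.1.trans hc.2)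
  have hm : min c (optimalMean α A B) ∈ Icc A B := ⟨le_min hc.1 ho.1, (min_le_left _ _).trans hc.2⟩
  refine capacity_and_center_of_isSaddle hα hA hm (isSaddle_const hα hA hm ?_ ?_)
  · rintro W ⟨f, hf, he, rfl⟩
    exact ⟨f, hf, he.le.trans (mul_le_mul_of_nonneg_left (min_le_left _ _) hT.out.le), rfl⟩
  rintro W ⟨f, hf, he, rfl⟩
  refine ⟨f, hf, rfl, fun hl _ h0 ↦ ?_, fun hl hp ↦ ?_⟩
  · rcases min_choice c (optimalMean α A B) with h | h
    · rw [h] at h0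
      rwa [h0, mul_zero] at he
    · exact absurd (h.symm.trans h0) (optimalMean_pos hα hA hl).ne'
  · rcases le_total c (optimalMean α A B) with h | h
    · rw [min_eq_left h] at hp ⊢
      refine mul_nonpos_of_nonneg_of_nonpos ?_ (sub_nonpos.2 he)
      have hle := meanIntensity_mono hα hA hc ho h
      rw [meanIntensity_optimalMean hα hA hl.le] at hle
      rcases hle.eq_or_lt with h' | h'
      · rw [h', levelGap_centerIntensity hα hA hl]
      · exact (levelGap_pos hα hA hl hp h').le
    · rw [min_eq_right h, levelGap_optimalMean hα hA hl, zero_mul]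

theorem capacity_and_center_familyGe (hα : 0 < α) (hA : 0 ≤ A) (hc : c ∈ Icc A B) :
    renyiCapacity α (familyGe T A B c) =
        ((meanCapacityRate α A B (max c (optimalMean α A B)) * T : ℝ) : EReal) ∧
      IsRenyiCenter α (familyGe T A B c)
        (poissonProcess T fun _ ↦ meanIntensity α A B (max c (optimalMean α A B))) := by
  have ho := optimalMean_mem hα hA (hc.1.trans hc.2)
  have hm : max c (optimalMean α A B) ∈ Icc A B := ⟨hc.1.trans (le_max_left _ _), max_le hc.2 ho.2⟩
  refine capacity_and_center_of_isSaddle hα hA hm (isSaddle_const hα hA hm ?_ ?_)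
  · rintro W ⟨f, hf, he, rfl⟩
    exact ⟨f, hf, (mul_le_mul_of_nonneg_left (le_max_left _ _) hT.out.le).trans he.ge, rfl⟩
  rintro W ⟨f, hf, he, rfl⟩
  refine ⟨f, hf, rfl, fun hl _ h0 ↦ ?_, fun hl hp ↦ ?_⟩
  · exact absurd h0 ((optimalMean_pos hα hA hl).trans_le (le_max_right _ _)).ne'
  · rcases le_total c (optimalMean α A B) with h | h
    · rw [max_eq_right h, levelGap_optimalMean hα hA hl, zero_mul]
    · rw [max_eq_left h] at hp ⊢
      refine mul_nonpos_of_nonpos_of_nonneg ?_ (sub_nonneg.2 he)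
      have hle := meanIntensity_mono hα hA ho hc h
      rw [meanIntensity_optimalMean hα hA hl.le] at hle
      rcases hle.eq_or_lt with h' | h'
      · rw [← h', levelGap_centerIntensity hα hA hl]
      · exact (levelGap_neg hα hA hl h').le

theorem capacity_and_center_family (hα : 0 < α) (hA : 0 ≤ A) (hAB : A ≤ B) :
    renyiCapacity α (family T A B) =
        ((meanCapacityRate α A B (optimalMean α A B) * T : ℝ) : EReal) ∧
      IsRenyiCenter α (family T A B)
        (poissonProcess T fun _ ↦ meanIntensity α A B (optimalMean α A B)) := by
  have ho := optimalMean_mem hα hA hAB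
  refine capacity_and_center_of_isSaddle hα hA ho (isSaddle_const hα hA ho ?_ ?_)
  · rintro W ⟨f, hf, -, rfl⟩
    exact ⟨f, hf, rfl⟩
  rintro W ⟨f, hf, rfl⟩
  refine ⟨f, hf, rfl, fun hl _ h0 ↦ absurd h0 (optimalMean_pos hα hA hl).ne', fun hl _ ↦ ?_⟩
  rw [levelGap_optimalMean hα hA hl, zero_mul]

theorem renyiDivergence_const {x q : ℝ} (hα : 0 < α) (hx : 0 ≤ x) (hq : 0 < q) :
    renyiDivergence α (poissonProcess T fun _ ↦ x) (poissonProcess T fun _ ↦ q) =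
      ((localDiv α x q * T : ℝ) : EReal) := by
  rw [renyiDivergence_poissonProcess (K := x / q) hα (by positivity) measurable_const
    measurable_const (fun _ ↦ hx) (fun _ ↦ hq.le) (fun _ ↦ (div_mul_cancel₀ x hq.ne').ge) (by simp)]
  simp [hT.out.le, mul_comm]

theorem renyiDivergence_zero (hα : 0 < α) :
    renyiDivergence α (poissonProcess T fun _ ↦ 0) (poissonProcess T fun _ ↦ 0) = 0 := by
  rw [renyiDivergence_poissonProcess (K := 0) hα le_rfl measurable_const
    measurable_const (fun _ ↦ le_rfl) (fun _ ↦ le_rfl) (fun _ ↦ by simp) (by simp)]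
  simp [localDiv_zero_zero hα]

/-- The capacity is the average of the divergences of the two levels. -/
theorem coe_meanCapacityRate (hα : 0 < α) (hA : 0 ≤ A) (hc : c ∈ Icc A B) :
    ((meanCapacityRate α A B c * T : ℝ) : EReal) =
      (((c - A) / (B - A) : ℝ) : EReal) * renyiDivergence α (poissonProcess T fun _ ↦ B)
          (poissonProcess T fun _ ↦ meanIntensity α A B c) +
        (((B - c) / (B - A) : ℝ) : EReal) * renyiDivergence α (poissonProcess T fun _ ↦ A)
          (poissonProcess T fun _ ↦ meanIntensity α A B c) := by
  have hAB := hc.1.trans hc.2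
  have e := congrFun (infoRate_weight (T := T) (c := fun _ ↦ c) hα (fun _ ↦ hc)
    (constantLevels hA hc)) 0
  rw [infoRate, powMean_weight (c := fun _ ↦ c) hα (fun _ ↦ hA) fun _ ↦ hc] at e
  dsimp only at e
  rcases hAB.eq_or_lt with he | hl
  -- For `A = B` both weights are quotients by zero, hence zero, in agreement with the capacity.
  · rw [meanCapacityRate, if_pos he, he, sub_self, div_zero, div_zero]
    simp
  rw [one_sub_weight hl] at e
  rw [← e]
  rcases lt_or_ge 0 (meanIntensity α A B c) with hp | hp
  · rw [renyiDivergence_const hα (hA.trans hAB) hp, renyiDivergence_const hα hA hp]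
    norm_cast
    ring
  · obtain ⟨hA0, hc0⟩ := eq_zero_of_meanIntensity hα hA hl hc hp
    have hq0 : meanIntensity α A B c = 0 := le_antisymm hp (hA.trans (meanIntensity_mem hα hA hc).1)
    rw [hq0, hA0, hc0, renyiDivergence_zero hα, localDiv_zero_zero hα]
    simp

end ConstantLevels

/-! ### Families below an integrable function -/

section VariableLevel

variable {T α A : ℝ} {g g' : ℝ → ℝ}

theorem measurable_optimalMean : Measurable (optimalMean α A) := by
  have e : optimalMean α A = fun B ↦ if A = B then A else (if α = 1 then
      Real.exp (-1) * B ^ (B / (B - A)) * A ^ (-(A / (B - A)))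
      else α ^ (α / (1 - α)) * ((B - A) / (B ^ α - A ^ α)) ^ (1 / (1 - α))
        + (A * B ^ α - B * A ^ α) / (B ^ α - A ^ α)) := rfl
  rw [e]
  refine Measurable.ite (measurableSet_eq_fun measurable_const measurable_id) measurable_const ?_
  split_ifs <;> fun_prop

theorem levels_optimalMean (hα : 0 < α) (hA : 0 ≤ A) (hg : Measurable g') (hAg : ∀ t, A ≤ g' t)
    (hi : IntegrableOn g' (Ioc 0 T)) : AdmissibleLevels T (fun _ ↦ A) g'
      fun t ↦ (optimalMean α A (g' t) - A) / (g' t - A) :=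
  admissibleLevels_weight (c := fun t ↦ optimalMean α A (g' t)) measurable_const hg
    (measurable_optimalMean.comp hg) (fun _ ↦ hA) (fun t ↦ optimalMean_mem hα hA (hAg t)) hi



/-- At `centerIntensity` the chord is flat, so by convexity no level in between is farther than the
endpoints. This gives the saddle inequality at each time separately, without any constraint on the
integral. -/
theorem localDiv_centerIntensity_mem {B x : ℝ} (hα : 0 < α) (hA : 0 ≤ A) (hx : x ∈ Icc A B) :
    localDiv α x (centerIntensity α A B) ∈ Icc 0 (localDiv α A (centerIntensity α A B)) := by
  rcases (hx.1.trans hx.2).eq_or_lt with he | hl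
  · have : x = A := le_antisymm (hx.2.trans he.ge) hx.1
    rw [centerIntensity, if_pos he, this, localDiv_self hα hA]
    exact ⟨le_rfl, le_rfl⟩
  · have hp := centerIntensity_pos hα hA hl
    refine ⟨localDiv_nonneg hα (hA.trans hx.1) hp, ?_⟩
    have := localDiv_le_chord hα hA hl hx hp
    rwa [levelGap_centerIntensity hα hA hl, mul_zero, add_zero] at this

theorem powMean_optimalMean (hα : 0 < α) (hA : 0 ≤ A) (hAg : ∀ t, A ≤ g' t) :
    powMean α (fun _ ↦ A) g' (fun t ↦ (optimalMean α A (g' t) - A) / (g' t - A)) =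
      fun t ↦ centerIntensity α A (g' t) := by
  rw [powMean_weight (c := fun t ↦ optimalMean α A (g' t)) hα (fun _ ↦ hA)
    fun t ↦ optimalMean_mem hα hA (hAg t)]
  exact funext fun t ↦ meanIntensity_optimalMean hα hA (hAg t)

theorem infoRate_optimalMean (hα : 0 < α) (hA : 0 ≤ A) (hg : Measurable g') (hAg : ∀ t, A ≤ g' t)
    (hi : IntegrableOn g' (Ioc 0 T)) :
    infoRate α (fun _ ↦ A) g' (fun t ↦ (optimalMean α A (g' t) - A) / (g' t - A)) =
      fun t ↦ capacityRate α A (g' t) := by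
  rw [infoRate_weight (c := fun t ↦ optimalMean α A (g' t)) hα
    (fun t ↦ optimalMean_mem hα hA (hAg t)) (levels_optimalMean hα hA hg hAg hi)]
  exact funext fun t ↦ (capacityRate_eq hα hA (hAg t)).symm

theorem isSaddle_familyFun (hα : 0 < α) (hA : 0 ≤ A) (hAg : ∀ t ∈ Ioc 0 T, A ≤ g t)
    (hg' : Measurable g') (hAg' : ∀ t, A ≤ g' t) (hi : IntegrableOn g' (Ioc 0 T))
    (hgg : g =ᵐ[volume.restrict (Ioc 0 T)] g') :
    IsSaddle α T (fun _ ↦ A) g' (fun t ↦ (optimalMean α A (g' t) - A) / (g' t - A))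
      (familyFun T A g) := by
  have hL := levels_optimalMean hα hA hg' hAg' hi
  have hq := congrFun (powMean_optimalMean hα hA hAg')
  refine ⟨hL, fun N u ↦ ?_, fun W hW ↦ ?_⟩
  · set f := shiftIntensity T N (fun _ ↦ A) g'
      (fun t ↦ (optimalMean α A (g' t) - A) / (g' t - A)) u with hf
    have hfm : ∀ t, f t ∈ Icc A (g' t) := shiftIntensity_mem hL.le u
    have hfi : IntegrableOn f (Ioc 0 T) := shiftIntensity_integrableOn hL.measurable_a
      hL.measurable_b hL.measurable_w hL.nonneg hL.le hL.integrableOn u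
    -- The shift intensity lies below the measurable version `g'`, whereas membership asks for a
    -- bound by `g` at every time; cutting at `g` changes it only on a null set.
    have hff : f =ᵐ[volume.restrict (Ioc 0 T)] fun t ↦ min (f t) (g t) := by
      filter_upwards [hgg] with t ht
      rw [ht, min_eq_left (hfm t).2]
    exact ⟨fun t ↦ min (f t) (g t), hfi.congr hff, fun t ht ↦
      ⟨le_min (hfm t).1 (hAg t ht), min_le_right _ _⟩, poissonProcess_congr hff⟩
  · obtain ⟨f, hfi, hfm, rfl⟩ := hW
    have hae : ∀ᵐ t ∂volume.restrict (Ioc 0 T), f t ∈ Icc A (g' t) := by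
      filter_upwards [hgg, (ae_restrict_iff' measurableSet_Ioc).2 (Eventually.of_forall hfm)]
        with t ht h
      exact ⟨h.1, h.2.trans ht.le⟩
    obtain ⟨f', hf'm, hf'b, hff⟩ := exists_measurable_version (T := T) measurable_const hg' hAg'
      hfi hae
    obtain ⟨k, hk, hkB⟩ := exists_mul_le_centerIntensity hα
    -- The factor `1 / k` works where `A < g'`, uniformly in `g'` although it may be unbounded; the
    -- factor `1` works where `g' = A` and the center equals `A`.
    refine ⟨f', max 1 (1 / k), zero_le_one.trans (le_max_left _ _), hf'm,
      fun t ↦ hA.trans (hf'b t).1, fun t ↦ ?_, poissonProcess_congr hff, ?_⟩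
    · rw [hq]
      refine (hf'b t).2.trans ?_
      rcases (hAg' t).eq_or_lt with he | hl
      · rw [centerIntensity, if_pos he, ← he]
        exact le_mul_of_one_le_left hA (le_max_left _ _)
      · calc g' t = 1 / k * (k * g' t) := by field_simp
          _ ≤ 1 / k * centerIntensity α A (g' t) :=
            mul_le_mul_of_nonneg_left (hkB A (g' t) hA hl) (by positivity)
          _ ≤ _ := mul_le_mul_of_nonneg_right (le_max_right _ _)
            (powMean_nonneg hL hα t |>.trans_eq (hq t))
    · refine integral_mono_of_nonneg (Eventually.of_forall fun t ↦ ?_)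
        (infoRate_integrableOn hL hα) (Eventually.of_forall fun t ↦ ?_)
      · simp only [hq, Pi.zero_apply]
        exact (localDiv_centerIntensity_mem hα hA (hf'b t)).1
      · dsimp only
        rw [infoRate_eq_levelGap, hq]
        refine (localDiv_centerIntensity_mem hα hA (hf'b t)).2.trans_eq ?_
        rcases (hAg' t).eq_or_lt with he | hl
        · rw [← he, sub_self, div_zero, zero_mul, add_zero]
        · rw [levelGap_centerIntensity hα hA hl, mul_zero, add_zero]

theorem capacity_and_center_familyFun [Fact (0 < T)] (hα : 0 < α) (hA : 0 ≤ A) (hi : IntegrableOn g (Ioc 0 T))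
    (hAg : ∀ t ∈ Ioc 0 T, A ≤ g t) :
    IntegrableOn (fun t ↦ capacityRate α A (g t)) (Ioc 0 T) ∧
      IntegrableOn (fun t ↦ centerIntensity α A (g t)) (Ioc 0 T) ∧
      renyiCapacity α (familyFun T A g) =
        ((∫ t in Ioc 0 T, capacityRate α A (g t) : ℝ) : EReal) ∧
      IsRenyiCenter α (familyFun T A g) (poissonProcess T fun t ↦ centerIntensity α A (g t)) := by
  have hm := hi.1.aemeasurable
  obtain ⟨g', hg', hAg', hgg⟩ : ∃ g' : ℝ → ℝ, Measurable g' ∧ (∀ t, A ≤ g' t) ∧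
      g =ᵐ[volume.restrict (Ioc 0 T)] g' := by
    refine ⟨fun t ↦ max A (hm.mk g t), measurable_const.max hm.measurable_mk,
      fun t ↦ le_max_left _ _, ?_⟩
    filter_upwards [hm.ae_eq_mk, (ae_restrict_iff' measurableSet_Ioc).2 (Eventually.of_forall hAg)]
      with t ht h
    rw [← ht, max_eq_right h]
  have hi' : IntegrableOn g' (Ioc 0 T) := hi.congr hgg
  have hS := isSaddle_familyFun hα hA hAg hg' hAg' hi' hgg
  have h1 : (fun t ↦ capacityRate α A (g' t)) =ᵐ[volume.restrict (Ioc 0 T)]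
      fun t ↦ capacityRate α A (g t) := by
    filter_upwards [hgg] with t ht
    rw [ht]
  have h2 : (fun t ↦ centerIntensity α A (g' t)) =ᵐ[volume.restrict (Ioc 0 T)]
      fun t ↦ centerIntensity α A (g t) := by
    filter_upwards [hgg] with t ht
    rw [ht]
  have e1 := infoRate_optimalMean hα hA hg' hAg' hi'
  have e2 := powMean_optimalMean hα hA hAg'
  have i1 := infoRate_integrableOn hS.levels hα
  have i2 := powMean_integrableOn hS.levels hα
  have hC := hS.renyiCapacity_eq hα
  have hZ := hS.isRenyiCenter hα
  rw [e1] at i1 hC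
  rw [e2] at i2 hZ
  rw [integral_congr_ae h1] at hC
  rw [poissonProcess_congr h2] at hZ
  exact ⟨i1.congr h1, i2.congr h2, hC, hZ⟩

end VariableLevel
end RenyiPoisson

/-! ### The main theorem -/

open RenyiPoisson in
theorem mainTheorem12 (T : ℝ) (hT : 0 < T) (α : ℝ) (hα : 0 < α) :
    -- intensities between two constants `A ≤ B`
    (∀ A B : ℝ, 0 ≤ A → A ≤ B →
      optimalMean α A B ∈ Set.Icc A B ∧
      -- the mean intensity is `c`, at most `c`, at least `c`
      (∀ c ∈ Set.Icc A B,
        (renyiCapacity α (familyEq T A B c) = ((meanCapacityRate α A B c * T : ℝ) : EReal) ∧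
          IsRenyiCenter α (familyEq T A B c)
            (poissonProcess T fun _ ↦ meanIntensity α A B c) ∧
          renyiCapacity α (familyEq T A B c) =
            (((c - A) / (B - A) : ℝ) : EReal) *
                renyiDivergence α (poissonProcess T fun _ ↦ B)
                  (poissonProcess T fun _ ↦ meanIntensity α A B c) +
              (((B - c) / (B - A) : ℝ) : EReal) *
                renyiDivergence α (poissonProcess T fun _ ↦ A)
                  (poissonProcess T fun _ ↦ meanIntensity α A B c)) ∧
        (renyiCapacity α (familyLe T A B c) =
            renyiCapacity α (familyEq T A B (min c (optimalMean α A B))) ∧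
          renyiCapacity α (familyLe T A B c) =
            ((meanCapacityRate α A B (min c (optimalMean α A B)) * T : ℝ) : EReal) ∧
          IsRenyiCenter α (familyLe T A B c)
            (poissonProcess T fun _ ↦ meanIntensity α A B (min c (optimalMean α A B))) ∧
          ∀ Q, IsRenyiCenter α (familyLe T A B c) Q ↔
            IsRenyiCenter α (familyEq T A B (min c (optimalMean α A B))) Q) ∧
        (renyiCapacity α (familyGe T A B c) =
            renyiCapacity α (familyEq T A B (max c (optimalMean α A B))) ∧
          renyiCapacity α (familyGe T A B c) =
            ((meanCapacityRate α A B (max c (optimalMean α A B)) * T : ℝ) : EReal) ∧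
          IsRenyiCenter α (familyGe T A B c)
            (poissonProcess T fun _ ↦ meanIntensity α A B (max c (optimalMean α A B))) ∧
          ∀ Q, IsRenyiCenter α (familyGe T A B c) Q ↔
            IsRenyiCenter α (familyEq T A B (max c (optimalMean α A B))) Q)) ∧
      -- no constraint on the mean intensity
      (renyiCapacity α (family T A B) =
          renyiCapacity α (familyEq T A B (optimalMean α A B)) ∧
        renyiCapacity α (family T A B) = ((capacityRate α A B * T : ℝ) : EReal) ∧
        IsRenyiCenter α (family T A B) (poissonProcess T fun _ ↦ centerIntensity α A B) ∧
        (∀ Q, IsRenyiCenter α (family T A B) Q ↔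
          IsRenyiCenter α (familyEq T A B (optimalMean α A B)) Q) ∧
        centerIntensity α A B = meanIntensity α A B (optimalMean α A B) ∧
        renyiCapacity α (family T A B) =
          (((optimalMean α A B - A) / (B - A) : ℝ) : EReal) *
              renyiDivergence α (poissonProcess T fun _ ↦ B)
                (poissonProcess T fun _ ↦ centerIntensity α A B) +
            (((B - optimalMean α A B) / (B - A) : ℝ) : EReal) *
              renyiDivergence α (poissonProcess T fun _ ↦ A)
                (poissonProcess T fun _ ↦ centerIntensity α A B))) ∧
    -- intensities between a constant `A` and an integrable function `g`
    (∀ (A : ℝ) (g : ℝ → ℝ), 0 ≤ A → MeasureTheory.IntegrableOn g (Set.Ioc 0 T) →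
      (∀ t ∈ Set.Ioc 0 T, A ≤ g t) →
      MeasureTheory.IntegrableOn (fun t ↦ capacityRate α A (g t)) (Set.Ioc 0 T) ∧
      MeasureTheory.IntegrableOn (fun t ↦ centerIntensity α A (g t)) (Set.Ioc 0 T) ∧
      renyiCapacity α (familyFun T A g) =
        ((∫ t in Set.Ioc 0 T, capacityRate α A (g t) : ℝ) : EReal) ∧
      IsRenyiCenter α (familyFun T A g) (poissonProcess T fun t ↦ centerIntensity α A (g t))) := by
  have : Fact (0 < T) := ⟨hT⟩
  refine ⟨fun A B hA hAB ↦ ?_, fun A g hA hg hAg ↦ capacity_and_center_familyFun hα hA hg hAg⟩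
  have ho := optimalMean_mem hα hA hAB
  have hEo := capacity_and_center_familyEq (T := T) hα hA ho
  have hF := capacity_and_center_family (T := T) hα hA hAB
  have hp := meanIntensity_optimalMean hα hA hAB
  refine ⟨ho, fun c hc ↦ ⟨?_, ?_, ?_⟩, ?_⟩
  · obtain ⟨h1, h2⟩ := capacity_and_center_familyEq (T := T) hα hA hc
    exact ⟨h1, h2, h1.trans (coe_meanCapacityRate hα hA hc)⟩
  · have hm : min c (optimalMean α A B) ∈ Set.Icc A B :=
      ⟨le_min hc.1 ho.1, (min_le_left _ _).trans hc.2⟩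
    obtain ⟨h1, h2⟩ := capacity_and_center_familyEq (T := T) hα hA hm
    obtain ⟨h3, h4⟩ := capacity_and_center_familyLe (T := T) hα hA hc
    exact ⟨h3.trans h1.symm, h3, h4, fun Q ↦ (h4.iff_eq Q).trans (h2.iff_eq Q).symm⟩
  · have hm : max c (optimalMean α A B) ∈ Set.Icc A B :=
      ⟨hc.1.trans (le_max_left _ _), max_le hc.2 ho.2⟩
    obtain ⟨h1, h2⟩ := capacity_and_center_familyEq (T := T) hα hA hm
    obtain ⟨h3, h4⟩ := capacity_and_center_familyGe (T := T) hα hA hc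
    exact ⟨h3.trans h1.symm, h3, h4, fun Q ↦ (h4.iff_eq Q).trans (h2.iff_eq Q).symm⟩
  · refine ⟨hF.1.trans hEo.1.symm, ?_, hp ▸ hF.2, fun Q ↦
      (hF.2.iff_eq Q).trans (hEo.2.iff_eq Q).symm, hp.symm, ?_⟩
    · rw [hF.1, capacityRate_eq hα hA hAB]
    · rw [hF.1, coe_meanCapacityRate hα hA ho, hp]
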